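/- An MT-space is a set $X$ with a topology and a $\sigma$-algebra (not necessarily related). A measurable chart of $X$ is a homeomorphism $\varphi:U\to P\times T$, measurable in both directions, where $U\subset X$ is open and measurable, $P$ is a connected, locally path connected, locally compact Polish space with its Borel sets, and $T$ is a standard Borel space with the discrete topology. A measurable lamination is an MT-space covered by the domains of countably many measurable charts; its leaves are its connected components (they are open). A transversal is a measurable subset of $X$ meeting each leaf in a countable set. Let $\Gamma$ be an abelian group (for instance the additive group of a unitary ring) that is a standard Borel space with measurable addition and inversion. *Singular cohomology.* A measurable singular $n$-simplex is a map $\sigma:\Delta^n\times T\to X$, with $T$ a standard Borel space, that is measurable and is continuous on each $\Delta^n\times\{t\}$. A singular $n$-cochain $\omega$ of $X$ with values in $\Gamma$ is measurable if $t\mapsto\omega(\sigma|_{\Delta^n\times\{t\}})$ is measurable for every measurable singular $n$-simplex $\sigma$. With the usual singular coboundary the measurable cochains form a complex, and $H^n_{MT}(X,\Gamma)$ is its $n$-th cohomology group. *Simplicial cohomology.* A measurable triangulation $\mathcal T$ of $X$ is a family of triangulations of the leaves, each closed $n$-simplex with barycenter $b$ coming with an affine parametrization $\sigma^n_b:\Delta^n\to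 X$, such that for every $n$ the set $B^n\subset X$ of barycenters of $n$-simplices is a transversal and the map $\Delta^n\times B^n\to X$, $(x,b)\mapsto\sigma^n_b(x)$, is measurable. (No compatibility between the vertex numberings of different simplices is assumed.) A measurable simplicial $n$-cochain is a measurable map $\omega:B^n\to\Gamma$, and $$\delta\omega(b)=\sum_{p}[b:p]\,\omega(p),\qquad b\in B^{n+1},$$ where the sum is over the barycenters $p$ of the $n$-dimensional faces of the simplex of $b$, and $[b:p]=\pm1$ is $1$ exactly if the orientation of the simplex of $p$ given by $\sigma^n_p$ agrees with the one induced by the orientation $\sigma^{n+1}_b$. The $n$-th cohomology group of this complex is $H^n(\mathcal T,\Gamma)$. **Proposition.** Let $X$ be a measurable lamination and $\mathcal T$ a measurable triangulation of $X$. Then $H^n_{MT}(X,\Gamma)\cong H^n(\mathcal T,\Gamma)$ as abelian groups for every $n\ge 0$. Consequently, for any two measurable triangulations $\mathcal T,\mathcal T'$ of $X$, $H^n(\mathcal T,\Gamma)\cong H^n(\mathcal T',\Gamma)$ for every $n\ge0$. -/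

import Mathlib

universe u v

noncomputable section

namespace MTSpace

/-! ### Measurable laminations

An MT-space is a type with a `TopologicalSpace` and an unrelated `MeasurableSpace` structure. -/

/-- A measurable chart of an MT-space `X`: a homeomorphism, measurable in both directions, from an
open measurable set onto `P × T`, where `P` is a connected, locally path connected, locally compact
Polish space with its Borel sets, and `T` is a standard Borel space with the discrete topology. -/
structure MeasurableChart (X : Type u) [TopologicalSpace X] [MeasurableSpace X] where
  source : Set X
  isOpen_source : IsOpen source
  measurableSet_source : MeasurableSet source
  P : Type u
  [topP : TopologicalSpace P]
  [polishP : PolishSpace P]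
  [locallyCompactP : LocallyCompactSpace P]
  [connectedP : ConnectedSpace P]
  [locPathConnectedP : LocallyPathConnectedSpace P]
  [measP : MeasurableSpace P]
  [borelP : BorelSpace P]
  T : Type u
  [measT : MeasurableSpace T]
  [standardT : StandardBorelSpace T]
  [topT : TopologicalSpace T]
  [discreteT : DiscreteTopology T]
  toHomeomorph : source ≃ₜ P × T
  measurable_toFun : Measurable toHomeomorph
  measurable_invFun : Measurable toHomeomorph.symm

/-- A measurable lamination is an MT-space that is covered by the domains of countably many
measurable charts. -/
def IsMeasurableLamination (X : Type u) [TopologicalSpace X] [MeasurableSpace X] : Prop :=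
  ∃ 𝒰 : Set (MeasurableChart X), 𝒰.Countable ∧ ⋃ c ∈ 𝒰, c.source = Set.univ

/-- A transversal: a measurable set meeting each leaf (connected component) in a countable set. -/
def IsTransversal {X : Type u} [TopologicalSpace X] [MeasurableSpace X] (S : Set X) : Prop :=
  MeasurableSet S ∧ ∀ x : X, (S ∩ connectedComponent x).Countable

/-! ### The standard simplex -/

/-- The canonical `n`-simplex, with the topology and the Borel sets induced from `ℝⁿ⁺¹`. -/
abbrev Simplex (n : ℕ) : Type := stdSimplex ℝ (Fin (n + 1))

/-- The affine map of simplices given on vertices by `f`. -/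
def simplexMap {m n : ℕ} (f : Fin (m + 1) → Fin (n + 1)) : C(Simplex m, Simplex n) where
  toFun := stdSimplex.map f
  continuous_toFun := stdSimplex.continuous_map f

/-- The `i`-th face inclusion, omitting the `i`-th vertex. -/
def faceMap {n : ℕ} (i : Fin (n + 2)) : C(Simplex n, Simplex (n + 1)) :=
  simplexMap i.succAbove

/-! ### Measurable singular cohomology -/

section Singular

variable (X : Type u) [TopologicalSpace X] [MeasurableSpace X]

/-- A family of singular simplices parametrized by a measurable space `T` is a measurable singular
simplex if it is measurable as a map `Δⁿ × T → X`. As `T` carries the discrete topology, the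
continuity of that map is the continuity of each member of the family. -/
def IsMeasurableSimplex {X : Type u} [TopologicalSpace X] [MeasurableSpace X]
    {n : ℕ} {T : Type u} [MeasurableSpace T] (σ : T → C(Simplex n, X)) : Prop :=
  Measurable fun p : Simplex n × T => σ p.2 p.1

variable (Γ : Type v) [AddCommGroup Γ]

/-- The singular coboundary `(δω)(σ) = ∑ᵢ (-1)ⁱ ω(σ ∘ dᵢ)` on all singular cochains, where singular
`n`-cochains are the functions on singular `n`-simplices. -/
def singularCoboundary (n : ℕ) : (C(Simplex n, X) → Γ) →+ (C(Simplex (n + 1), X) → Γ) where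
  toFun ω σ := ∑ i : Fin (n + 2), ((-1 : ℤ) ^ (i : ℕ)) • ω (σ.comp (faceMap i))
  map_zero' := by ext; simp
  map_add' := by intros; ext; simp [Finset.sum_add_distrib]

variable [MeasurableSpace Γ] [MeasurableAdd₂ Γ] [MeasurableNeg Γ]

/-- The measurable singular `n`-cochains: those `ω` for which `t ↦ ω (σ t)` is measurable for each
measurable singular `n`-simplex `σ : Δⁿ × T → X`, with `T` any standard Borel space. -/
def singularCochains (n : ℕ) : AddSubgroup (C(Simplex n, X) → Γ) where
  carrier := {ω | ∀ (T : Type u) [MeasurableSpace T] [StandardBorelSpace T]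
    (σ : T → C(Simplex n, X)), IsMeasurableSimplex σ → Measurable fun t => ω (σ t)}
  zero_mem' := fun _ _ _ _ _ => measurable_const
  add_mem' := fun ha hb T _ _ σ hσ => (ha T σ hσ).add (hb T σ hσ)
  neg_mem' := fun ha T _ _ σ hσ => (ha T σ hσ).neg

/-- Measurable singular cocycles. -/
def singularCocycles (n : ℕ) : AddSubgroup (C(Simplex n, X) → Γ) :=
  singularCochains X Γ n ⊓ (singularCoboundary X Γ n).ker

/-- Coboundaries of measurable singular cochains. -/
def singularCoboundaries : (n : ℕ) → AddSubgroup (C(Simplex n, X) → Γ)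
  | 0 => ⊥
  | n + 1 => (singularCochains X Γ n).map (singularCoboundary X Γ n)

/-- The measurable singular cohomology group `Hⁿ_MT(X, Γ) = Ker δₙ / Im δₙ₋₁`. -/
abbrev SingularCohomology (n : ℕ) : Type (max u v) :=
  singularCocycles X Γ n ⧸
    (singularCoboundaries X Γ n).addSubgroupOf (singularCocycles X Γ n)

end Singular

/-! ### Measurable triangulations and measurable simplicial cohomology -/

/-- A triangulation of a topological space `X`, given by the affine parametrizations of its closed
simplices; a simplex is named by its barycenter. The first fields say that `X` is the disjoint union
of the open simplices, that each face of a simplex is a simplex (up to a renumbering of vertices),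
that simplices are embedded and determined by their vertices, and that `X` has the weak topology;
that is, `X` is homeomorphic to the geometric realization of an abstract simplicial complex by a
homeomorphism that is given on each simplex by these parametrizations. In a lamination the leaves
are open and each simplex lies in one leaf, so that a triangulation of `X` is the same as a
family of triangulations, one of each leaf. -/
structure Triangulation (X : Type u) [TopologicalSpace X] where
  /-- The set of barycenters of the `n`-simplices. -/
  B : ℕ → Set X
  /-- The parametrization of the `n`-simplex with barycenter `b`. -/
  simplex : (n : ℕ) → B n → C(Simplex n, X)
  simplex_barycenter : ∀ (n : ℕ) (b : B n), simplex n b stdSimplex.barycenter = b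
  simplex_injective : ∀ (n : ℕ) (b : B n), Function.Injective (simplex n b)
  existsUnique_open_simplex : ∀ x : X, ∃! s : Σ n : ℕ, B n × Simplex n,
    (∀ j, 0 < s.2.2 j) ∧ simplex s.1 s.2.1 s.2.2 = x
  exists_face : ∀ (n : ℕ) (b : B (n + 1)) (i : Fin (n + 2)),
    ∃ (q : B n) (π : Equiv.Perm (Fin (n + 1))),
      ∀ x : Simplex n, simplex (n + 1) b (faceMap i x) = simplex n q (simplexMap π x)
  eq_of_vertices_eq : ∀ (n : ℕ) (b b' : B n),
    (Set.range fun j => simplex n b (stdSimplex.vertex j)) =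
      (Set.range fun j => simplex n b' (stdSimplex.vertex j)) → b = b'
  isClosed_of_preimage : ∀ A : Set X, (∀ (n : ℕ) (b : B n), IsClosed (simplex n b ⁻¹' A)) →
    IsClosed A

/-- A measurable triangulation of an MT-space `X`: a triangulation whose sets of barycenters are
transversals and whose parametrizations `Δⁿ × Bⁿ → X` are measurable. No numbering of the vertices
of a simplex is required to be compatible with those of its faces. -/
structure MeasurableTriangulation (X : Type u) [TopologicalSpace X] [MeasurableSpace X]
    extends Triangulation X where
  isTransversal : ∀ n : ℕ, IsTransversal (B n)
  measurable_simplex : ∀ n : ℕ, Measurable fun p : Simplex n × B n => simplex n p.2 p.1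

namespace Triangulation

variable {X : Type u} [TopologicalSpace X] (𝒯 : Triangulation X)

/-- The face of `b` opposite to its `i`-th vertex; it is unique. -/
def face {n : ℕ} (b : 𝒯.B (n + 1)) (i : Fin (n + 2)) : 𝒯.B n :=
  (𝒯.exists_face n b i).choose

/-- The permutation by which the numbering of the vertices of the `i`-th face of `b` that is
inherited from `b` differs from the numbering of that face as a simplex; it is unique. -/
def facePerm {n : ℕ} (b : 𝒯.B (n + 1)) (i : Fin (n + 2)) : Equiv.Perm (Fin (n + 1)) :=
  (𝒯.exists_face n b i).choose_spec.choose

/-- The incidence number: `1` if the orientation of the `i`-th face of `b` agrees with the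
orientation induced by `b`, and `-1` otherwise. -/
def incidence {n : ℕ} (b : 𝒯.B (n + 1)) (i : Fin (n + 2)) : ℤ :=
  (-1) ^ (i : ℕ) * (Equiv.Perm.sign (𝒯.facePerm b i) : ℤ)

variable (Γ : Type v) [AddCommGroup Γ]

/-- The simplicial coboundary: the sum over the faces of a simplex, with incidence numbers. -/
def coboundary (n : ℕ) : (𝒯.B n → Γ) →+ (𝒯.B (n + 1) → Γ) where
  toFun ω b := ∑ i : Fin (n + 2), 𝒯.incidence b i • ω (𝒯.face b i)
  map_zero' := by ext; simp
  map_add' := by intros; ext; simp [Finset.sum_add_distrib]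

end Triangulation

namespace MeasurableTriangulation

variable {X : Type u} [TopologicalSpace X] [MeasurableSpace X] (𝒯 : MeasurableTriangulation X)
variable (Γ : Type v) [AddCommGroup Γ] [MeasurableSpace Γ] [MeasurableAdd₂ Γ] [MeasurableNeg Γ]

/-- The measurable simplicial `n`-cochains: measurable maps `Bⁿ → Γ`. -/
def cochains (n : ℕ) : AddSubgroup (𝒯.B n → Γ) where
  carrier := {ω | Measurable ω}
  zero_mem' := measurable_const
  add_mem' := fun ha hb => Measurable.add ha hb
  neg_mem' := fun ha => Measurable.neg ha

/-- Measurable simplicial cocycles. -/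
def cocycles (n : ℕ) : AddSubgroup (𝒯.B n → Γ) :=
  𝒯.cochains Γ n ⊓ (𝒯.coboundary Γ n).ker

/-- Coboundaries of measurable simplicial cochains. -/
def coboundaries : (n : ℕ) → AddSubgroup (𝒯.B n → Γ)
  | 0 => ⊥
  | n + 1 => (𝒯.cochains Γ n).map (𝒯.coboundary Γ n)

/-- The measurable simplicial cohomology group `Hⁿ(𝒯, Γ) = Ker δₙ / Im δₙ₋₁`. -/
abbrev Cohomology (n : ℕ) : Type (max u v) :=
  𝒯.cocycles Γ n ⧸ (𝒯.coboundaries Γ n).addSubgroupOf (𝒯.cocycles Γ n)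

end MeasurableTriangulation

end MTSpace

end

noncomputable section

namespace MTSpace

open FreeAbelianGroup

/-! ### Permutations and alternating functions -/

/-! The comparison map evaluates singular cochains on the simplices of the triangulation. Since
vertex numberings need not match on faces, each simplex is first renumbered along a Borel injection
`r : X → ℝ` and given the sign of the renumbering. Then faces of sorted simplices are again sorted,
and restriction is a cochain map (`boundary_sortedChain`). The injection exists because the charts
make `X` standard Borel.

In the other direction, every point has a dominant vertex, at which its barycentric coordinate is
largest. A simplicial cochain, extended alternatingly to tuples of points, is evaluated on the
dominant vertices of the vertices of a singular simplex. This is an exact right inverse of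
restriction, but it commutes with coboundaries only on small simplices, those that satisfy
`IsSmall`. On small simplices the identity is chain homotopic to simplicial approximation, the
homotopy being built from straight cones inside simplices of the triangulation
(`boundary_approxHtpy`).

The passage from small to arbitrary simplices is by barycentric subdivision: a cocycle that vanishes
on small simplices has an explicit primitive, the sum of its values on the successive subdivision
homotopies, which is a finite sum for each simplex (`singularCoboundary_primitive`). This primitive
corrects the extension of a simplicial cocycle to a singular cocycle (surjectivity). Likewise, a
singular cocycle restricting to zero differs on small simplices from zero only by the coboundary of
its evaluation on the approximation homotopy (injectivity).

All of these constructions must preserve measurability. The main tool is the Lusin–Souslin theorem,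
in the form of `measurable_of_injections`: open simplices, vertex tuples and joinable pairs are
covered by countably many measurable injections from standard Borel spaces, along which the
constructions are explicit. The primitive is measurable as a pointwise limit, although the required
number of subdivisions varies with the simplex. -/

theorem exists_perm_succAbove {n : ℕ} (π : Equiv.Perm (Fin (n + 1))) (i : Fin (n + 1)) :
    ∃ π' : Equiv.Perm (Fin n), (∀ j, π (i.succAbove j) = (π i).succAbove (π' j)) ∧
      (-1 : ℤ) ^ (i : ℕ) * (Equiv.Perm.sign π : ℤ) =
        (-1) ^ (π i : ℕ) * (Equiv.Perm.sign π' : ℤ) := by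
  -- The two cycles move `i` and `π i` to `0`, so `ρ` fixes `0` and `π'` is its action on the
  -- successors. The cycles have signs `(-1) ^ i` and `(-1) ^ (π i)`.
  set ρ : Equiv.Perm (Fin (n + 1)) := (π i).cycleRange * π * i.cycleRange⁻¹ with hρ
  obtain ⟨⟨p, e⟩, hpe⟩ := Equiv.Perm.decomposeFin.symm.surjective ρ
  have hρ0 : ρ 0 = 0 := by
    simp [hρ, Equiv.Perm.inv_def]
  have hp : p = 0 := by
    rw [← hpe, Equiv.Perm.decomposeFin_symm_apply_zero] at hρ0
    exact hρ0
  subst hp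
  refine ⟨e, fun j => ?_, ?_⟩
  · have h1 : ρ j.succ = (e j).succ := by
      rw [← hpe, Equiv.Perm.decomposeFin_symm_apply_succ]; simp
    have h2 : (π i).cycleRange (π (i.succAbove j)) = (e j).succ := by
      rw [← h1]; simp [hρ, Equiv.Perm.inv_def]
    rw [← Fin.cycleRange_symm_succ (π i), ← h2, Equiv.symm_apply_apply]
  · have h1 : Equiv.Perm.sign e = Equiv.Perm.sign ρ := by
      rw [← hpe, Equiv.Perm.decomposeFin.symm_sign]; simp
    rw [h1, hρ]
    simp only [Equiv.Perm.sign_mul, Equiv.Perm.sign_inv, Fin.sign_cycleRange]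
    push_cast
    have : ((-1 : ℤ) ^ ((π i : ℕ))) * (-1) ^ ((π i : ℕ)) = 1 := by
      rw [← mul_pow]; simp
    linear_combination (-(-1 : ℤ) ^ (i : ℕ) * (Equiv.Perm.sign π : ℤ)) * this

/-- A function on tuples is alternating if it is multiplied by the sign under permutations of the
entries, and vanishes on tuples with repeated entries. -/
structure IsAlternating {X G : Type*} [AddCommGroup G] {n : ℕ} (f : (Fin n → X) → G) : Prop where
  comp_perm : ∀ (w : Fin n → X) (π : Equiv.Perm (Fin n)),
    f (w ∘ π) = (Equiv.Perm.sign π : ℤ) • f w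
  eq_zero : ∀ w : Fin n → X, ¬ Function.Injective w → f w = 0

/-- The alternating sum over the faces of a tuple. -/
def tupleDelta {X G : Type*} [AddCommGroup G] {n : ℕ} (f : (Fin n → X) → G)
    (w : Fin (n + 1) → X) : G :=
  ∑ i : Fin (n + 1), (-1 : ℤ) ^ (i : ℕ) • f (w ∘ i.succAbove)

/-- Permuting the entries permutes the faces, with the signs of `exists_perm_succAbove`. If two
entries coincide, a face that keeps both vanishes, and the two faces omitting one of them differ by
a permutation whose sign makes them cancel. -/
theorem IsAlternating.tupleDelta {X G : Type*} [AddCommGroup G] {n : ℕ} {f : (Fin n → X) → G}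
    (hf : IsAlternating f) : IsAlternating (tupleDelta f) where
  comp_perm w π := by
    unfold MTSpace.tupleDelta
    rw [← Equiv.sum_comp π fun i => (-1 : ℤ) ^ (i : ℕ) • f (w ∘ i.succAbove), Finset.smul_sum]
    refine Finset.sum_congr rfl fun i _ => ?_
    obtain ⟨π', h, hs⟩ := exists_perm_succAbove π i
    have h1 : (w ∘ π) ∘ i.succAbove = (w ∘ (π i).succAbove) ∘ π' := by
      ext j; simp [h]
    rw [h1, hf.comp_perm, smul_smul, smul_smul]
    have h2 := Int.units_coe_mul_self (Equiv.Perm.sign π)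
    have h3 := Int.units_coe_mul_self (Equiv.Perm.sign π')
    congr 1
    linear_combination ((Equiv.Perm.sign π : ℤ) * Equiv.Perm.sign π') * hs -
      (-1) ^ (i : ℕ) * (Equiv.Perm.sign π' : ℤ) * h2 +
      (-1) ^ (π i : ℕ) * (Equiv.Perm.sign π : ℤ) * h3
  eq_zero w hw := by
    obtain ⟨i, j, hij, hne⟩ : ∃ i j, w i = w j ∧ i ≠ j := by
      simpa [Function.Injective] using hw
    -- Invariance under the transposition relates the faces omitting `i` and `j`, and its sign `-1`
    -- produces the cancellation.
    have hτ : w ∘ Equiv.swap i j = w := by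
      ext k
      rcases eq_or_ne k i with rfl | hi
      · simp [hij]
      · rcases eq_or_ne k j with rfl | hj
        · simp [hij]
        · simp [Equiv.swap_apply_of_ne_of_ne hi hj]
    obtain ⟨τ', h, hs⟩ := exists_perm_succAbove (Equiv.swap i j) i
    rw [Equiv.swap_apply_left, Equiv.Perm.sign_swap hne] at *
    have h1 : w ∘ i.succAbove = (w ∘ j.succAbove) ∘ τ' := by
      conv_lhs => rw [← hτ]
      ext k
      simp [h]
    have h3 := Int.units_coe_mul_self (Equiv.Perm.sign τ')
    unfold MTSpace.tupleDelta
    rw [Finset.sum_eq_add_of_mem i j (Finset.mem_univ _) (Finset.mem_univ _) hne, h1,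
      hf.comp_perm, smul_smul, ← add_smul]
    · have h4 : (-1 : ℤ) ^ (i : ℕ) * (Equiv.Perm.sign τ' : ℤ) + (-1) ^ (j : ℕ) = 0 := by
        push_cast at hs
        linear_combination (-(Equiv.Perm.sign τ' : ℤ)) * hs - (-1) ^ (j : ℕ) * h3
      rw [h4, zero_smul]
    · intro k _ hk
      rw [hf.eq_zero, smul_zero]
      intro hinj
      obtain ⟨i', rfl⟩ := Fin.exists_succAbove_eq hk.1.symm
      obtain ⟨j', rfl⟩ := Fin.exists_succAbove_eq hk.2.symm
      exact hne (congrArg _ (hinj hij))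

/-! ### Singular chains -/

/-- The singular `n`-chains with integral coefficients. -/
abbrev Chain (Y : Type*) [TopologicalSpace Y] (n : ℕ) : Type _ :=
  FreeAbelianGroup C(Simplex n, Y)

section Chain

variable {Y Z : Type*} [TopologicalSpace Y] [TopologicalSpace Z]

/-- The singular boundary. -/
def boundary (n : ℕ) : Chain Y (n + 1) →+ Chain Y n :=
  lift fun σ => ∑ i : Fin (n + 2), (-1 : ℤ) ^ (i : ℕ) • of (σ.comp (faceMap i))

theorem boundary_of {n : ℕ} (σ : C(Simplex (n + 1), Y)) :
    boundary n (of σ) = ∑ i : Fin (n + 2), (-1 : ℤ) ^ (i : ℕ) • of (σ.comp (faceMap i)) :=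
  lift_apply_of _ _

theorem simplexMap_comp {k m n : ℕ} (g : Fin (m + 1) → Fin (n + 1))
    (f : Fin (k + 1) → Fin (m + 1)) :
    (simplexMap g).comp (simplexMap f) = simplexMap (g ∘ f) := by
  ext1 x
  exact stdSimplex.map_comp_apply f g x

theorem simplexMap_id {n : ℕ} : simplexMap (id : Fin (n + 1) → Fin (n + 1)) = .id _ := by
  ext1 x
  exact stdSimplex.map_id_apply x

theorem boundary_boundary {n : ℕ} (z : Chain Y (n + 2)) :
    boundary n (boundary (n + 1) z) = 0 := by
  suffices h : (boundary n).comp (boundary (n + 1)) = (0 : Chain Y (n + 2) →+ Chain Y n) from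
    DFunLike.congr_fun h z
  refine lift_ext _ _ fun σ => ?_
  simp only [AddMonoidHom.comp_apply, AddMonoidHom.zero_apply, boundary_of, map_sum, map_zsmul,
    Finset.smul_sum, smul_smul, ContinuousMap.comp_assoc]
  rw [← Finset.sum_product']
  -- The involution exchanges the order in which two vertices are omitted; the parity of the sum of
  -- the two indices changes.
  refine Finset.sum_involution (fun p _ => (p.1.succAbove p.2, p.2.predAbove p.1)) ?_ ?_ ?_ ?_
  · rintro ⟨i, j⟩ -
    have h : (faceMap (i.succAbove j)).comp (faceMap (j.predAbove i)) =
        (faceMap i).comp (faceMap (n := n) j) := by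
      simp only [faceMap, simplexMap_comp]
      congr 1
      ext k
      simp [Fin.succAbove_succAbove_succAbove_predAbove]
    simp only [h, ← pow_add, Fin.neg_one_pow_succAbove_add_predAbove]
    simp
  · rintro ⟨i, j⟩ - - h
    exact Fin.succAbove_ne _ _ (congrArg Prod.fst h)
  · simp
  · rintro ⟨i, j⟩ -
    simp [Fin.succAbove_succAbove_predAbove, Fin.predAbove_predAbove_succAbove]

/-- The chain map induced by a continuous map. -/
def push (g : C(Y, Z)) (n : ℕ) : Chain Y n →+ Chain Z n :=
  FreeAbelianGroup.map g.comp

@[simp]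
theorem push_of (g : C(Y, Z)) {n : ℕ} (σ : C(Simplex n, Y)) : push g n (of σ) = of (g.comp σ) :=
  map_of_apply _

theorem boundary_push (g : C(Y, Z)) {n : ℕ} (z : Chain Y (n + 1)) :
    boundary n (push g (n + 1) z) = push g n (boundary n z) := by
  suffices h : (boundary n).comp (push g (n + 1)) = (push g n).comp (boundary n) from
    DFunLike.congr_fun h z
  refine lift_ext _ _ fun σ => ?_
  simp [boundary_of, map_sum, ContinuousMap.comp_assoc]

theorem push_push {W : Type*} [TopologicalSpace W] (h : C(Z, W)) (g : C(Y, Z)) {n : ℕ}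
    (z : Chain Y n) : push h n (push g n z) = push (h.comp g) n z := by
  suffices e : (push h n).comp (push g n) = push (h.comp g) n from DFunLike.congr_fun e z
  exact lift_ext _ _ fun σ => by simp [ContinuousMap.comp_assoc]

/-- The natural operator on singular chains given by its value `m` on the identity simplex. -/
def natOp {n k : ℕ} (m : Chain (Simplex n) k) (Y : Type*) [TopologicalSpace Y] :
    Chain Y n →+ Chain Y k :=
  lift fun σ => push σ k m

@[simp]
theorem natOp_of {n k : ℕ} (m : Chain (Simplex n) k) (σ : C(Simplex n, Y)) :
    natOp m Y (of σ) = push σ k m :=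
  lift_apply_of _ _

theorem natOp_push {n k : ℕ} (m : Chain (Simplex n) k) (g : C(Y, Z)) (z : Chain Y n) :
    natOp m Z (push g n z) = push g k (natOp m Y z) := by
  suffices e : (natOp m Z).comp (push g n) = (push g k).comp (natOp m Y) from
    DFunLike.congr_fun e z
  exact lift_ext _ _ fun σ => by simp [push_push]

/-- The chains all of whose simplices satisfy `p`. -/
def chainsIn {n : ℕ} (p : C(Simplex n, Y) → Prop) : AddSubgroup (Chain Y n) :=
  AddSubgroup.closure (of '' {σ | p σ})

theorem of_mem_chainsIn {n : ℕ} {p : C(Simplex n, Y) → Prop} {σ : C(Simplex n, Y)} (h : p σ) :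
    of σ ∈ chainsIn p :=
  AddSubgroup.subset_closure ⟨σ, h, rfl⟩

/-- Homomorphisms map chains supported in `p` to a subgroup if they do so for simplices. -/
theorem map_mem_of_mem_chainsIn {G : Type*} [AddCommGroup G] {n : ℕ} {p : C(Simplex n, Y) → Prop}
    {H : AddSubgroup G} {f : Chain Y n →+ G} (h : ∀ σ, p σ → f (of σ) ∈ H) {z : Chain Y n}
    (hz : z ∈ chainsIn p) : f z ∈ H := by
  have : chainsIn p ≤ H.comap f := by
    rw [chainsIn, AddSubgroup.closure_le]
    rintro _ ⟨σ, hσ, rfl⟩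
    exact h σ hσ
  exact this hz

theorem eq_of_mem_chainsIn {G : Type*} [AddCommGroup G] {n : ℕ} {p : C(Simplex n, Y) → Prop}
    {f g : Chain Y n →+ G} (h : ∀ σ, p σ → f (of σ) = g (of σ)) {z : Chain Y n}
    (hz : z ∈ chainsIn p) : f z = g z := by
  have := map_mem_of_mem_chainsIn (H := ⊥) (f := f - g)
    (fun σ hσ => by simp [h σ hσ]) hz
  simpa [sub_eq_zero] using this

theorem boundary_mem_chainsIn {n : ℕ} {p : C(Simplex (n + 1), Y) → Prop}
    {q : C(Simplex n, Y) → Prop} (h : ∀ σ, p σ → ∀ i, q (σ.comp (faceMap i)))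
    {z : Chain Y (n + 1)} (hz : z ∈ chainsIn p) : boundary n z ∈ chainsIn q := by
  refine map_mem_of_mem_chainsIn (fun σ hσ => ?_) hz
  rw [boundary_of]
  exact sum_mem fun i _ => zsmul_mem (of_mem_chainsIn (h σ hσ i)) _

theorem singularCoboundary_apply {X : Type u} [TopologicalSpace X] {Γ : Type v} [AddCommGroup Γ]
    {n : ℕ} (ω : C(Simplex n, X) → Γ) (σ : C(Simplex (n + 1), X)) :
    singularCoboundary X Γ n ω σ = lift ω (boundary n (of σ)) := by
  simp [singularCoboundary, boundary_of, map_sum]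

theorem lift_singularCoboundary {X : Type u} [TopologicalSpace X] {Γ : Type v} [AddCommGroup Γ]
    {n : ℕ} (ω : C(Simplex n, X) → Γ) (z : Chain X (n + 1)) :
    lift (singularCoboundary X Γ n ω) z = lift ω (boundary n z) := by
  suffices e : lift (singularCoboundary X Γ n ω) = (lift ω).comp (boundary n) from
    DFunLike.congr_fun e z
  exact lift_ext _ _ fun σ => by simp [singularCoboundary_apply]

theorem singularCoboundary_singularCoboundary {X : Type u} [TopologicalSpace X] {Γ : Type v}
    [AddCommGroup Γ] {n : ℕ} (ω : C(Simplex n, X) → Γ) :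
    singularCoboundary X Γ (n + 1) (singularCoboundary X Γ n ω) = 0 := by
  ext σ
  rw [singularCoboundary_apply, lift_singularCoboundary, boundary_boundary, map_zero]
  rfl

end Chain

/-! ### Cones -/

theorem simplexMap_apply {m n : ℕ} (f : Fin (m + 1) → Fin (n + 1)) (x : Simplex m)
    (k : Fin (n + 1)) : simplexMap f x k = ∑ j, if f j = k then x j else 0 := by
  change FunOnFinite.linearMap ℝ ℝ f x k = _
  rw [FunOnFinite.linearMap_apply_apply, Finset.sum_filter]

theorem simplexMap_apply_apply {m n : ℕ} {f : Fin (m + 1) → Fin (n + 1)}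
    (hf : Function.Injective f) (x : Simplex m) (j : Fin (m + 1)) :
    simplexMap f x (f j) = x j := by
  simp [simplexMap_apply, hf.eq_iff]

theorem simplexMap_apply_eq_zero {m n : ℕ} {f : Fin (m + 1) → Fin (n + 1)} (x : Simplex m)
    {k : Fin (n + 1)} (hk : k ∉ Set.range f) : simplexMap f x k = 0 := by
  rw [simplexMap_apply]
  exact Finset.sum_eq_zero fun j _ => if_neg fun h => hk ⟨j, h⟩

@[simp]
theorem simplexMap_vertex {m n : ℕ} (f : Fin (m + 1) → Fin (n + 1)) (j : Fin (m + 1)) :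
    simplexMap f (stdSimplex.vertex j) = stdSimplex.vertex (f j) :=
  stdSimplex.map_vertex f j

/-- The point dividing the segment from the vertex `0` to a point of the opposite face. -/
def joinPt (n : ℕ) : C(unitInterval × Simplex n, Simplex (n + 1)) where
  toFun q := ⟨Fin.cons (q.1 : ℝ) fun j => (1 - q.1) * q.2 j, by
    refine ⟨fun i => ?_, ?_⟩
    · refine Fin.cases ?_ (fun j => ?_) i
      · simpa using q.1.2.1
      · simpa using mul_nonneg (sub_nonneg.2 q.1.2.2) (stdSimplex.zero_le q.2 j)
    · rw [Fin.sum_univ_succ]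
      simp [← Finset.mul_sum]⟩
  continuous_toFun := by
    refine Continuous.subtype_mk (continuous_pi fun i => ?_) _
    refine Fin.cases ?_ (fun j => ?_) i
    · exact continuous_subtype_val.comp continuous_fst
    · have h : Continuous fun q : unitInterval × Simplex n => q.2 j :=
        (continuous_apply j).comp (continuous_subtype_val.comp continuous_snd)
      exact (continuous_const.sub (continuous_subtype_val.comp continuous_fst)).mul h

@[simp]
theorem joinPt_zero {n : ℕ} (q : unitInterval × Simplex n) : joinPt n q 0 = q.1 := rfl

@[simp]
theorem joinPt_succ {n : ℕ} (q : unitInterval × Simplex n) (j : Fin (n + 1)) :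
    joinPt n q j.succ = (1 - q.1) * q.2 j := rfl

/-- The projection of a simplex from the vertex `0` to the opposite face. -/
def joinProj {n : ℕ} (p : Simplex (n + 1)) : Simplex n :=
  -- At the apex the projection is undetermined and any point of the face serves.
  if h : p 0 = 1 then stdSimplex.vertex 0 else
    ⟨fun j => p j.succ / (1 - p 0), fun j =>
      div_nonneg (stdSimplex.zero_le p _) (sub_nonneg.2 (stdSimplex.le_one p 0)), by
      have h1 := stdSimplex.sum_eq_one p
      rw [Fin.sum_univ_succ] at h1
      rw [← Finset.sum_div, div_eq_one_iff_eq (sub_ne_zero.2 (Ne.symm h))]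
      linarith⟩

/-- The `0`-th barycentric coordinate, as an element of the unit interval. -/
def joinCoord {n : ℕ} (p : Simplex (n + 1)) : unitInterval :=
  ⟨p 0, stdSimplex.zero_le p 0, stdSimplex.le_one p 0⟩

theorem joinPt_joinProj {n : ℕ} (p : Simplex (n + 1)) : joinPt n (joinCoord p, joinProj p) = p := by
  ext i
  refine Fin.cases rfl (fun j => ?_) i
  rw [joinPt_succ]
  by_cases h : p 0 = 1
  · have h1 := stdSimplex.sum_eq_one p
    rw [Fin.sum_univ_succ, h, add_eq_left,
      Finset.sum_eq_zero_iff_of_nonneg fun j _ => stdSimplex.zero_le p _] at h1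
    rw [h1 j (Finset.mem_univ _)]
    simp [joinCoord, h]
  · have h2 : (1 : ℝ) - p 0 ≠ 0 := sub_ne_zero.2 (Ne.symm h)
    have h3 : joinProj p j = p j.succ / (1 - p 0) := by
      rw [joinProj, dif_neg h]; rfl
    rw [h3]
    change (1 - p 0) * _ = _
    field_simp

theorem joinPt_surjective (n : ℕ) : Function.Surjective (joinPt n) :=
  fun p => ⟨_, joinPt_joinProj p⟩

/-- By compactness `joinPt` is closed. Hence continuity on a cone can be checked on the cylinder
above it. -/
theorem isQuotientMap_joinPt (n : ℕ) : Topology.IsQuotientMap (joinPt n) :=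
  (joinPt n).continuous.isClosedMap.isQuotientMap (joinPt n).continuous (joinPt_surjective n)

theorem faceMap_zero {n : ℕ} (y : Simplex n) : faceMap 0 y = joinPt n (0, y) := by
  ext i
  refine Fin.cases ?_ (fun j => ?_) i
  · rw [faceMap, simplexMap_apply_eq_zero]
    · rfl
    · simp
  · rw [joinPt_succ, faceMap, ← Fin.zero_succAbove,
      simplexMap_apply_apply Fin.succAbove_right_injective]
    simp

theorem faceMap_succ_joinPt {n : ℕ} (i : Fin (n + 2)) (s : unitInterval) (y : Simplex n) :
    faceMap i.succ (joinPt n (s, y)) = joinPt (n + 1) (s, faceMap i y) := by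
  ext k
  refine Fin.cases ?_ (fun k => ?_) k
  · have : (0 : Fin (n + 3)) = i.succ.succAbove 0 := by simp
    rw [this, faceMap, simplexMap_apply_apply Fin.succAbove_right_injective, ← this]
    rfl
  · rw [joinPt_succ]
    by_cases hk : k = i
    · subst hk
      rw [faceMap, simplexMap_apply_eq_zero _ (by simp), faceMap,
        simplexMap_apply_eq_zero _ (by simp), mul_zero]
    · obtain ⟨j, rfl⟩ := Fin.exists_succAbove_eq hk
      rw [← Fin.succ_succAbove_succ, faceMap,
        simplexMap_apply_apply Fin.succAbove_right_injective, faceMap,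
        simplexMap_apply_apply Fin.succAbove_right_injective, joinPt_succ]

theorem joinPt_one {n : ℕ} (y : Simplex n) : joinPt n (1, y) = stdSimplex.vertex 0 := by
  ext i
  refine Fin.cases ?_ (fun j => ?_) i
  · simp
  · simp

theorem joinPt_vertex {n : ℕ} (j : Fin (n + 1)) :
    joinPt n (0, stdSimplex.vertex j) = stdSimplex.vertex j.succ := by
  rw [← faceMap_zero, faceMap, simplexMap_vertex, Fin.zero_succAbove]

/-- The point dividing the segment between two points of a simplex. -/
def segPoint {n : ℕ} (s : unitInterval) (y z : Simplex n) : Simplex n :=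
  ⟨(s : ℝ) • y.1 + (1 - s : ℝ) • z.1,
    convex_stdSimplex ℝ _ y.2 z.2 s.2.1 (sub_nonneg.2 s.2.2) (by ring)⟩

theorem segPoint_apply {n : ℕ} (s : unitInterval) (y z : Simplex n) (i : Fin (n + 1)) :
    segPoint s y z i = s * y i + (1 - s) * z i := rfl

theorem continuous_segPoint {n : ℕ} :
    Continuous fun q : unitInterval × Simplex n × Simplex n => segPoint q.1 q.2.1 q.2.2 := by
  refine Continuous.subtype_mk ?_ _
  have h1 : Continuous fun q : unitInterval × Simplex n × Simplex n => (q.1 : ℝ) :=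
    continuous_subtype_val.comp continuous_fst
  exact (h1.smul (continuous_subtype_val.comp (continuous_fst.comp continuous_snd))).add
    ((continuous_const.sub h1).smul (continuous_subtype_val.comp
      (continuous_snd.comp continuous_snd)))

section Cone

variable {Y E : Type*} [TopologicalSpace Y] [AddCommGroup E] [Module ℝ E] (c : Y → E)

/-- `κ` is the straight cone over `τ` with apex `a`, with respect to the coordinates `c`. -/
def IsCone (a : Y) {n : ℕ} (τ : C(Simplex n, Y)) (κ : C(Simplex (n + 1), Y)) : Prop :=
  ∀ (s : unitInterval) (y : Simplex n),
    c (κ (joinPt n (s, y))) = (s : ℝ) • c a + (1 - s : ℝ) • c (τ y)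

/-- The straight cone over `τ` with apex `a` exists. -/
def Coneable (a : Y) {n : ℕ} (τ : C(Simplex n, Y)) : Prop := ∃ κ, IsCone c a τ κ

open Classical in
/-- The straight cone over `τ` with apex `a`; the constant simplex if there is none. -/
def coneMap (a : Y) {n : ℕ} (τ : C(Simplex n, Y)) : C(Simplex (n + 1), Y) :=
  -- The default makes the cone operator total; being constant at the apex, it also depends
  -- measurably on `a`.
  if h : Coneable c a τ then h.choose else .const _ a

/-- The cone operator on chains. -/
def cone (a : Y) (n : ℕ) : Chain Y n →+ Chain Y (n + 1) :=
  lift fun τ => of (coneMap c a τ)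

@[simp]
theorem cone_of (a : Y) {n : ℕ} (τ : C(Simplex n, Y)) : cone c a n (of τ) = of (coneMap c a τ) :=
  lift_apply_of _ _

variable {c}

theorem Coneable.isCone {a : Y} {n : ℕ} {τ : C(Simplex n, Y)} (h : Coneable c a τ) :
    IsCone c a τ (coneMap c a τ) := by
  rw [coneMap, dif_pos h]
  exact h.choose_spec

theorem coneMap_of_not_coneable {a : Y} {n : ℕ} {τ : C(Simplex n, Y)} (h : ¬ Coneable c a τ) :
    coneMap c a τ = .const _ a := by
  rw [coneMap, dif_neg h]

theorem IsCone.unique (hc : Function.Injective c) {a : Y} {n : ℕ} {τ : C(Simplex n, Y)}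
    {κ κ' : C(Simplex (n + 1), Y)} (h : IsCone c a τ κ) (h' : IsCone c a τ κ') : κ = κ' := by
  ext1 p
  obtain ⟨⟨s, y⟩, rfl⟩ := joinPt_surjective n p
  exact hc ((h s y).trans (h' s y).symm)

theorem IsCone.coneMap_eq (hc : Function.Injective c) {a : Y} {n : ℕ} {τ : C(Simplex n, Y)}
    {κ : C(Simplex (n + 1), Y)} (h : IsCone c a τ κ) : coneMap c a τ = κ :=
  (Coneable.isCone ⟨κ, h⟩).unique hc h

/-- The map `joinPt` identifies points only at `s = 1`, where the coordinates of `F` are those of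
the apex. So `F` descends along the quotient map. -/
theorem coneable_of_continuous (hc : Function.Injective c) {a : Y} {n : ℕ} {τ : C(Simplex n, Y)}
    (F : C(unitInterval × Simplex n, Y))
    (hF : ∀ s y, c (F (s, y)) = (s : ℝ) • c a + (1 - s : ℝ) • c (τ y)) : Coneable c a τ := by
  have key : ∀ q q', joinPt n q = joinPt n q' → F q = F q' := by
    rintro ⟨s, y⟩ ⟨s', y'⟩ h
    have hs : s = s' := Subtype.ext (congrArg (fun p : Simplex (n + 1) => p 0) h)
    subst hs
    apply hc
    rw [hF, hF]
    by_cases h1 : (s : ℝ) = 1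
    · simp [h1]
    · have hy : y = y' := by
        ext j
        have := congrArg (fun p : Simplex (n + 1) => p j.succ) h
        simpa [sub_eq_zero, Ne.symm h1] using this
      rw [hy]
  refine ⟨⟨fun p => F (Function.surjInv (joinPt_surjective n) p), ?_⟩, fun s y => ?_⟩
  · rw [(isQuotientMap_joinPt n).continuous_iff]
    convert F.continuous using 1
    ext q
    exact key _ _ (Function.surjInv_eq _ _)
  · rw [← hF]
    exact congrArg c (key _ _ (Function.surjInv_eq _ _))

theorem IsCone.comp_faceMap_zero (hc : Function.Injective c) {a : Y} {n : ℕ} {τ : C(Simplex n, Y)}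
    {κ : C(Simplex (n + 1), Y)} (h : IsCone c a τ κ) : κ.comp (faceMap 0) = τ := by
  ext1 y
  apply hc
  simp [faceMap_zero, h 0 y]

theorem IsCone.comp_faceMap_succ {a : Y} {n : ℕ} {τ : C(Simplex (n + 1), Y)}
    {κ : C(Simplex (n + 2), Y)} (h : IsCone c a τ κ) (i : Fin (n + 2)) :
    IsCone c a (τ.comp (faceMap i)) (κ.comp (faceMap i.succ)) := by
  intro s y
  simp [faceMap_succ_joinPt, h s (faceMap i y)]

theorem IsCone.comp_faceMap_one (hc : Function.Injective c) {a : Y} {τ : C(Simplex 0, Y)}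
    {κ : C(Simplex 1, Y)} (h : IsCone c a τ κ) : κ.comp (faceMap 1) = .const _ a := by
  ext1 y
  apply hc
  have : faceMap 1 y = joinPt 0 (1, y) := by
    rw [joinPt_one]
    obtain rfl : y = stdSimplex.vertex 0 := Subsingleton.elim _ _
    rw [faceMap, simplexMap_vertex]
    rfl
  simp [this, h 1 y]

/-- The face opposite the apex is the base, and every other face is the cone over a face of the
base. Coneability is needed only of the simplices of `z`, as their faces inherit it. -/
theorem boundary_cone (hc : Function.Injective c) {a : Y} {n : ℕ} {z : Chain Y (n + 1)}
    (hz : z ∈ chainsIn (Coneable c a)) :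
    boundary (n + 1) (cone c a (n + 1) z) = z - cone c a n (boundary n z) := by
  refine eq_of_mem_chainsIn (f := (boundary (n + 1)).comp (cone c a (n + 1)))
    (g := .id _ - (cone c a n).comp (boundary n)) (fun τ hτ => ?_) hz
  have h := hτ.isCone
  simp only [AddMonoidHom.comp_apply, AddMonoidHom.sub_apply, AddMonoidHom.id_apply, cone_of,
    boundary_of, map_sum, map_zsmul]
  rw [Fin.sum_univ_succ, h.comp_faceMap_zero hc, sub_eq_add_neg]
  congr 1
  · rw [← Finset.sum_neg_distrib]
    refine Finset.sum_congr rfl fun i _ => ?_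
    rw [(h.comp_faceMap_succ i).coneMap_eq hc, Fin.val_succ, pow_succ]
    simp

/-- The augmentation of singular chains. -/
def augmentation (Y : Type*) [TopologicalSpace Y] : Chain Y 0 →+ ℤ := lift fun _ => 1

@[simp]
theorem augmentation_of (σ : C(Simplex 0, Y)) : augmentation Y (of σ) = 1 := lift_apply_of _ _

theorem augmentation_boundary (z : Chain Y 1) : augmentation Y (boundary 0 z) = 0 := by
  suffices e : (augmentation Y).comp (boundary 0) = 0 from DFunLike.congr_fun e z
  exact lift_ext _ _ fun σ => by simp [boundary_of, Fin.sum_univ_succ]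

/-- The second endpoint of a cone over a point is the apex, so the augmentation replaces the cone
over the boundary. -/
theorem boundary_cone_zero (hc : Function.Injective c) {a : Y} {z : Chain Y 0}
    (hz : z ∈ chainsIn (Coneable c a)) :
    boundary 0 (cone c a 0 z) = z - augmentation Y z • of (.const _ a) := by
  refine eq_of_mem_chainsIn (f := (boundary 0).comp (cone c a 0))
    (g := .id _ - (zmultiplesHom (Chain Y 0) (of (ContinuousMap.const _ a))).comp
      (augmentation Y)) (fun τ hτ => ?_) hz
  have h := hτ.isCone
  simp only [AddMonoidHom.comp_apply, AddMonoidHom.sub_apply, AddMonoidHom.id_apply, cone_of,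
    boundary_of]
  rw [Fin.sum_univ_two, h.comp_faceMap_zero hc, h.comp_faceMap_one hc]
  simp [sub_eq_add_neg]

end Cone

/-! ### Barycentric subdivision -/

section Subdivision

/-- A point of the standard simplex, as a vector. -/
abbrev simplexCoord {n : ℕ} (x : Simplex n) : Fin (n + 1) → ℝ := x.1

theorem coneable_simplexCoord {n k : ℕ} (a : Simplex n) (τ : C(Simplex k, Simplex n)) :
    Coneable simplexCoord a τ := by
  refine coneable_of_continuous Subtype.val_injective
    ⟨fun q => segPoint q.1 a (τ q.2), ?_⟩ fun _ _ => rfl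
  exact continuous_segPoint.comp (continuous_fst.prodMk (continuous_const.prodMk
    (τ.continuous.comp continuous_snd)))

theorem mem_chainsIn_coneable {n k : ℕ} (a : Simplex n) (z : Chain (Simplex n) k) :
    z ∈ chainsIn (Coneable simplexCoord a) := by
  induction z using FreeAbelianGroup.induction_on with
  | zero => exact zero_mem _
  | of τ => exact of_mem_chainsIn (coneable_simplexCoord a τ)
  | neg τ h => exact neg_mem h
  | add x y hx hy => exact add_mem hx hy

/-- The barycentric subdivision of the standard simplex. -/
def subdivModel : (n : ℕ) → Chain (Simplex n) n
  | 0 => of (.id _)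
  | n + 1 => cone simplexCoord stdSimplex.barycenter n
      (natOp (subdivModel n) _ (boundary n (of (.id _))))

/-- The chain homotopy between the barycentric subdivision and the identity, on the standard
simplex. -/
def subdivHtpyModel : (n : ℕ) → Chain (Simplex n) (n + 1)
  | 0 => 0
  | n + 1 => cone simplexCoord stdSimplex.barycenter (n + 1)
      (of (.id _) - natOp (subdivHtpyModel n) _ (boundary n (of (.id _))))

theorem subdivModel_succ (n : ℕ) : subdivModel (n + 1) =
    cone simplexCoord stdSimplex.barycenter n
      (natOp (subdivModel n) _ (boundary n (of (.id _)))) := rfl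

theorem subdivHtpyModel_succ (n : ℕ) : subdivHtpyModel (n + 1) =
    cone simplexCoord stdSimplex.barycenter (n + 1)
      (of (.id _) - natOp (subdivHtpyModel n) _ (boundary n (of (.id _)))) := rfl

variable {Y : Type*} [TopologicalSpace Y]

/-- By naturality a relation between boundaries needs checking only on the identity simplex. -/
theorem boundary_natOp {n k : ℕ} {m : Chain (Simplex (n + 1)) (k + 1)} {m' : Chain (Simplex n) k}
    (h : boundary k m = natOp m' _ (boundary n (of (.id _)))) (z : Chain Y (n + 1)) :
    boundary k (natOp m Y z) = natOp m' Y (boundary n z) := by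
  suffices e : (boundary k).comp (natOp m Y) = (natOp m' Y).comp (boundary n) from
    DFunLike.congr_fun e z
  refine lift_ext _ _ fun σ => ?_
  have h1 : of σ = push σ (n + 1) (of (.id _)) := by simp
  simp only [AddMonoidHom.comp_apply, natOp_of]
  rw [boundary_push, h, h1, boundary_push, natOp_push]

theorem natOp_subdivModel_zero (z : Chain Y 0) : natOp (subdivModel 0) Y z = z := by
  suffices e : natOp (subdivModel 0) Y = .id _ from DFunLike.congr_fun e z
  exact lift_ext _ _ fun σ => by simp [subdivModel]

theorem boundary_subdivModel : ∀ n : ℕ, boundary n (subdivModel (n + 1)) =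
    natOp (subdivModel n) _ (boundary n (of (.id _)))
  | 0 => by
    rw [subdivModel_succ, boundary_cone_zero Subtype.val_injective (mem_chainsIn_coneable _ _),
      natOp_subdivModel_zero, augmentation_boundary, zero_smul, sub_zero]
  | n + 1 => by
    rw [subdivModel_succ, boundary_cone Subtype.val_injective (mem_chainsIn_coneable _ _),
      boundary_natOp (boundary_subdivModel n), boundary_boundary, map_zero, map_zero, sub_zero]

/-- The barycentric subdivision operator on singular chains. -/
def subdiv (n : ℕ) (Y : Type*) [TopologicalSpace Y] : Chain Y n →+ Chain Y n :=
  natOp (subdivModel n) Y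

/-- The chain homotopy between the barycentric subdivision and the identity. -/
def subdivHtpy (n : ℕ) (Y : Type*) [TopologicalSpace Y] : Chain Y n →+ Chain Y (n + 1) :=
  natOp (subdivHtpyModel n) Y

theorem boundary_subdiv {n : ℕ} (z : Chain Y (n + 1)) :
    boundary n (subdiv (n + 1) Y z) = subdiv n Y (boundary n z) :=
  boundary_natOp (boundary_subdivModel n) z

/-- Coning off `ι - T ∂ι`, with `ι` the identity simplex and `T` the homotopy one dimension lower,
leaves the cone over `∂ι - ∂T∂ι`. By induction the latter chain is the subdivided boundary, whose
cone is the subdivision of `ι`. In dimension zero subdivision is the identity and the homotopy is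
zero. -/
theorem boundary_subdivHtpyModel : ∀ n : ℕ, boundary (n + 1) (subdivHtpyModel (n + 1)) =
    of (.id _) - subdivModel (n + 1) -
      natOp (subdivHtpyModel n) _ (boundary n (of (.id _)))
  | 0 => by
    have h (Y : Type) [TopologicalSpace Y] : natOp (subdivHtpyModel 0) Y = 0 :=
      lift_ext _ _ fun σ => by simp [subdivHtpyModel]
    rw [subdivHtpyModel_succ, boundary_cone Subtype.val_injective (mem_chainsIn_coneable _ _), h,
      subdivModel_succ, natOp_subdivModel_zero]
    simp
  | n + 1 => by
    have h := boundary_subdivHtpyModel n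
    have h1 : ∀ z : Chain (Simplex (n + 2)) (n + 1),
        boundary (n + 1) (natOp (subdivHtpyModel (n + 1)) _ z) =
          z - natOp (subdivModel (n + 1)) _ z -
            natOp (subdivHtpyModel n) _ (boundary n z) := by
      intro z
      suffices e : (boundary (n + 1)).comp (natOp (subdivHtpyModel (n + 1)) (Simplex (n + 2))) =
          .id _ - natOp (subdivModel (n + 1)) _ - (natOp (subdivHtpyModel n) _).comp (boundary n)
        from DFunLike.congr_fun e z
      refine lift_ext _ _ fun σ => ?_
      simp only [AddMonoidHom.comp_apply, natOp_of, AddMonoidHom.sub_apply, AddMonoidHom.id_apply]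
      have h1 : of σ = push σ (n + 1) (of (.id _)) := by simp
      rw [boundary_push, h, map_sub, map_sub, h1, boundary_push, natOp_push]
    rw [subdivHtpyModel_succ, boundary_cone Subtype.val_injective (mem_chainsIn_coneable _ _),
      map_sub, h1, boundary_boundary, map_zero, sub_zero, subdivModel_succ]
    simp only [sub_sub_cancel]
    abel

theorem boundary_subdivHtpy {n : ℕ} (z : Chain Y (n + 1)) :
    boundary (n + 1) (subdivHtpy (n + 1) Y z) =
      z - subdiv (n + 1) Y z - subdivHtpy n Y (boundary n z) := by
  suffices e : (boundary (n + 1)).comp (subdivHtpy (n + 1) Y) =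
      .id _ - subdiv (n + 1) Y - (subdivHtpy n Y).comp (boundary n) from DFunLike.congr_fun e z
  refine lift_ext _ _ fun σ => ?_
  simp only [AddMonoidHom.comp_apply, subdivHtpy, subdiv, natOp_of, AddMonoidHom.sub_apply,
    AddMonoidHom.id_apply]
  have h1 : of σ = push σ (n + 1) (of (.id _)) := by simp
  rw [boundary_push, boundary_subdivHtpyModel, map_sub, map_sub, h1, boundary_push, natOp_push]

/-- A singular simplex of a standard simplex that is affine. -/
def IsAffine {k n : ℕ} (u : C(Simplex k, Simplex n)) : Prop :=
  ∀ p, (u p).1 = ∑ j, p j • (u (stdSimplex.vertex j)).1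

theorem simplex_eq_sum {n : ℕ} (p : Simplex n) :
    p.1 = ∑ j, p j • (stdSimplex.vertex (S := ℝ) j).1 := by
  ext i
  simp only [Finset.sum_apply, Pi.smul_apply, smul_eq_mul]
  rw [Finset.sum_eq_single i]
  · simp; rfl
  · intro j _ hj
    simp [hj.symm]
  · simp

theorem isAffine_id (n : ℕ) : IsAffine (.id (Simplex n)) := fun p => simplex_eq_sum p

theorem isAffine_simplexMap {k n : ℕ} (f : Fin (k + 1) → Fin (n + 1)) :
    IsAffine (simplexMap f) := by
  intro p
  ext i
  change simplexMap f p i = _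
  rw [simplexMap_apply]
  simp only [simplexMap_vertex, Finset.sum_apply, Pi.smul_apply, smul_eq_mul, Pi.single_apply,
    eq_comm (a := i)]
  simp

theorem IsAffine.comp {k m n : ℕ} {g : C(Simplex m, Simplex n)} {u : C(Simplex k, Simplex m)}
    (hg : IsAffine g) (hu : IsAffine u) : IsAffine (g.comp u) := by
  intro p
  have h (l : Fin (m + 1)) : u p l = ∑ j, p j * u (stdSimplex.vertex j) l := by
    have := congrFun (hu p) l
    rw [Finset.sum_apply] at this
    exact this
  simp only [ContinuousMap.comp_apply]
  rw [hg]
  simp only [h, Finset.sum_smul]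
  rw [Finset.sum_comm]
  refine Finset.sum_congr rfl fun j _ => ?_
  rw [hg (u _), Finset.smul_sum]
  simp only [smul_smul]

theorem IsCone.isAffine {k n : ℕ} {a : Simplex n} {τ : C(Simplex k, Simplex n)}
    {κ : C(Simplex (k + 1), Simplex n)} (h : IsCone simplexCoord a τ κ) (hτ : IsAffine τ) :
    IsAffine κ := by
  intro p
  obtain ⟨⟨s, y⟩, rfl⟩ := joinPt_surjective k p
  have h0 : κ (stdSimplex.vertex 0) = a := by
    apply Subtype.val_injective
    rw [← joinPt_one (stdSimplex.vertex 0)]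
    simpa using h 1 (stdSimplex.vertex 0)
  have h1 (j) : κ (stdSimplex.vertex j.succ) = τ (stdSimplex.vertex j) := by
    apply Subtype.val_injective
    rw [← joinPt_vertex]
    simpa using h 0 (stdSimplex.vertex j)
  rw [Fin.sum_univ_succ, h0]
  simp only [h1, joinPt_zero, joinPt_succ]
  refine (h s y).trans ?_
  simp only [simplexCoord]
  rw [hτ y, Finset.smul_sum]
  simp only [smul_smul]

/-- The affine singular simplices `u` with `diam (g ∘ u) ≤ r diam g` for all affine `g`. -/
def Shrinks (r : ℝ) {k n : ℕ} (u : C(Simplex k, Simplex n)) : Prop :=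
  IsAffine u ∧ ∀ (N : ℕ) (g : C(Simplex n, Simplex N)) (d : ℝ), IsAffine g →
    (∀ x y, dist (g x) (g y) ≤ d) → ∀ p q, dist (g (u p)) (g (u q)) ≤ r * d

/-- The difference between barycenter and vertex is an average of `n + 1` edge vectors, one of which
is zero; this gives the factor `n / (n + 1)`. Other points are convex combinations of the vertices.
-/
theorem dist_barycenter_le {n N : ℕ} {g : C(Simplex n, Simplex N)} (hg : IsAffine g) {d : ℝ}
    (hd : ∀ x y, dist (g x) (g y) ≤ d) (z : Simplex n) :
    dist (g stdSimplex.barycenter) (g z) ≤ n / (n + 1) * d := by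
  have hb : (g stdSimplex.barycenter).1 =
      ∑ j : Fin (n + 1), (n + 1 : ℝ)⁻¹ • (g (stdSimplex.vertex j)).1 := by
    rw [hg]
    refine Finset.sum_congr rfl fun j _ => ?_
    congr 1
    change (stdSimplex.barycenter : Simplex n).1 j = _
    simp
  have hn : (0 : ℝ) < n + 1 := by positivity
  have hd0 : 0 ≤ d := dist_nonneg.trans (hd z z)
  have h1 (k : Fin (n + 1)) :
      ‖(g stdSimplex.barycenter).1 - (g (stdSimplex.vertex k)).1‖ ≤ n / (n + 1) * d := by
    have e : (g stdSimplex.barycenter).1 - (g (stdSimplex.vertex k)).1 =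
        (n + 1 : ℝ)⁻¹ • ∑ j ∈ Finset.univ.erase k,
          ((g (stdSimplex.vertex j)).1 - (g (stdSimplex.vertex k)).1) := by
      rw [Finset.sum_erase _ (by simp), Finset.sum_sub_distrib, smul_sub, Finset.smul_sum, hb]
      congr 1
      simp only [Finset.sum_const, Finset.card_univ, Fintype.card_fin]
      rw [← Nat.cast_smul_eq_nsmul ℝ, smul_smul]
      push_cast
      rw [inv_mul_cancel₀ hn.ne', one_smul]
    rw [e, norm_smul, norm_inv, Real.norm_of_nonneg hn.le]
    have h2 : ‖∑ j ∈ Finset.univ.erase k,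
        ((g (stdSimplex.vertex j)).1 - (g (stdSimplex.vertex k)).1)‖ ≤ n * d := by
      refine (norm_sum_le_of_le _ fun j _ => ?_).trans_eq
        (b := ∑ j ∈ (Finset.univ : Finset (Fin (n + 1))).erase k, d) ?_
      · rw [← dist_eq_norm]
        exact hd _ _
      · simp
    calc _ ≤ (n + 1 : ℝ)⁻¹ * (n * d) := by gcongr
      _ = _ := by ring
  have e : (g stdSimplex.barycenter).1 - (g z).1 =
      ∑ k, z k • ((g stdSimplex.barycenter).1 - (g (stdSimplex.vertex k)).1) := by
    simp only [smul_sub, Finset.sum_sub_distrib]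
    rw [← Finset.sum_smul, stdSimplex.sum_eq_one, one_smul, ← hg z]
  rw [Subtype.dist_eq, dist_eq_norm, e]
  refine (norm_sum_le_of_le _ fun k _ => ?_).trans_eq
    (b := ∑ k, z k * (n / (n + 1) * d)) ?_
  · rw [norm_smul, Real.norm_of_nonneg (stdSimplex.zero_le z k)]
    exact mul_le_mul_of_nonneg_left (h1 k) (stdSimplex.zero_le z k)
  · rw [← Finset.sum_mul, stdSimplex.sum_eq_one, one_mul]

theorem norm_segment_sub_segment_le {V : Type*} [NormedAddCommGroup V] [NormedSpace ℝ V]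
    {b x y : V} {d s t : ℝ} (hs : 0 ≤ s) (hs1 : s ≤ 1) (ht : 0 ≤ t) (ht1 : t ≤ 1)
    (hx : ‖b - x‖ ≤ d) (hy : ‖b - y‖ ≤ d) (hxy : ‖x - y‖ ≤ d) :
    ‖(s • b + (1 - s) • x) - (t • b + (1 - t) • y)‖ ≤ d := by
  -- The three coefficients on the right are nonnegative with sum `1 - s * t ≤ 1`.
  have e : (s • b + (1 - s) • x) - (t • b + (1 - t) • y) =
      (s * (1 - t)) • (b - y) + ((1 - s) * t) • (x - b) + ((1 - s) * (1 - t)) • (x - y) := by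
    module
  have hs' := sub_nonneg.2 hs1
  have ht' := sub_nonneg.2 ht1
  have hd := (norm_nonneg _).trans hx
  rw [e]
  refine (norm_add₃_le).trans ?_
  rw [norm_smul, norm_smul, norm_smul, Real.norm_of_nonneg (by positivity),
    Real.norm_of_nonneg (by positivity), Real.norm_of_nonneg (by positivity), norm_sub_rev x b]
  calc _ ≤ s * (1 - t) * d + (1 - s) * t * d + (1 - s) * (1 - t) * d := by gcongr
    _ = (1 - s * t) * d := by ring
    _ ≤ 1 * d := by gcongr; nlinarith
    _ = d := one_mul d

/-- Distances in a cone from the barycenter are controlled by distances to the barycenter and within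
the base. The quantifier over affine maps in `Shrinks` allows the inductive hypothesis to be used
for `g` restricted to a face. -/
theorem subdivModel_mem : ∀ n : ℕ, subdivModel n ∈ chainsIn (Shrinks ((n : ℝ) / (n + 1)))
  | 0 => by
    refine of_mem_chainsIn ⟨isAffine_id 0, fun N g d _ _ p q => ?_⟩
    obtain rfl : p = q := Subsingleton.elim _ _
    simp
  | n + 1 => by
    rw [subdivModel]
    have h1 : natOp (subdivModel n) _ (boundary n (of (.id (Simplex (n + 1))))) ∈
        chainsIn fun τ => ∃ (i : Fin (n + 2)) (u : C(Simplex n, Simplex n)),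
          Shrinks ((n : ℝ) / (n + 1)) u ∧ τ = (faceMap i).comp u := by
      rw [boundary_of, map_sum]
      refine sum_mem fun i _ => ?_
      rw [map_zsmul]
      refine zsmul_mem ?_ _
      rw [natOp_of]
      exact map_mem_of_mem_chainsIn (fun u hu => by
        rw [push_of]; exact of_mem_chainsIn ⟨i, u, hu, rfl⟩) (subdivModel_mem n)
    refine map_mem_of_mem_chainsIn ?_ h1
    rintro _ ⟨i, u, hu, rfl⟩
    rw [cone_of]
    have hc := (coneable_simplexCoord (stdSimplex.barycenter : Simplex (n + 1))
      ((faceMap i).comp u)).isCone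
    have hA := hc.isAffine ((isAffine_simplexMap i.succAbove).comp hu.1)
    refine of_mem_chainsIn ⟨hA, fun N g d hg hd p q => ?_⟩
    have hgc (s : unitInterval) (y : Simplex n) :
        (g (coneMap simplexCoord stdSimplex.barycenter ((faceMap i).comp u) (joinPt n (s, y)))).1 =
          (s : ℝ) • (g stdSimplex.barycenter).1 + (1 - s : ℝ) • (g (faceMap i (u y))).1 := by
      rw [hg, hg stdSimplex.barycenter, hg (faceMap i (u y)), Finset.smul_sum, Finset.smul_sum,
        ← Finset.sum_add_distrib]
      refine Finset.sum_congr rfl fun j _ => ?_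
      rw [smul_smul, smul_smul, ← add_smul]
      congr 1
      exact congrFun (hc s y) j
    obtain ⟨⟨s, x⟩, rfl⟩ := joinPt_surjective n p
    obtain ⟨⟨t, y⟩, rfl⟩ := joinPt_surjective n q
    have hd0 : 0 ≤ d := dist_nonneg.trans (hd stdSimplex.barycenter stdSimplex.barycenter)
    -- The ratio `n / (n + 1)` increases with `n`, so the bound on a face is good enough.
    have hr : (n : ℝ) / (n + 1) * d ≤ ((n + 1 : ℕ) : ℝ) / ((n + 1 : ℕ) + 1) * d := by
      refine mul_le_mul_of_nonneg_right ?_ hd0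
      rw [div_le_div_iff₀ (by positivity) (by positivity)]
      push_cast
      nlinarith
    have hb (z) : ‖(g stdSimplex.barycenter).1 - (g z).1‖ ≤
        ((n + 1 : ℕ) : ℝ) / ((n + 1 : ℕ) + 1) * d := by
      rw [← dist_eq_norm]
      exact dist_barycenter_le hg hd z
    rw [Subtype.dist_eq, dist_eq_norm, hgc, hgc]
    refine norm_segment_sub_segment_le s.2.1 s.2.2 t.2.1 t.2.2 (hb _) (hb _) ?_
    rw [← dist_eq_norm]
    exact (hu.2 N (g.comp (faceMap i)) d (hg.comp (isAffine_simplexMap _))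
      (fun x y => hd _ _) x y).trans hr

theorem iterate_subdiv_of {n : ℕ} (σ : C(Simplex n, Y)) (m : ℕ) :
    (subdiv n Y)^[m] (of σ) = push σ n ((subdiv n (Simplex n))^[m] (of (.id _))) := by
  induction m with
  | zero => simp
  | succ m ih =>
    rw [Function.iterate_succ_apply', Function.iterate_succ_apply', ih, subdiv, natOp_push, subdiv]

theorem iterate_subdiv_mem (n m : ℕ) : (subdiv n (Simplex n))^[m] (of (.id _)) ∈
    chainsIn fun u => IsAffine u ∧ ∀ p q, dist (u p) (u q) ≤ ((n : ℝ) / (n + 1)) ^ m := by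
  induction m with
  | zero =>
    refine of_mem_chainsIn ⟨isAffine_id n, fun p q => ?_⟩
    rw [pow_zero]
    refine (Metric.dist_le_diam_of_mem (bounded_stdSimplex _) p.2 q.2).trans diam_stdSimplex_le
  | succ m ih =>
    rw [Function.iterate_succ_apply']
    refine map_mem_of_mem_chainsIn (fun g hg => ?_) ih
    rw [subdiv, natOp_of]
    refine map_mem_of_mem_chainsIn (fun u hu => ?_) (subdivModel_mem n)
    rw [push_of]
    refine of_mem_chainsIn ⟨hg.1.comp hu.1, fun p q => ?_⟩
    rw [pow_succ']
    exact hu.2 n g _ hg.1 hg.2 p q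

/-- Iterated barycentric subdivisions are arbitrarily fine. -/
theorem exists_iterate_subdiv_mem (n : ℕ) {ε : ℝ} (hε : 0 < ε) : ∃ M, ∀ m ≥ M,
    (subdiv n (Simplex n))^[m] (of (.id _)) ∈ chainsIn fun u => ∀ p q, dist (u p) (u q) < ε := by
  have h0 : (0 : ℝ) ≤ n / (n + 1) := by positivity
  have h1 : (n : ℝ) / (n + 1) < 1 := by
    rw [div_lt_one (by positivity)]
    linarith
  obtain ⟨M, hM⟩ := exists_pow_lt_of_lt_one hε h1
  refine ⟨M, fun m hm => ?_⟩
  refine AddSubgroup.closure_mono (Set.image_mono ?_) (iterate_subdiv_mem n m)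
  exact fun u hu p q => (hu.2 p q).trans_lt ((pow_le_pow_of_le_one h0 h1.le hm).trans_lt hM)

end Subdivision

/-- Every point of a simplex is an interior point of a face. -/
theorem exists_interior_face {n : ℕ} (z : Simplex n) :
    ∃ (k : ℕ) (f : Fin (k + 1) → Fin (n + 1)) (y : Simplex k), Function.Injective f ∧
      (∀ j, 0 < y j) ∧ simplexMap f y = z := by
  classical
  set J : Finset (Fin (n + 1)) := Finset.univ.filter fun j => 0 < z j with hJ
  have hz0 : ∀ j, j ∉ J → z j = 0 := fun j hj => by
    have : ¬ 0 < z j := by simpa [hJ] using hj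
    exact le_antisymm (not_lt.1 this) (stdSimplex.zero_le z j)
  have hsum : ∑ j ∈ J, z j = 1 := by
    rw [← stdSimplex.sum_eq_one z]
    exact Finset.sum_subset (Finset.subset_univ _) fun j _ hj => hz0 j hj
  have hne : J.Nonempty := by
    rw [Finset.nonempty_iff_ne_empty]
    rintro h
    simp [h] at hsum
  obtain ⟨k, hk⟩ : ∃ k, J.card = k + 1 := ⟨J.card - 1, by have := hne.card_pos; omega⟩
  set f := J.orderEmbOfFin hk with hf
  have hfJ : ∀ j, f j ∈ J := fun j => J.orderEmbOfFin_mem hk j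
  have himg : Finset.univ.image f = J := by
    simp [hf]
  refine ⟨k, f, ⟨fun j => z (f j), fun j => stdSimplex.zero_le z _, ?_⟩, f.injective,
    fun j => ?_, ?_⟩
  · rw [← hsum, ← himg, Finset.sum_image fun _ _ _ _ h => f.injective h]
  · exact (Finset.mem_filter.1 (hfJ j)).2
  · ext i
    by_cases hi : i ∈ Set.range f
    · obtain ⟨j, rfl⟩ := hi
      rw [simplexMap_apply_apply f.injective]
      rfl
    · rw [simplexMap_apply_eq_zero _ hi, hz0]
      rw [← himg]
      simpa using hi

/-! ### Faces, carriers and barycentric coordinates -/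

namespace Triangulation

variable {X : Type u} [TopologicalSpace X] (𝒯 : Triangulation X)

/-- The `j`-th vertex of a simplex. -/
def vert {n : ℕ} (b : 𝒯.B n) (j : Fin (n + 1)) : X := 𝒯.simplex n b (stdSimplex.vertex j)

theorem vert_injective {n : ℕ} (b : 𝒯.B n) : Function.Injective (𝒯.vert b) :=
  (𝒯.simplex_injective n b).comp stdSimplex.vertex_injective

theorem exists_subface : ∀ (n : ℕ) (b : 𝒯.B n) (k : ℕ) (f : Fin (k + 1) → Fin (n + 1)),
    Function.Injective f → ∃ (q : 𝒯.B k) (π : Equiv.Perm (Fin (k + 1))),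
      ∀ x : Simplex k, 𝒯.simplex n b (simplexMap f x) = 𝒯.simplex k q (simplexMap π x) := by
  intro n
  induction n with
  | zero =>
    intro b k f hf
    obtain rfl : k = 0 := by
      have := Fintype.card_le_of_injective f hf
      simp at this
      omega
    exact ⟨b, Equiv.ofBijective f (Finite.injective_iff_bijective.1 hf), fun x => rfl⟩
  | succ n ih =>
    intro b k f hf
    by_cases hs : Function.Surjective f
    · obtain rfl : k = n + 1 := by
        have := Fintype.card_of_bijective ⟨hf, hs⟩
        simp at this
        omega
      exact ⟨b, Equiv.ofBijective f ⟨hf, hs⟩, fun x => rfl⟩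
    · obtain ⟨i, hi⟩ : ∃ i, ∀ j, f j ≠ i := by simpa [Function.Surjective] using hs
      choose f' hf' using fun j => Fin.exists_succAbove_eq (hi j)
      obtain rfl : f = i.succAbove ∘ f' := funext fun j => (hf' j).symm
      obtain ⟨q, π, hq⟩ := 𝒯.exists_face n b i
      obtain ⟨q', π', hq'⟩ := ih q k (π ∘ f') (π.injective.comp hf.of_comp)
      refine ⟨q', π', fun x => ?_⟩
      rw [← hq', ← simplexMap_comp, ← simplexMap_comp]
      exact hq _

/-- The dimension of the simplex with a given point in its interior. -/
def dim (x : X) : ℕ := (𝒯.existsUnique_open_simplex x).exists.choose.1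

/-- The simplex with a given point in its interior. -/
def carrier (x : X) : 𝒯.B (𝒯.dim x) := (𝒯.existsUnique_open_simplex x).exists.choose.2.1

/-- The position of a point in its carrier. -/
def pos (x : X) : Simplex (𝒯.dim x) := (𝒯.existsUnique_open_simplex x).exists.choose.2.2

theorem pos_pos (x : X) (j) : 0 < 𝒯.pos x j :=
  (𝒯.existsUnique_open_simplex x).exists.choose_spec.1 j

@[simp]
theorem simplex_carrier_pos (x : X) : 𝒯.simplex _ (𝒯.carrier x) (𝒯.pos x) = x :=
  (𝒯.existsUnique_open_simplex x).exists.choose_spec.2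

theorem carrier_eq {n : ℕ} {b : 𝒯.B n} {y : Simplex n} (hy : ∀ j, 0 < y j) :
    (⟨𝒯.dim (𝒯.simplex n b y), 𝒯.carrier (𝒯.simplex n b y), 𝒯.pos (𝒯.simplex n b y)⟩ :
      Σ n : ℕ, 𝒯.B n × Simplex n) = ⟨n, b, y⟩ :=
  (𝒯.existsUnique_open_simplex (𝒯.simplex n b y)).unique
    (𝒯.existsUnique_open_simplex (𝒯.simplex n b y)).exists.choose_spec ⟨hy, rfl⟩

open Classical in
/-- The barycentric coordinates of a point. -/
def coord (x : X) (v : X) : ℝ := ∑ j, if 𝒯.vert (𝒯.carrier x) j = v then 𝒯.pos x j else 0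

open Classical in
-- Coordinates may be computed in any closed simplex containing the point: the point is interior to
-- a face, that face is its carrier up to renumbering, and the remaining coordinates vanish.
theorem coord_simplex {n : ℕ} (b : 𝒯.B n) (z : Simplex n) (v : X) :
    𝒯.coord (𝒯.simplex n b z) v = ∑ j, if 𝒯.vert b j = v then z j else 0 := by
  obtain ⟨k, f, y, hf, hy, rfl⟩ := exists_interior_face z
  obtain ⟨q, π, h⟩ := 𝒯.exists_subface n b k f hf
  have hv (j) : 𝒯.vert b (f j) = 𝒯.vert q (π j) := by
    simpa [vert] using h (stdSimplex.vertex j)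
  have hpos (j) : 0 < simplexMap π y j := by
    obtain ⟨i, rfl⟩ := π.surjective j
    rw [simplexMap_apply_apply π.injective]
    exact hy i
  have key : 𝒯.coord (𝒯.simplex k q (simplexMap π y)) v =
      ∑ j, if 𝒯.vert q j = v then simplexMap π y j else 0 :=
    congrArg (fun s : Σ n : ℕ, 𝒯.B n × Simplex n =>
      ∑ j, if 𝒯.vert s.2.1 j = v then s.2.2 j else 0) (𝒯.carrier_eq hpos)
  rw [h, key, ← Equiv.sum_comp π]
  simp only [simplexMap_apply_apply π.injective, ← hv]
  symm
  rw [← Finset.sum_subset (Finset.subset_univ (Finset.univ.image f)),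
    Finset.sum_image fun _ _ _ _ e => hf e]
  · simp only [simplexMap_apply_apply hf]
  · intro i _ hi
    rw [simplexMap_apply_eq_zero _ (by simpa using hi), ite_self]

@[simp]
theorem coord_vert {n : ℕ} (b : 𝒯.B n) (z : Simplex n) (j : Fin (n + 1)) :
    𝒯.coord (𝒯.simplex n b z) (𝒯.vert b j) = z j := by
  classical
  simp [coord_simplex, (𝒯.vert_injective b).eq_iff]

theorem coord_carrier (x : X) (j) : 𝒯.coord x (𝒯.vert (𝒯.carrier x) j) = 𝒯.pos x j := by
  have := 𝒯.coord_vert (𝒯.carrier x) (𝒯.pos x) j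
  rwa [simplex_carrier_pos] at this

theorem coord_eq_zero {n : ℕ} (b : 𝒯.B n) (z : Simplex n) {v : X} (h : v ∉ Set.range (𝒯.vert b)) :
    𝒯.coord (𝒯.simplex n b z) v = 0 := by
  classical
  rw [coord_simplex]
  exact Finset.sum_eq_zero fun j _ => if_neg fun e => h ⟨j, e⟩

theorem mem_range_vert_of_coord {n : ℕ} {b : 𝒯.B n} {z : Simplex n} {v : X}
    (h : 𝒯.coord (𝒯.simplex n b z) v ≠ 0) : v ∈ Set.range (𝒯.vert b) := by
  by_contra hv
  exact h (𝒯.coord_eq_zero b z hv)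

theorem coord_nonneg (x v : X) : 0 ≤ 𝒯.coord x v := by
  refine Finset.sum_nonneg fun j _ => ?_
  split_ifs
  exacts [stdSimplex.zero_le _ _, le_rfl]

theorem coord_ne_zero_iff (x v : X) :
    𝒯.coord x v ≠ 0 ↔ v ∈ Set.range (𝒯.vert (𝒯.carrier x)) := by
  constructor
  · intro h
    rw [← 𝒯.simplex_carrier_pos x] at h
    exact 𝒯.mem_range_vert_of_coord h
  · rintro ⟨j, rfl⟩
    rw [coord_carrier]
    exact (𝒯.pos_pos x j).ne'

theorem carrier_eq_of_range_eq {n m : ℕ} {b : 𝒯.B n} {b' : 𝒯.B m}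
    (h : Set.range (𝒯.vert b) = Set.range (𝒯.vert b')) : (⟨n, b⟩ : Σ n, 𝒯.B n) = ⟨m, b'⟩ := by
  have hc := congrArg Set.ncard h
  rw [← Set.image_univ, ← Set.image_univ, Set.ncard_image_of_injective _ (𝒯.vert_injective b),
    Set.ncard_image_of_injective _ (𝒯.vert_injective b'), Set.ncard_univ, Set.ncard_univ,
    Nat.card_fin, Nat.card_fin] at hc
  obtain rfl : n = m := by omega
  rw [𝒯.eq_of_vertices_eq n b b' h]

/-- The vertices of the carrier are among those of `b`, hence span a face of `b`. This face is the
carrier, because simplices are determined by their vertices. -/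
theorem mem_range_simplex {n : ℕ} {b : 𝒯.B n} {x : X}
    (h : ∀ v, 𝒯.coord x v ≠ 0 → v ∈ Set.range (𝒯.vert b)) : x ∈ Set.range (𝒯.simplex n b) := by
  have h1 (l) : ∃ j, 𝒯.vert b j = 𝒯.vert (𝒯.carrier x) l :=
    h _ ((𝒯.coord_ne_zero_iff _ _).2 ⟨l, rfl⟩)
  choose f hf using h1
  have hinj : Function.Injective f := fun i j hij =>
    𝒯.vert_injective (𝒯.carrier x) (by rw [← hf, ← hf, hij])
  obtain ⟨q, π, hq⟩ := 𝒯.exists_subface n b _ f hinj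
  have hv (j) : 𝒯.vert b (f j) = 𝒯.vert q (π j) := by
    simpa [vert] using hq (stdSimplex.vertex j)
  have hcq : 𝒯.carrier x = q := by
    refine 𝒯.eq_of_vertices_eq _ _ _ ?_
    change Set.range (𝒯.vert _) = Set.range (𝒯.vert _)
    rw [← π.surjective.range_comp (𝒯.vert q)]
    congr 1
    ext l
    rw [← hf, hv]
    rfl
  refine ⟨simplexMap f (simplexMap π.symm (𝒯.pos x)), ?_⟩
  rw [hq, ← hcq]
  conv_rhs => rw [← 𝒯.simplex_carrier_pos x]
  congr 1
  have := DFunLike.congr_fun (simplexMap_comp π π.symm) (𝒯.pos x)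
  simpa [simplexMap_id] using this

theorem coord_injective : Function.Injective 𝒯.coord := by
  intro x x' h
  have hx' : x' ∈ Set.range (𝒯.simplex _ (𝒯.carrier x)) := by
    refine 𝒯.mem_range_simplex fun v hv => ?_
    rwa [← coord_ne_zero_iff, h]
  obtain ⟨z, rfl⟩ := hx'
  refine (𝒯.simplex_carrier_pos x).symm.trans (congrArg _ ?_)
  ext j
  rw [← coord_carrier, h, coord_vert]

theorem mem_range_simplex_iff {n : ℕ} {b : 𝒯.B n} {x : X} :
    x ∈ Set.range (𝒯.simplex n b) ↔ ∀ v, 𝒯.coord x v ≠ 0 → v ∈ Set.range (𝒯.vert b) := by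
  refine ⟨?_, 𝒯.mem_range_simplex⟩
  rintro ⟨z, rfl⟩ v hv
  exact 𝒯.mem_range_vert_of_coord hv

theorem continuous_coord (v : X) : Continuous fun x => 𝒯.coord x v := by
  classical
  rw [continuous_iff_isClosed]
  intro C hC
  refine 𝒯.isClosed_of_preimage _ fun n b => ?_
  have h : Continuous fun z : Simplex n => 𝒯.coord (𝒯.simplex n b z) v := by
    simp only [coord_simplex]
    refine continuous_finsetSum _ fun j _ => ?_
    split_ifs
    · exact (continuous_apply j).comp continuous_subtype_val
    · exact continuous_const
  exact hC.preimage h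

/-- A map into finitely many closed simplices is continuous if its barycentric coordinates are. -/
theorem continuous_of_coord {W : Type*} [TopologicalSpace W] {F : W → X} {S : Set (Σ n, 𝒯.B n)}
    (hS : S.Finite) (hF : ∀ w, ∃ s ∈ S, F w ∈ Set.range (𝒯.simplex s.1 s.2))
    (hc : ∀ v, Continuous fun w => 𝒯.coord (F w) v) : Continuous F := by
  rw [continuous_iff_isClosed]
  intro A hA
  have hcont : Continuous fun w => 𝒯.coord (F w) := continuous_pi hc
  have hcoord : Continuous 𝒯.coord := continuous_pi 𝒯.continuous_coord
  -- The weak topology may be finer than that of the coordinates, but each closed simplex has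
  -- compact image under the injective coordinate map. So finitely many simplices exhibit the
  -- preimage of `A` as closed.
  have : F ⁻¹' A = ⋃ s ∈ S, (fun w => 𝒯.coord (F w)) ⁻¹'
      ((fun z => 𝒯.coord (𝒯.simplex s.1 s.2 z)) '' (𝒯.simplex s.1 s.2 ⁻¹' A)) := by
    ext w
    simp only [Set.mem_preimage, Set.mem_iUnion, Set.mem_image]
    constructor
    · intro hw
      obtain ⟨s, hs, z, hz⟩ := hF w
      exact ⟨s, hs, z, by rwa [hz], by rw [hz]⟩
    · rintro ⟨s, -, z, hz, hzw⟩
      rwa [← 𝒯.coord_injective hzw]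
  rw [this]
  refine hS.isClosed_biUnion fun s _ => IsClosed.preimage hcont ?_
  exact ((hA.preimage (𝒯.simplex s.1 s.2).continuous).isCompact.image
    (hcoord.comp (𝒯.simplex s.1 s.2).continuous)).isClosed

/-- A compact set meets only finitely many open simplices. -/
theorem finite_carriers {K : Set X} (hK : IsCompact K) :
    ((fun x => (⟨𝒯.dim x, 𝒯.carrier x⟩ : Σ n, 𝒯.B n)) '' K).Finite := by
  -- `E` has one point in each open simplex that meets `K`. A closed simplex has finitely many
  -- faces, so it contains finitely many points of `E`; thus all subsets of `E` are closed, and `E`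
  -- is compact and discrete.
  obtain ⟨E, hEK, hE⟩ := (Set.surjOn_image (fun x => (⟨𝒯.dim x, 𝒯.carrier x⟩ : Σ n, 𝒯.B n))
    K).exists_bijOn_subset
  have hclosed : ∀ A ⊆ E, IsClosed A := by
    intro A hA
    refine 𝒯.isClosed_of_preimage A fun n b => Set.Finite.isClosed ?_
    refine Set.Finite.of_finite_image (f := fun z : Simplex n => {j | z j ≠ 0}) (Set.toFinite _) ?_
    intro z hz z' hz' h
    apply 𝒯.simplex_injective n b
    apply hE.injOn (hA hz) (hA hz')
    apply 𝒯.carrier_eq_of_range_eq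
    ext v
    rw [← coord_ne_zero_iff, ← coord_ne_zero_iff]
    by_cases hv : v ∈ Set.range (𝒯.vert b)
    · obtain ⟨j, rfl⟩ := hv
      rw [coord_vert, coord_vert]
      exact Set.ext_iff.1 h j
    · rw [coord_eq_zero _ _ _ hv, coord_eq_zero _ _ _ hv]
  have hEfin : E.Finite := by
    refine (hK.of_isClosed_subset (hclosed E subset_rfl) hEK).finite ?_
    refine ⟨discreteTopology_iff_forall_isClosed.2 fun s => ?_⟩
    have := (hclosed (Subtype.val '' s) (Subtype.coe_image_subset E s)).preimage
      (continuous_subtype_val (p := (· ∈ E)))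
    rwa [Set.preimage_image_eq _ Subtype.val_injective] at this
  rw [← hE.image_eq]
  exact hEfin.image _

/-! ### Straight cones in a triangulated space -/

/-- A vertex `a` and a point `x` lie in a common simplex. -/
def Joinable (a x : X) : Prop :=
  ∃ (n : ℕ) (b : 𝒯.B n), a ∈ Set.range (𝒯.vert b) ∧ x ∈ Set.range (𝒯.simplex n b)

theorem coord_vert_self {n : ℕ} (b : 𝒯.B n) (j : Fin (n + 1)) (v : X) :
    𝒯.coord (𝒯.vert b j) v ≠ 0 ↔ v = 𝒯.vert b j := by
  constructor
  · intro h
    obtain ⟨i, rfl⟩ := 𝒯.mem_range_vert_of_coord h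
    rw [vert, coord_vert] at h
    have : i = j := by
      by_contra hij
      exact h (by simp [hij])
    rw [this]
  · rintro rfl
    change 𝒯.coord (𝒯.simplex n b _) _ ≠ 0
    rw [coord_vert]
    simp

theorem coord_segPoint {n : ℕ} (b : 𝒯.B n) (s : unitInterval) (y z : Simplex n) :
    𝒯.coord (𝒯.simplex n b (segPoint s y z)) =
      (s : ℝ) • 𝒯.coord (𝒯.simplex n b y) + (1 - s : ℝ) • 𝒯.coord (𝒯.simplex n b z) := by
  classical
  ext v
  simp only [Pi.add_apply, Pi.smul_apply, smul_eq_mul, coord_simplex, Finset.mul_sum,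
    ← Finset.sum_add_distrib, segPoint_apply]
  refine Finset.sum_congr rfl fun i _ => ?_
  split_ifs
  · rfl
  · simp

theorem Joinable.exists_point {a x : X} (h : 𝒯.Joinable a x) (s : unitInterval) :
    ∃ x', 𝒯.coord x' = (s : ℝ) • 𝒯.coord a + (1 - s : ℝ) • 𝒯.coord x := by
  obtain ⟨n, b, ⟨j, rfl⟩, z, rfl⟩ := h
  exact ⟨_, 𝒯.coord_segPoint b s _ z⟩

/-- The cone is defined pointwise and has continuous coordinates. Its continuity follows since the
image of `τ` meets finitely many open simplices, and for each of these a single simplex contains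
both it and the apex. -/
theorem coneable_of_joinable {a : X} {k : ℕ} {τ : C(Simplex k, X)}
    (h : ∀ p, 𝒯.Joinable a (τ p)) : Coneable 𝒯.coord a τ := by
  choose F hF using fun q : unitInterval × Simplex k => (h q.2).exists_point 𝒯 q.1
  refine coneable_of_continuous 𝒯.coord_injective ⟨F, ?_⟩ fun s y => hF (s, y)
  have hfin := 𝒯.finite_carriers (isCompact_range τ.continuous)
  rw [← Set.range_comp] at hfin
  have hex (p : Simplex k) : ∃ s : Σ n, 𝒯.B n, a ∈ Set.range (𝒯.vert s.2) ∧
      Set.range (𝒯.vert (𝒯.carrier (τ p))) ⊆ Set.range (𝒯.vert s.2) := by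
    obtain ⟨n, b, ha, hx⟩ := h p
    refine ⟨⟨n, b⟩, ha, fun v hv => ?_⟩
    exact 𝒯.mem_range_simplex_iff.1 hx v ((𝒯.coord_ne_zero_iff _ _).2 hv)
  have hex' (q : Set.range ((fun x => (⟨𝒯.dim x, 𝒯.carrier x⟩ : Σ n, 𝒯.B n)) ∘ τ)) :
      ∃ s : Σ n, 𝒯.B n, a ∈ Set.range (𝒯.vert s.2) ∧
        Set.range (𝒯.vert q.1.2) ⊆ Set.range (𝒯.vert s.2) := by
    obtain ⟨_, p, rfl⟩ := q
    exact hex p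
  choose G hG using hex'
  have := hfin.to_subtype
  refine 𝒯.continuous_of_coord (S := Set.range G) (Set.finite_range G) (fun q => ?_) fun v => ?_
  · obtain ⟨ha, hc⟩ := hG ⟨_, q.2, rfl⟩
    refine ⟨_, ⟨⟨_, q.2, rfl⟩, rfl⟩, 𝒯.mem_range_simplex fun v hv => ?_⟩
    rw [hF] at hv
    simp only [Pi.add_apply, Pi.smul_apply, smul_eq_mul] at hv
    by_cases h1 : 𝒯.coord (τ q.2) v = 0
    · have h2 : 𝒯.coord a v ≠ 0 := by
        rintro h2
        simp [h1, h2] at hv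
      obtain ⟨j, rfl⟩ := ha
      rw [coord_vert_self] at h2
      exact ⟨j, h2.symm⟩
    · exact hc ((𝒯.coord_ne_zero_iff _ _).1 h1)
  · simp only [hF, Pi.add_apply, Pi.smul_apply, smul_eq_mul]
    have h1 : Continuous fun q : unitInterval × Simplex k => (q.1 : ℝ) :=
      continuous_subtype_val.comp continuous_fst
    have h2 : Continuous fun q : unitInterval × Simplex k => 𝒯.coord (τ q.2) v :=
      (𝒯.continuous_coord v).comp (τ.continuous.comp continuous_snd)
    exact (h1.mul continuous_const).add ((continuous_const.sub h1).mul h2)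

/-- Conversely, halfway along a segment of the cone the support of the coordinates contains both the
apex and the support of `τ p`, so the carrier there joins them. Coneability thus becomes a pointwise
condition, accessible to measurability arguments. -/
theorem coneable_iff_joinable {n : ℕ} {b : 𝒯.B n} {j : Fin (n + 1)} {k : ℕ} {τ : C(Simplex k, X)} :
    Coneable 𝒯.coord (𝒯.vert b j) τ ↔ ∀ p, 𝒯.Joinable (𝒯.vert b j) (τ p) := by
  refine ⟨?_, 𝒯.coneable_of_joinable⟩
  rintro ⟨κ, hκ⟩ p
  have h := hκ ⟨1 / 2, by norm_num, by norm_num⟩ p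
  set x := κ (joinPt k (⟨1 / 2, by norm_num, by norm_num⟩, p)) with hx
  have hnn (v) : 𝒯.coord x v =
      1 / 2 * 𝒯.coord (𝒯.vert b j) v + (1 - 1 / 2) * 𝒯.coord (τ p) v := by
    rw [h]
    simp
  refine ⟨_, 𝒯.carrier x, ?_, 𝒯.mem_range_simplex fun v hv => ?_⟩
  · rw [← coord_ne_zero_iff, hnn]
    have h1 := (𝒯.coord_vert_self b j (𝒯.vert b j)).2 rfl
    have h2 := (𝒯.coord_nonneg (𝒯.vert b j) (𝒯.vert b j)).lt_of_ne' h1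
    have h3 := 𝒯.coord_nonneg (τ p) (𝒯.vert b j)
    nlinarith
  · rw [← coord_ne_zero_iff, hnn]
    have h2 := (𝒯.coord_nonneg (τ p) v).lt_of_ne' hv
    have h3 := 𝒯.coord_nonneg (𝒯.vert b j) v
    nlinarith

theorem isClosed_joinable (a : X) : IsClosed {x | 𝒯.Joinable a x} := by
  refine 𝒯.isClosed_of_preimage _ fun n b => ?_
  -- Within one simplex the condition depends only on the support, and defines a finite union of
  -- closed faces.
  have : 𝒯.simplex n b ⁻¹' {x | 𝒯.Joinable a x} =
      ⋃ F ∈ {F : Set (Fin (n + 1)) | ∃ (m : ℕ) (b' : 𝒯.B m), a ∈ Set.range (𝒯.vert b') ∧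
        𝒯.vert b '' F ⊆ Set.range (𝒯.vert b')}, {z : Simplex n | ∀ j ∉ F, z j = 0} := by
    ext z
    simp only [Set.mem_preimage, Set.mem_ofPred_eq, Set.mem_iUnion, exists_prop, Joinable]
    constructor
    · rintro ⟨m, b', ha, hx⟩
      refine ⟨{j | z j ≠ 0}, ⟨m, b', ha, ?_⟩, fun j hj => by simpa using hj⟩
      rintro _ ⟨j, hj, rfl⟩
      exact 𝒯.mem_range_simplex_iff.1 hx _ (by rwa [coord_vert])
    · rintro ⟨F, ⟨m, b', ha, hF⟩, hz⟩
      refine ⟨m, b', ha, 𝒯.mem_range_simplex fun v hv => ?_⟩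
      obtain ⟨j, rfl⟩ := 𝒯.mem_range_vert_of_coord hv
      rw [coord_vert] at hv
      exact hF ⟨j, by_contra fun hj => hv (hz j hj), rfl⟩
  rw [this]
  refine (Set.toFinite _).isClosed_biUnion fun F _ => ?_
  simp only [Set.ofPred_forall]
  refine isClosed_iInter fun j => isClosed_iInter fun _ => ?_
  exact isClosed_eq ((continuous_apply j).comp continuous_subtype_val) continuous_const

/-! ### Dominant vertices and small singular simplices -/

end Triangulation

open Classical in
/-- The first among the indices of the largest coordinates. -/
def domIdx {n : ℕ} (y : Simplex n) : Fin (n + 1) :=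
  (Finset.univ.filter fun j => ∀ k, y k ≤ y j).min' (by
    obtain ⟨j, -, hj⟩ := Finset.exists_max_image Finset.univ y ⟨0, Finset.mem_univ _⟩
    exact ⟨j, by simpa using hj⟩)

theorem le_domIdx {n : ℕ} (y : Simplex n) (k : Fin (n + 1)) : y k ≤ y (domIdx y) := by
  classical
  have h : domIdx y ∈ Finset.univ.filter fun j => ∀ k, y k ≤ y j := Finset.min'_mem _ _
  exact (Finset.mem_filter.1 h).2 k

theorem domIdx_eq_iff {n : ℕ} (y : Simplex n) (j : Fin (n + 1)) :
    domIdx y = j ↔ (∀ k, y k ≤ y j) ∧ ∀ i < j, ¬ ∀ k, y k ≤ y i := by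
  classical
  constructor
  · rintro rfl
    refine ⟨le_domIdx y, fun i hi h => hi.not_ge ?_⟩
    exact Finset.min'_le _ _ (by simpa using h)
  · rintro ⟨h1, h2⟩
    refine le_antisymm (Finset.min'_le _ _ (by simpa using h1)) ?_
    by_contra hlt
    exact h2 _ (not_le.1 hlt) (le_domIdx y)

namespace Triangulation

variable {X : Type u} [TopologicalSpace X] (𝒯 : Triangulation X)

/-- The dominant vertex of a point: a vertex at which its barycentric coordinate is largest. -/
def dom (x : X) : X := 𝒯.vert (𝒯.carrier x) (domIdx (𝒯.pos x))

theorem coord_dom_ne_zero (x : X) : 𝒯.coord x (𝒯.dom x) ≠ 0 :=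
  (𝒯.coord_ne_zero_iff _ _).2 ⟨_, rfl⟩

theorem coord_le_coord_dom (x v : X) : 𝒯.coord x v ≤ 𝒯.coord x (𝒯.dom x) := by
  by_cases h : 𝒯.coord x v = 0
  · rw [h]
    exact 𝒯.coord_nonneg _ _
  · obtain ⟨j, rfl⟩ := (𝒯.coord_ne_zero_iff _ _).1 h
    rw [dom, coord_carrier, coord_carrier]
    exact le_domIdx _ _

@[simp]
theorem dom_vert {n : ℕ} (b : 𝒯.B n) (j : Fin (n + 1)) : 𝒯.dom (𝒯.vert b j) = 𝒯.vert b j :=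
  (𝒯.coord_vert_self b j _).1 (𝒯.coord_dom_ne_zero _)

/-- A singular simplex is small with respect to a triangulation if each of its points lies in a
common simplex with the dominant vertices of all its points. -/
def IsSmall {k : ℕ} (σ : C(Simplex k, X)) : Prop :=
  ∀ p, ∃ (n : ℕ) (b : 𝒯.B n), σ p ∈ Set.range (𝒯.simplex n b) ∧
    ∀ q, 𝒯.dom (σ q) ∈ Set.range (𝒯.vert b)

theorem IsSmall.comp {k l : ℕ} {σ : C(Simplex k, X)} (h : 𝒯.IsSmall σ)
    (u : C(Simplex l, Simplex k)) : 𝒯.IsSmall (σ.comp u) := by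
  intro p
  obtain ⟨n, b, hb, hb'⟩ := h (u p)
  exact ⟨n, b, hb, fun q => hb' (u q)⟩

theorem isSmall_of_zero (σ : C(Simplex 0, X)) : 𝒯.IsSmall σ := by
  refine fun p => ⟨_, 𝒯.carrier (σ p), ⟨_, 𝒯.simplex_carrier_pos _⟩, fun q => ?_⟩
  obtain rfl : p = q := Subsingleton.elim _ _
  exact ⟨_, rfl⟩

theorem isSmall_simplex {n : ℕ} (b : 𝒯.B n) : 𝒯.IsSmall (𝒯.simplex n b) :=
  fun p => ⟨n, b, ⟨p, rfl⟩, fun _ => 𝒯.mem_range_vert_of_coord (𝒯.coord_dom_ne_zero _)⟩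

theorem sum_coord_le_one (s : Finset X) (x : X) : ∑ v ∈ s, 𝒯.coord x v ≤ 1 := by
  classical
  have h1 : ∑ j, 𝒯.coord x (𝒯.vert (𝒯.carrier x) j) = 1 := by
    simp only [coord_carrier, stdSimplex.sum_eq_one]
  rw [← h1, ← Finset.sum_image (s := Finset.univ) (g := 𝒯.vert (𝒯.carrier x)) (f := 𝒯.coord x)
    fun _ _ _ _ h => 𝒯.vert_injective _ h]
  rw [← Finset.sum_filter_ne_zero]
  refine Finset.sum_le_sum_of_subset_of_nonneg ?_ fun v _ _ => 𝒯.coord_nonneg x v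
  intro v hv
  obtain ⟨j, hj⟩ := (𝒯.coord_ne_zero_iff _ _).1 (Finset.mem_filter.1 hv).2
  simp [← hj]

theorem exists_open_small (x : X) : ∃ U : Set X, IsOpen U ∧ x ∈ U ∧ ∃ (n : ℕ) (b : 𝒯.B n),
    ∀ x' ∈ U, (∀ j, 𝒯.coord x' (𝒯.vert b j) ≠ 0) ∧ 𝒯.dom x' ∈ Set.range (𝒯.vert b) := by
  classical
  set n := 𝒯.dim x
  set b := 𝒯.carrier x
  -- The threshold is forced by counting: were the dominant vertex not among the `n + 1` vertices of
  -- `b`, its coordinate would be at least each of theirs while all `n + 2` sum to at most one, so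
  -- those of `b` would sum to at most `(n + 1) / (n + 2)`.
  refine ⟨(⋂ j, {x' | 𝒯.coord x' (𝒯.vert b j) ≠ 0}) ∩
    {x' | ((n : ℝ) + 1) / (n + 2) < ∑ j, 𝒯.coord x' (𝒯.vert b j)}, ?_, ?_, n, b, ?_⟩
  · refine (isOpen_iInter_of_finite fun j => ?_).inter ?_
    · exact isOpen_ne_fun (𝒯.continuous_coord _) continuous_const
    · exact isOpen_lt continuous_const (continuous_finsetSum _ fun j _ => 𝒯.continuous_coord _)
  · refine ⟨Set.mem_iInter.2 fun j => (𝒯.coord_ne_zero_iff _ _).2 ⟨j, rfl⟩, ?_⟩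
    change _ < ∑ j, 𝒯.coord x (𝒯.vert b j)
    simp only [b, coord_carrier, stdSimplex.sum_eq_one]
    rw [div_lt_one (by positivity)]
    linarith
  · rintro x' ⟨h1, h2⟩
    refine ⟨Set.mem_iInter.1 h1, ?_⟩
    by_contra hd
    have h2 : ((n : ℝ) + 1) / (n + 2) < ∑ j, 𝒯.coord x' (𝒯.vert b j) := h2
    have h3 := 𝒯.sum_coord_le_one (insert (𝒯.dom x') (Finset.univ.image (𝒯.vert b))) x'
    rw [Finset.sum_insert (by simpa using hd),
      Finset.sum_image fun _ _ _ _ h => 𝒯.vert_injective _ h] at h3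
    have h4 : ∑ j, 𝒯.coord x' (𝒯.vert b j) ≤ (n + 1) * 𝒯.coord x' (𝒯.dom x') := by
      refine (Finset.sum_le_sum fun j _ => 𝒯.coord_le_coord_dom x' (𝒯.vert b j)).trans_eq ?_
      simp [n]
    rw [div_lt_iff₀ (by positivity)] at h2
    nlinarith

/-- Sufficiently small pieces of a singular simplex are small with respect to the triangulation. -/
theorem exists_isSmall_comp {n : ℕ} (σ : C(Simplex n, X)) : ∃ ε > 0, ∀ (k : ℕ)
    (u : C(Simplex k, Simplex n)), (∀ p q, dist (u p) (u q) < ε) → 𝒯.IsSmall (σ.comp u) := by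
  choose U hU hxU hsmall using 𝒯.exists_open_small
  -- A piece finer than the Lebesgue number maps into one of the neighborhoods. Its simplex `b`
  -- contains the dominant vertices of all points of the piece and is itself a face of the carrier
  -- of each point.
  obtain ⟨ε, hε, h⟩ := lebesgue_number_lemma_of_metric (s := (Set.univ : Set (Simplex n)))
    isCompact_univ (fun x => (hU x).preimage σ.continuous)
    (fun p _ => Set.mem_iUnion.2 ⟨σ p, hxU (σ p)⟩)
  refine ⟨ε, hε, fun k u hu => ?_⟩
  obtain ⟨x, hx⟩ := h (u (stdSimplex.vertex 0)) (Set.mem_univ _)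
  obtain ⟨m, b, hb⟩ := hsmall x
  refine fun p => ⟨_, 𝒯.carrier (σ (u p)), ⟨_, 𝒯.simplex_carrier_pos _⟩, fun q => ?_⟩
  obtain ⟨j, hj⟩ := (hb _ (hx (hu q _))).2
  change 𝒯.dom (σ (u q)) ∈ Set.range (𝒯.vert (𝒯.carrier (σ (u p))))
  rw [← hj]
  exact (𝒯.coord_ne_zero_iff _ _).1 ((hb _ (hx (hu p _))).1 j)

end Triangulation

namespace Triangulation

variable {X : Type u} [TopologicalSpace X] (𝒯 : Triangulation X)

/-! ### Alternating extension of simplicial cochains -/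

section Hat

variable {G H : Type*} [AddCommGroup G] [AddCommGroup H]

open Classical in
/-- The alternating extension of a simplicial cochain to all tuples of points: it vanishes on the
tuples that are not the tuples of vertices of a simplex. -/
def hat {n : ℕ} (c : 𝒯.B n → G) (w : Fin (n + 1) → X) : G :=
  if h : ∃ (b : 𝒯.B n) (π : Equiv.Perm (Fin (n + 1))), w = 𝒯.vert b ∘ π then
    (Equiv.Perm.sign h.choose_spec.choose : ℤ) • c h.choose else 0

theorem vert_comp_perm_inj {n : ℕ} {b b' : 𝒯.B n} {π π' : Equiv.Perm (Fin (n + 1))}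
    (h : 𝒯.vert b ∘ π = 𝒯.vert b' ∘ π') : b = b' ∧ π = π' := by
  have hr := congrArg Set.range h
  rw [π.surjective.range_comp, π'.surjective.range_comp] at hr
  obtain rfl := 𝒯.eq_of_vertices_eq n b b' hr
  exact ⟨rfl, Equiv.ext fun j => 𝒯.vert_injective b (congrFun h j)⟩

theorem hat_vert_comp {n : ℕ} (c : 𝒯.B n → G) (b : 𝒯.B n) (π : Equiv.Perm (Fin (n + 1))) :
    𝒯.hat c (𝒯.vert b ∘ π) = (Equiv.Perm.sign π : ℤ) • c b := by
  have h : ∃ (b' : 𝒯.B n) (π' : Equiv.Perm (Fin (n + 1))), 𝒯.vert b ∘ π = 𝒯.vert b' ∘ π' :=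
    ⟨b, π, rfl⟩
  obtain ⟨h1, h2⟩ := 𝒯.vert_comp_perm_inj h.choose_spec.choose_spec
  rw [hat, dif_pos h, ← h2, ← h1]

theorem hat_vert {n : ℕ} (c : 𝒯.B n → G) (b : 𝒯.B n) : 𝒯.hat c (𝒯.vert b) = c b := by
  simpa using 𝒯.hat_vert_comp c b 1

theorem hat_eq_zero {n : ℕ} (c : 𝒯.B n → G) {w : Fin (n + 1) → X}
    (h : ¬ ∃ (b : 𝒯.B n) (π : Equiv.Perm (Fin (n + 1))), w = 𝒯.vert b ∘ π) : 𝒯.hat c w = 0 := by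
  rw [hat, dif_neg h]

theorem isAlternating_hat {n : ℕ} (c : 𝒯.B n → G) : IsAlternating (𝒯.hat c) where
  comp_perm w ρ := by
    by_cases h : ∃ (b : 𝒯.B n) (π : Equiv.Perm (Fin (n + 1))), w = 𝒯.vert b ∘ π
    · obtain ⟨b, π, rfl⟩ := h
      have e : (𝒯.vert b ∘ π) ∘ ρ = 𝒯.vert b ∘ (π * ρ : Equiv.Perm _) := rfl
      rw [e, hat_vert_comp, hat_vert_comp, smul_smul, Equiv.Perm.sign_mul, mul_comm]
      simp
    · rw [hat_eq_zero _ _ h, hat_eq_zero, smul_zero]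
      rintro ⟨b, π, hw⟩
      refine h ⟨b, π * ρ⁻¹, ?_⟩
      ext j
      have := congrFun hw (ρ⁻¹ j)
      simpa using this
  eq_zero w hw := by
    apply hat_eq_zero
    rintro ⟨b, π, rfl⟩
    exact hw ((𝒯.vert_injective b).comp π.injective)

theorem map_hat {n : ℕ} (f : G →+ H) (c : 𝒯.B n → G) (w : Fin (n + 1) → X) :
    f (𝒯.hat c w) = 𝒯.hat (fun b => f (c b)) w := by
  unfold hat
  split_ifs <;> simp

theorem exists_eq_vert_comp {n k : ℕ} {b : 𝒯.B n} {w : Fin (k + 1) → X}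
    (hw : Function.Injective w) (h : ∀ i, w i ∈ Set.range (𝒯.vert b)) :
    ∃ (q : 𝒯.B k) (π : Equiv.Perm (Fin (k + 1))), w = 𝒯.vert q ∘ π := by
  choose f hf using h
  obtain ⟨q, π, hq⟩ := 𝒯.exists_subface n b k f fun i j hij => hw (by rw [← hf, ← hf, hij])
  refine ⟨q, π, funext fun i => ?_⟩
  rw [← hf]
  simpa [vert] using hq (stdSimplex.vertex i)

theorem simplex_comp_faceMap {n : ℕ} (b : 𝒯.B (n + 1)) (i : Fin (n + 2)) :
    (𝒯.simplex (n + 1) b).comp (faceMap i) =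
      (𝒯.simplex n (𝒯.face b i)).comp (simplexMap (𝒯.facePerm b i)) :=
  ContinuousMap.ext (𝒯.exists_face n b i).choose_spec.choose_spec

theorem vert_comp_succAbove {n : ℕ} (b : 𝒯.B (n + 1)) (i : Fin (n + 2)) :
    𝒯.vert b ∘ i.succAbove = 𝒯.vert (𝒯.face b i) ∘ 𝒯.facePerm b i := by
  ext j
  have := DFunLike.congr_fun (𝒯.simplex_comp_faceMap b i) (stdSimplex.vertex j)
  simpa [faceMap, vert] using this

/-- Both sides are alternating, so it suffices to compare them on `vert q` for a simplex `q`. The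
entries must lie in a common simplex: otherwise faces of the tuple could span simplices when the
tuple does not. -/
theorem hat_coboundary {n : ℕ} {G : Type v} [AddCommGroup G] (c : 𝒯.B n → G)
    {w : Fin (n + 2) → X} {m : ℕ} {b : 𝒯.B m} (h : ∀ i, w i ∈ Set.range (𝒯.vert b)) :
    𝒯.hat (𝒯.coboundary G n c) w = tupleDelta (𝒯.hat c) w := by
  have h1 := 𝒯.isAlternating_hat (𝒯.coboundary G n c)
  have h2 := (𝒯.isAlternating_hat c).tupleDelta
  by_cases hw : Function.Injective w
  · obtain ⟨q, π, rfl⟩ := 𝒯.exists_eq_vert_comp hw h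
    rw [h1.comp_perm, h2.comp_perm, hat_vert]
    congr 1
    simp only [coboundary, AddMonoidHom.coe_mk, ZeroHom.coe_mk, tupleDelta]
    refine Finset.sum_congr rfl fun i _ => ?_
    rw [vert_comp_succAbove, hat_vert_comp, smul_smul]
    rfl
  · rw [h1.eq_zero w hw, h2.eq_zero w hw]

end Hat

/-! ### Simplices with sorted vertices -/

section Sorted

variable (r : X → ℝ)

/-- The permutation sorting the vertices of a simplex. -/
def sortPerm {n : ℕ} (b : 𝒯.B n) : Equiv.Perm (Fin (n + 1)) := Tuple.sort (r ∘ 𝒯.vert b)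

variable {r}

theorem sortPerm_eq_iff (hr : Function.Injective r) {n : ℕ} (b : 𝒯.B n)
    (π : Equiv.Perm (Fin (n + 1))) : 𝒯.sortPerm r b = π ↔ StrictMono (r ∘ 𝒯.vert b ∘ π) := by
  have hinj : Function.Injective (r ∘ 𝒯.vert b) := hr.comp (𝒯.vert_injective b)
  have hs : Monotone ((r ∘ 𝒯.vert b) ∘ 𝒯.sortPerm r b) := Tuple.monotone_sort _
  constructor
  · rintro rfl
    exact hs.strictMono_of_injective (hinj.comp (Equiv.injective _))
  · intro h
    have := Tuple.unique_monotone hs (τ := π) h.monotone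
    exact Equiv.ext fun j => hinj (congrFun this j)

variable (r)

/-- A simplex with sorted vertices, as an oriented singular simplex. -/
def sortedChain {n : ℕ} (b : 𝒯.B n) : Chain X n :=
  (Equiv.Perm.sign (𝒯.sortPerm r b) : ℤ) •
    of ((𝒯.simplex n b).comp (simplexMap (𝒯.sortPerm r b)))

variable {r}

/-- Omitting a vertex from an increasing list leaves an increasing list, so the faces of a sorted
simplex are the sorted faces as maps. Only signs remain, and they combine to the incidence numbers.
-/
theorem boundary_sortedChain (hr : Function.Injective r) {n : ℕ} (b : 𝒯.B (n + 1)) :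
    boundary n (𝒯.sortedChain r b) = 𝒯.coboundary (Chain X n) n (𝒯.sortedChain r) b := by
  have hsort := (𝒯.sortPerm_eq_iff hr b _).1 rfl
  set π := 𝒯.sortPerm r b with hπ
  rw [sortedChain, map_zsmul, boundary_of, Finset.smul_sum]
  simp only [coboundary, AddMonoidHom.coe_mk, ZeroHom.coe_mk, incidence]
  symm
  rw [← Equiv.sum_comp π]
  symm
  refine Finset.sum_congr rfl fun k _ => ?_
  obtain ⟨π', h, hs⟩ := exists_perm_succAbove π k
  have hcomp : π ∘ k.succAbove = (π k).succAbove ∘ π' := funext h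
  have hq : 𝒯.sortPerm r (𝒯.face b (π k)) = 𝒯.facePerm b (π k) * π' := by
    rw [sortPerm_eq_iff _ hr]
    have e : r ∘ 𝒯.vert (𝒯.face b (π k)) ∘ (𝒯.facePerm b (π k) * π' : Equiv.Perm _) =
        (r ∘ 𝒯.vert b ∘ π) ∘ k.succAbove := by
      have := 𝒯.vert_comp_succAbove b (π k)
      rw [Equiv.Perm.coe_mul, ← Function.comp_assoc (𝒯.vert _), ← this]
      simp only [Function.comp_assoc, hcomp]
    rw [e]
    exact hsort.comp (Fin.strictMono_succAbove k)
  rw [sortedChain, hq, smul_smul, smul_smul, ← hπ, Equiv.Perm.coe_mul, ← simplexMap_comp,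
    ← ContinuousMap.comp_assoc, ← simplex_comp_faceMap, ContinuousMap.comp_assoc,
    ContinuousMap.comp_assoc, faceMap, faceMap, simplexMap_comp, simplexMap_comp, hcomp,
    Equiv.Perm.sign_mul]
  congr 1
  have h3 := Int.units_coe_mul_self (Equiv.Perm.sign (𝒯.facePerm b (π k)))
  push_cast
  linear_combination hs - (-1) ^ (π k : ℕ) * (Equiv.Perm.sign π' : ℤ) * h3

end Sorted

/-! ### The homotopy between a small singular simplex and its simplicial approximation -/

section Homotopy

variable (r : X → ℝ)

/-- The dominant vertices of the vertices of a singular simplex. -/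
def domTuple {n : ℕ} (σ : C(Simplex n, X)) (i : Fin (n + 1)) : X :=
  𝒯.dom (σ (stdSimplex.vertex i))

theorem domTuple_comp_faceMap {n : ℕ} (σ : C(Simplex (n + 1), X)) (i : Fin (n + 2)) :
    𝒯.domTuple (σ.comp (faceMap i)) = 𝒯.domTuple σ ∘ i.succAbove := by
  ext j
  simp [domTuple, faceMap]

theorem IsSmall.exists_domTuple_mem {n : ℕ} {σ : C(Simplex n, X)} (h : 𝒯.IsSmall σ) :
    ∃ (m : ℕ) (b : 𝒯.B m), ∀ i, 𝒯.domTuple σ i ∈ Set.range (𝒯.vert b) := by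
  obtain ⟨m, b, -, hb⟩ := h (stdSimplex.vertex 0)
  exact ⟨m, b, fun i => hb _⟩

/-- The simplicial approximation of a small singular simplex. -/
def approx {n : ℕ} (σ : C(Simplex n, X)) : Chain X n :=
  𝒯.hat (𝒯.sortedChain r) (𝒯.domTuple σ)

variable {r}

/-- This is `hat_coboundary` for the cochain `sortedChain` with values in chains; smallness puts the
dominant vertices in a common simplex. -/
theorem boundary_approx (hr : Function.Injective r) {n : ℕ} {σ : C(Simplex (n + 1), X)}
    (h : 𝒯.IsSmall σ) :
    boundary n (𝒯.approx r σ) = lift (𝒯.approx r) (boundary n (of σ)) := by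
  obtain ⟨m, b, hb⟩ := h.exists_domTuple_mem
  rw [approx, map_hat]
  simp only [𝒯.boundary_sortedChain hr]
  rw [hat_coboundary _ _ hb, boundary_of, map_sum, tupleDelta]
  refine Finset.sum_congr rfl fun i _ => ?_
  rw [map_zsmul, lift_apply_of, approx, domTuple_comp_faceMap]

theorem augmentation_approx (σ : C(Simplex 0, X)) : augmentation X (𝒯.approx r σ) = 1 := by
  obtain ⟨m, b, hb⟩ := (𝒯.isSmall_of_zero σ).exists_domTuple_mem
  have hs : Subsingleton (Fin (0 + 1)) := inferInstanceAs (Subsingleton (Fin 1))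
  obtain ⟨q, π, hq⟩ := 𝒯.exists_eq_vert_comp (Function.injective_of_subsingleton _) hb
  have h1 (ρ : Equiv.Perm (Fin (0 + 1))) : ρ = 1 := Subsingleton.elim _ _
  rw [approx, map_hat, hq, hat_vert_comp, sortedChain, h1 π, h1 (𝒯.sortPerm r q)]
  simp

/-- Each point of `τ` lies in the simplex spanned by the carrier of some point of `σ` and the
dominant vertices of `σ`. -/
def IsCarried {k n : ℕ} (σ : C(Simplex n, X)) (τ : C(Simplex k, X)) : Prop :=
  ∀ p, ∃ y, ∀ v, 𝒯.coord (τ p) v ≠ 0 → 𝒯.coord (σ y) v ≠ 0 ∨ ∃ q, v = 𝒯.dom (σ q)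

/-- Smallness supplies one simplex containing `σ y` and all the dominant vertices, hence also the
point of `τ` and the apex. -/
theorem IsCarried.coneable {k n : ℕ} {σ : C(Simplex n, X)} {τ : C(Simplex k, X)}
    (h : 𝒯.IsCarried σ τ) (hσ : 𝒯.IsSmall σ) (q : Simplex n) :
    Coneable 𝒯.coord (𝒯.dom (σ q)) τ := by
  refine 𝒯.coneable_of_joinable fun p => ?_
  obtain ⟨y, hy⟩ := h p
  obtain ⟨m, b, hb, hb'⟩ := hσ y
  refine ⟨m, b, hb' q, 𝒯.mem_range_simplex fun v hv => ?_⟩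
  rcases hy v hv with hv' | ⟨q', rfl⟩
  · exact 𝒯.mem_range_simplex_iff.1 hb v hv'
  · exact hb' q'

theorem IsCarried.coneMap {k n : ℕ} {σ : C(Simplex n, X)} {τ : C(Simplex k, X)}
    (h : 𝒯.IsCarried σ τ) (hσ : 𝒯.IsSmall σ) (q : Simplex n) :
    𝒯.IsCarried σ (coneMap 𝒯.coord (𝒯.dom (σ q)) τ) := by
  intro p
  obtain ⟨⟨s, x⟩, rfl⟩ := joinPt_surjective k p
  obtain ⟨y, hy⟩ := h x
  refine ⟨y, fun v hv => ?_⟩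
  rw [(h.coneable 𝒯 hσ q).isCone] at hv
  simp only [Pi.add_apply, Pi.smul_apply, smul_eq_mul] at hv
  by_cases h1 : 𝒯.coord (τ x) v = 0
  · have h2 : 𝒯.coord (𝒯.dom (σ q)) v ≠ 0 := by
      rintro h2
      simp [h1, h2] at hv
    rw [dom, coord_vert_self] at h2
    exact Or.inr ⟨q, h2⟩
  · exact hy v h1

theorem IsCarried.of_comp {k l n : ℕ} {σ : C(Simplex n, X)} {u : C(Simplex l, Simplex n)}
    {τ : C(Simplex k, X)} (h : 𝒯.IsCarried (σ.comp u) τ) : 𝒯.IsCarried σ τ := by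
  intro p
  obtain ⟨y, hy⟩ := h p
  exact ⟨u y, fun v hv => (hy v hv).imp_right fun ⟨q, hq⟩ => ⟨u q, hq⟩⟩

theorem approx_mem_chainsIn {n : ℕ} (σ : C(Simplex n, X)) :
    𝒯.approx r σ ∈ chainsIn (𝒯.IsCarried σ (k := n)) := by
  by_cases h : ∃ (b : 𝒯.B n) (π : Equiv.Perm (Fin (n + 1))), 𝒯.domTuple σ = 𝒯.vert b ∘ π
  · obtain ⟨b, π, hb⟩ := h
    rw [approx, hb, hat_vert_comp, sortedChain]
    refine zsmul_mem (zsmul_mem (of_mem_chainsIn fun p => ⟨p, fun v hv => Or.inr ?_⟩) _) _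
    obtain ⟨j, rfl⟩ := 𝒯.mem_range_vert_of_coord hv
    obtain ⟨i, rfl⟩ := π.surjective j
    exact ⟨_, (congrFun hb i).symm⟩
  · rw [approx, hat_eq_zero _ _ h]
    exact zero_mem _

variable (r)

/-- The chain homotopy between the identity and the simplicial approximation. -/
def approxHtpy : (n : ℕ) → C(Simplex n, X) → Chain X (n + 1)
  | 0, σ => cone 𝒯.coord (𝒯.domTuple σ 0) 0 (of σ - 𝒯.approx r σ)
  | n + 1, σ => cone 𝒯.coord (𝒯.domTuple σ 0) (n + 1)
      (of σ - 𝒯.approx r σ - lift (approxHtpy n) (boundary n (of σ)))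

theorem approxHtpy_succ {n : ℕ} (σ : C(Simplex (n + 1), X)) : 𝒯.approxHtpy r (n + 1) σ =
    cone 𝒯.coord (𝒯.domTuple σ 0) (n + 1)
      (of σ - 𝒯.approx r σ - lift (𝒯.approxHtpy r n) (boundary n (of σ))) := rfl

variable {r}

theorem of_sub_approx_mem {n : ℕ} (σ : C(Simplex n, X)) :
    of σ - 𝒯.approx r σ ∈ chainsIn (𝒯.IsCarried σ (k := n)) :=
  sub_mem (of_mem_chainsIn fun p => ⟨p, fun _ h => Or.inl h⟩) (𝒯.approx_mem_chainsIn σ)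

theorem cone_mem_chainsIn {k n : ℕ} {σ : C(Simplex n, X)} (hσ : 𝒯.IsSmall σ) {z : Chain X k}
    (hz : z ∈ chainsIn (𝒯.IsCarried σ (k := k))) :
    cone 𝒯.coord (𝒯.domTuple σ 0) k z ∈ chainsIn (𝒯.IsCarried σ (k := k + 1)) := by
  refine map_mem_of_mem_chainsIn (fun τ hτ => ?_) hz
  rw [cone_of]
  exact of_mem_chainsIn (hτ.coneMap 𝒯 hσ _)

theorem chainsIn_isCarried_le_coneable {k n : ℕ} {σ : C(Simplex n, X)} (hσ : 𝒯.IsSmall σ) :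
    chainsIn (𝒯.IsCarried σ (k := k)) ≤ chainsIn (Coneable 𝒯.coord (𝒯.domTuple σ 0)) :=
  AddSubgroup.closure_mono (Set.image_mono fun _ hτ => IsCarried.coneable 𝒯 hτ hσ _)

theorem lift_approxHtpy_boundary_mem {n : ℕ} {σ : C(Simplex (n + 1), X)}
    (h : ∀ i, 𝒯.approxHtpy r n (σ.comp (faceMap i)) ∈
      chainsIn (𝒯.IsCarried (σ.comp (faceMap i)) (k := n + 1))) :
    lift (𝒯.approxHtpy r n) (boundary n (of σ)) ∈ chainsIn (𝒯.IsCarried σ (k := n + 1)) := by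
  rw [boundary_of, map_sum]
  refine sum_mem fun i _ => ?_
  rw [map_zsmul, lift_apply_of]
  exact zsmul_mem (AddSubgroup.closure_mono (Set.image_mono fun τ hτ =>
    IsCarried.of_comp 𝒯 hτ) (h i)) _

theorem approxHtpy_mem_chainsIn : ∀ {n : ℕ} {σ : C(Simplex n, X)}, 𝒯.IsSmall σ →
    𝒯.approxHtpy r n σ ∈ chainsIn (𝒯.IsCarried σ (k := n + 1))
  | 0, σ, hσ => 𝒯.cone_mem_chainsIn hσ (𝒯.of_sub_approx_mem σ)
  | _ + 1, σ, hσ => 𝒯.cone_mem_chainsIn hσ (sub_mem (𝒯.of_sub_approx_mem σ)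
      (𝒯.lift_approxHtpy_boundary_mem fun i => approxHtpy_mem_chainsIn (hσ.comp 𝒯 (faceMap i))))

theorem boundary_approxHtpy_zero (σ : C(Simplex 0, X)) :
    boundary 0 (𝒯.approxHtpy r 0 σ) = of σ - 𝒯.approx r σ := by
  have hσ := 𝒯.isSmall_of_zero σ
  rw [approxHtpy, boundary_cone_zero 𝒯.coord_injective
    (𝒯.chainsIn_isCarried_le_coneable hσ (𝒯.of_sub_approx_mem σ)), map_sub, augmentation_of,
    augmentation_approx, sub_self, zero_smul, sub_zero]

/-- An acyclic carrier argument: what remains of `σ` after removing its approximation and the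
homotopy on its boundary is a cycle carried by `σ`. It is therefore the boundary of its cone from a
dominant vertex of `σ`. -/
theorem boundary_approxHtpy (hr : Function.Injective r) : ∀ {n : ℕ} {σ : C(Simplex (n + 1), X)},
    𝒯.IsSmall σ → boundary (n + 1) (𝒯.approxHtpy r (n + 1) σ) =
      of σ - 𝒯.approx r σ - lift (𝒯.approxHtpy r n) (boundary n (of σ)) := by
  -- The assumption `h` says that the chain being coned is a cycle; it comes from the homotopy
  -- formula in the preceding dimension.
  have key {n : ℕ} {σ : C(Simplex (n + 1), X)} (hσ : 𝒯.IsSmall σ)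
      (h : boundary n (lift (𝒯.approxHtpy r n) (boundary n (of σ))) =
        boundary n (of σ) - lift (𝒯.approx r) (boundary n (of σ))) :
      boundary (n + 1) (𝒯.approxHtpy r (n + 1) σ) =
        of σ - 𝒯.approx r σ - lift (𝒯.approxHtpy r n) (boundary n (of σ)) := by
    rw [approxHtpy_succ, boundary_cone 𝒯.coord_injective
      (𝒯.chainsIn_isCarried_le_coneable hσ (sub_mem (𝒯.of_sub_approx_mem σ)
        (𝒯.lift_approxHtpy_boundary_mem fun i =>
          𝒯.approxHtpy_mem_chainsIn (hσ.comp 𝒯 (faceMap i))))), sub_eq_self,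
      map_sub (boundary n), map_sub (boundary n), h, boundary_approx _ hr hσ, sub_self, map_zero]
  intro n
  induction n with
  | zero =>
    intro σ hσ
    refine key hσ ?_
    suffices e : (boundary 0).comp (lift (𝒯.approxHtpy r 0)) =
      .id _ - lift (𝒯.approx r) from DFunLike.congr_fun e _
    exact lift_ext _ _ fun σ => by simp [boundary_approxHtpy_zero]
  | succ n ih =>
    intro σ hσ
    refine key hσ ?_
    have h1 : boundary (n + 1) (of σ) ∈ chainsIn 𝒯.IsSmall :=
      boundary_mem_chainsIn (fun τ hτ i => hτ.comp 𝒯 _) (of_mem_chainsIn hσ)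
    have h2 := eq_of_mem_chainsIn (f := (boundary (n + 1)).comp (lift (𝒯.approxHtpy r (n + 1))))
      (g := .id _ - lift (𝒯.approx r) - (lift (𝒯.approxHtpy r n)).comp (boundary n))
      (fun τ hτ => by simp [ih hτ]) h1
    simpa [boundary_boundary] using h2

end Homotopy

end Triangulation

/-! ### Cocycles that vanish on small simplices -/

section Telescope

variable {Y : Type*} [TopologicalSpace Y]

/-- The `m`-fold barycentric subdivision as a homomorphism. -/
def subdivIter (n : ℕ) (Y : Type*) [TopologicalSpace Y] : ℕ → Chain Y n →+ Chain Y n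
  | 0 => .id _
  | m + 1 => (subdiv n Y).comp (subdivIter n Y m)

theorem subdivIter_apply {n : ℕ} (m : ℕ) (z : Chain Y n) :
    subdivIter n Y m z = (subdiv n Y)^[m] z := by
  induction m with
  | zero => rfl
  | succ m ih => rw [Function.iterate_succ_apply', ← ih]; rfl

/-- The chain homotopy between the identity and the `m`-fold barycentric subdivision. -/
def iterHtpy (n m : ℕ) (Y : Type*) [TopologicalSpace Y] : Chain Y n →+ Chain Y (n + 1) :=
  ∑ i ∈ Finset.range m, (subdivHtpy n Y).comp (subdivIter n Y i)

theorem iterHtpy_zero {n : ℕ} (z : Chain Y n) : iterHtpy n 0 Y z = 0 := by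
  simp [iterHtpy]

theorem iterHtpy_succ {n : ℕ} (m : ℕ) (z : Chain Y n) :
    iterHtpy n (m + 1) Y z = iterHtpy n m Y z + subdivHtpy n Y ((subdiv n Y)^[m] z) := by
  simp [iterHtpy, Finset.sum_range_succ, subdivIter_apply]

theorem boundary_iterate_subdiv {n : ℕ} (m : ℕ) (z : Chain Y (n + 1)) :
    boundary n ((subdiv (n + 1) Y)^[m] z) = (subdiv n Y)^[m] (boundary n z) := by
  induction m with
  | zero => rfl
  | succ m ih =>
    rw [Function.iterate_succ_apply', Function.iterate_succ_apply', boundary_subdiv, ih]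

theorem iterHtpy_boundary {n : ℕ} (m : ℕ) (z : Chain Y (n + 1)) :
    iterHtpy n m Y (boundary n z) =
      z - (subdiv (n + 1) Y)^[m] z - boundary (n + 1) (iterHtpy (n + 1) m Y z) := by
  induction m with
  | zero => simp [iterHtpy_zero]
  | succ m ih =>
    rw [iterHtpy_succ, iterHtpy_succ, ih, map_add, boundary_subdivHtpy, boundary_iterate_subdiv,
      Function.iterate_succ_apply']
    abel

end Telescope

namespace Triangulation

variable {X : Type u} [TopologicalSpace X] (𝒯 : Triangulation X)

theorem push_mem_chainsIn_isSmall {n k : ℕ} {σ : C(Simplex n, X)} (hσ : 𝒯.IsSmall σ)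
    (m : Chain (Simplex n) k) : push σ k m ∈ chainsIn (𝒯.IsSmall (k := k)) := by
  induction m using FreeAbelianGroup.induction_on with
  | zero => rw [map_zero]; exact zero_mem _
  | of u => rw [push_of]; exact of_mem_chainsIn (hσ.comp 𝒯 u)
  | neg u h => rw [map_neg]; exact neg_mem h
  | add x y hx hy => rw [map_add]; exact add_mem hx hy

theorem natOp_mem_chainsIn_isSmall {n k : ℕ} (m : Chain (Simplex n) k) {z : Chain X n}
    (hz : z ∈ chainsIn (𝒯.IsSmall (k := n))) : natOp m X z ∈ chainsIn (𝒯.IsSmall (k := k)) :=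
  map_mem_of_mem_chainsIn (fun σ hσ => by
    rw [natOp_of]; exact 𝒯.push_mem_chainsIn_isSmall hσ m) hz

theorem iterate_subdiv_mem_chainsIn_isSmall {n : ℕ} (m : ℕ) {z : Chain X n}
    (hz : z ∈ chainsIn (𝒯.IsSmall (k := n))) :
    (subdiv n X)^[m] z ∈ chainsIn (𝒯.IsSmall (k := n)) := by
  induction m with
  | zero => exact hz
  | succ m ih =>
    rw [Function.iterate_succ_apply']
    exact 𝒯.natOp_mem_chainsIn_isSmall _ ih

theorem exists_iterate_subdiv_isSmall {n : ℕ} (σ : C(Simplex n, X)) : ∃ M, ∀ m ≥ M,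
    (subdiv n X)^[m] (of σ) ∈ chainsIn (𝒯.IsSmall (k := n)) := by
  obtain ⟨ε, hε, h⟩ := 𝒯.exists_isSmall_comp σ
  obtain ⟨M, hM⟩ := exists_iterate_subdiv_mem n hε
  refine ⟨M, fun m hm => ?_⟩
  rw [iterate_subdiv_of]
  exact map_mem_of_mem_chainsIn (fun u hu => by
    rw [push_of]; exact of_mem_chainsIn (h n u hu)) (hM m hm)

variable {Γ : Type v} [AddCommGroup Γ]

theorem lift_eq_zero_of_isSmall {n : ℕ} {θ : C(Simplex n, X) → Γ}
    (hθ : ∀ σ, 𝒯.IsSmall σ → θ σ = 0) {z : Chain X n} (hz : z ∈ chainsIn (𝒯.IsSmall (k := n))) :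
    lift θ z = 0 :=
  eq_of_mem_chainsIn (g := 0) (fun σ hσ => by simpa using hθ σ hσ) hz

/-- The primitive of a cocycle that vanishes on small simplices. -/
def primitive {n : ℕ} (θ : C(Simplex (n + 1), X) → Γ) (σ : C(Simplex n, X)) : Γ :=
  lift θ (iterHtpy n (𝒯.exists_iterate_subdiv_isSmall σ).choose X (of σ))

/-- Once the subdivision is small, each further term evaluates `θ` on small simplices only and
vanishes. The value does not depend on which sufficiently large number of subdivisions is chosen. -/
theorem lift_iterHtpy_eq {n : ℕ} {θ : C(Simplex (n + 1), X) → Γ}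
    (hθ : ∀ σ, 𝒯.IsSmall σ → θ σ = 0) {σ : C(Simplex n, X)} {M m : ℕ}
    (hM : ∀ m ≥ M, (subdiv n X)^[m] (of σ) ∈ chainsIn (𝒯.IsSmall (k := n))) (hm : M ≤ m) :
    lift θ (iterHtpy n m X (of σ)) = lift θ (iterHtpy n M X (of σ)) := by
  induction m, hm using Nat.le_induction with
  | base => rfl
  | succ m hm ih =>
    have h : subdivHtpy n X ((subdiv n X)^[m] (of σ)) ∈ chainsIn 𝒯.IsSmall :=
      𝒯.natOp_mem_chainsIn_isSmall _ (hM m hm)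
    rw [iterHtpy_succ, map_add, ih, 𝒯.lift_eq_zero_of_isSmall hθ h, add_zero]

theorem eventually_lift_iterHtpy_eq {n : ℕ} {θ : C(Simplex (n + 1), X) → Γ}
    (hθ : ∀ σ, 𝒯.IsSmall σ → θ σ = 0) (σ : C(Simplex n, X)) :
    ∀ᶠ m in Filter.atTop, lift θ (iterHtpy n m X (of σ)) = 𝒯.primitive θ σ := by
  filter_upwards [Filter.eventually_ge_atTop (𝒯.exists_iterate_subdiv_isSmall σ).choose] with m hm
  exact 𝒯.lift_iterHtpy_eq hθ (𝒯.exists_iterate_subdiv_isSmall σ).choose_spec hm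

theorem primitive_eq_zero {n : ℕ} {θ : C(Simplex (n + 1), X) → Γ}
    (hθ : ∀ σ, 𝒯.IsSmall σ → θ σ = 0) {σ : C(Simplex n, X)} (hσ : 𝒯.IsSmall σ) :
    𝒯.primitive θ σ = 0 := by
  rw [primitive, 𝒯.lift_iterHtpy_eq hθ (M := 0) (fun m _ =>
    𝒯.iterate_subdiv_mem_chainsIn_isSmall m (of_mem_chainsIn hσ)) (Nat.zero_le _), iterHtpy_zero,
    map_zero]

theorem singularCoboundary_primitive {n : ℕ} {θ : C(Simplex (n + 1), X) → Γ}
    (hθ : ∀ σ, 𝒯.IsSmall σ → θ σ = 0) (hc : singularCoboundary X Γ (n + 1) θ = 0) :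
    singularCoboundary X Γ n (𝒯.primitive θ) = θ := by
  ext σ
  have h1 : ∀ᶠ m in Filter.atTop, ∀ i : Fin (n + 2),
      lift θ (iterHtpy n m X (of (σ.comp (faceMap i)))) =
        𝒯.primitive θ (σ.comp (faceMap i)) :=
    Filter.eventually_all.2 fun i => 𝒯.eventually_lift_iterHtpy_eq hθ _
  obtain ⟨M, hM⟩ := 𝒯.exists_iterate_subdiv_isSmall σ
  -- The numbers chosen for `σ` and its faces may differ; one large `m` serves for all of them, and
  -- then the homotopy formula applies.
  obtain ⟨m, hm, hmM⟩ := (h1.and (Filter.eventually_ge_atTop M)).exists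
  have h2 : singularCoboundary X Γ n (𝒯.primitive θ) σ =
      lift θ (iterHtpy n m X (boundary n (of σ))) := by
    rw [singularCoboundary_apply, boundary_of]
    simp only [map_sum, map_zsmul, lift_apply_of, hm]
  rw [h2, iterHtpy_boundary, map_sub, map_sub, ← lift_singularCoboundary, hc,
    𝒯.lift_eq_zero_of_isSmall hθ (hM m hmM), lift_apply_of, sub_zero, sub_eq_self]
  exact DFunLike.congr_fun (lift_ext (lift 0) (0 : Chain X (n + 2) →+ Γ) fun _ => by simp) _

end Triangulation

/-! ### Standard Borel spaces -/

theorem _root_.MeasurableEmbedding.standardBorelSpace {Y Z : Type*} [MeasurableSpace Y]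
    [MeasurableSpace Z] [StandardBorelSpace Z] {f : Y → Z} (hf : MeasurableEmbedding f) :
    StandardBorelSpace Y := by
  have hr : StandardBorelSpace (Set.range f) := hf.measurableSet_range.standardBorel
  let e : Y ≃ᵐ Set.range f := hf.equivRange
  let := upgradeStandardBorel (Set.range f)
  let : TopologicalSpace Y := TopologicalSpace.induced e inferInstance
  let h : Y ≃ₜ Set.range f := e.toEquiv.toHomeomorphOfIsInducing ⟨rfl⟩
  have h1 : PolishSpace Y := h.isClosedEmbedding.polishSpace
  have h2 : BorelSpace Y := ⟨by
    rw [borel_comap, ← BorelSpace.measurable_eq (α := Set.range f)]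
    exact e.measurableEmbedding.comap_eq.symm⟩
  exact standardBorel_of_polish

/-- The cover is made disjoint by taking the first index, and the pieces are embedded side by side
in `ℝ × ℕ`. -/
theorem standardBorelSpace_of_cover {Y : Type*} [MeasurableSpace Y] {S : ℕ → Set Y}
    (hS : ∀ i, MeasurableSet (S i)) (hSB : ∀ i, StandardBorelSpace (S i))
    (hcover : ⋃ i, S i = Set.univ) : StandardBorelSpace Y := by
  classical
  have hex (y : Y) : ∃ i, y ∈ S i := by
    have : y ∈ ⋃ i, S i := hcover ▸ Set.mem_univ y
    simpa using this
  have hemb (i) := MeasureTheory.measurableEmbedding_embeddingReal (S i)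
  let idx (y : Y) : ℕ := Nat.find (hex y)
  have hidx (y) : y ∈ S (idx y) := Nat.find_spec (hex y)
  have hidxm (i : ℕ) : MeasurableSet (idx ⁻¹' {i}) := by
    have : idx ⁻¹' {i} = S i ∩ ⋂ j : Fin i, (S j)ᶜ := by
      ext y
      simp only [Set.mem_preimage, Set.mem_singleton_iff, idx, Nat.find_eq_iff, Set.mem_inter_iff,
        Set.mem_iInter, Set.mem_compl_iff]
      exact and_congr_right fun _ => ⟨fun h j => h j j.2, fun h j hj => h ⟨j, hj⟩⟩
    rw [this]
    exact (hS i).inter (MeasurableSet.iInter fun j => (hS j).compl)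
  let f (y : Y) : ℝ × ℕ := (MeasureTheory.embeddingReal (S (idx y)) ⟨y, hidx y⟩, idx y)
  have hf (i : ℕ) (y : Y) (hy : idx y = i) (hyS : y ∈ S i) :
      f y = (MeasureTheory.embeddingReal (S i) ⟨y, hyS⟩, i) := by
    subst hy
    rfl
  have himg (s : Set Y) : f '' s = ⋃ i, (fun a => (a, i)) '' (MeasureTheory.embeddingReal (S i) ''
      (Subtype.val ⁻¹' (s ∩ idx ⁻¹' {i}))) := by
    ext q
    simp only [Set.mem_image, Set.mem_iUnion, Set.mem_preimage, Set.mem_inter_iff,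
      Set.mem_singleton_iff]
    constructor
    · rintro ⟨y, hy, rfl⟩
      exact ⟨idx y, _, ⟨⟨y, hidx y⟩, ⟨hy, rfl⟩, rfl⟩, rfl⟩
    · rintro ⟨i, _, ⟨⟨y, hyS⟩, ⟨hy, hi⟩, rfl⟩, rfl⟩
      exact ⟨y, hy, hf i y hi hyS⟩
  have hpre (s : Set (ℝ × ℕ)) : f ⁻¹' s = ⋃ i, (Subtype.val '' ((fun y : S i =>
      (MeasureTheory.embeddingReal (S i) y, i)) ⁻¹' s)) ∩ idx ⁻¹' {i} := by
    ext y
    simp only [Set.mem_preimage, Set.mem_iUnion, Set.mem_inter_iff, Set.mem_image,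
      Set.mem_singleton_iff, Subtype.exists, exists_and_right, exists_eq_right]
    constructor
    · intro h
      exact ⟨idx y, ⟨hidx y, h⟩, rfl⟩
    · rintro ⟨i, ⟨hyS, h⟩, hi⟩
      rwa [hf i y hi hyS]
  refine MeasurableEmbedding.standardBorelSpace (f := f) ⟨?_, ?_, ?_⟩
  · intro y y' h
    have hi : idx y' = idx y := (congrArg Prod.snd h).symm
    rw [hf (idx y) y' hi (hi ▸ hidx y')] at h
    exact congrArg Subtype.val ((hemb _).injective (congrArg Prod.fst h))
  · intro s hs
    rw [hpre]
    refine MeasurableSet.iUnion fun i => MeasurableSet.inter ?_ (hidxm i)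
    exact (hS i).subtype_image (((hemb i).measurable.prodMk measurable_const) hs)
  · intro s hs
    rw [himg]
    refine MeasurableSet.iUnion fun i => ?_
    have h1 : MeasurableEmbedding fun a : ℝ => (a, i) :=
      (measurable_id.prodMk measurable_const).measurableEmbedding fun a b h =>
        congrArg Prod.fst h
    exact h1.measurableSet_image' ((hemb i).measurableSet_image'
      (measurable_subtype_coe (hs.inter (hidxm i))))

/-- A chart domain is measurably isomorphic to `P × T`, whose factors are standard Borel; countably
many such domains cover `X`. -/
theorem IsMeasurableLamination.standardBorelSpace {X : Type u} [TopologicalSpace X]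
    [MeasurableSpace X] (hX : IsMeasurableLamination X) : StandardBorelSpace X := by
  obtain ⟨𝒰, hc, hU⟩ := hX
  have hSB (c : MeasurableChart X) : StandardBorelSpace c.source := by
    let := c.topP
    let := c.polishP
    let := c.measP
    let := c.borelP
    let := c.measT
    let := c.standardT
    let := c.topT
    let e : c.source ≃ᵐ c.P × c.T :=
      ⟨c.toHomeomorph.toEquiv, c.measurable_toFun, c.measurable_invFun⟩
    exact e.measurableEmbedding.standardBorelSpace
  rcases 𝒰.eq_empty_or_nonempty with rfl | hne
  · have : IsEmpty X := by
      rw [← Set.univ_eq_empty_iff, ← hU, Set.biUnion_empty]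
    refine standardBorelSpace_of_cover (S := fun _ => Set.univ) (fun _ => MeasurableSet.univ)
      (fun _ => ?_) (Set.iUnion_const _)
    have : DiscreteMeasurableSpace (Set.univ : Set X) :=
      ⟨fun s => by rw [Set.eq_empty_of_isEmpty s]; exact MeasurableSet.empty⟩
    infer_instance
  · obtain ⟨f, rfl⟩ := hc.exists_eq_range hne
    refine standardBorelSpace_of_cover (fun i => (f i).measurableSet_source) (fun i => hSB (f i)) ?_
    rw [← hU, Set.biUnion_range]

/-- A map on a standard Borel space that is measurable along countably many measurable injections
of standard Borel spaces, and equal to a measurable map off their images, is measurable. -/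
theorem measurable_of_injections {ι : Type*} [Countable ι] {Z : ι → Type*}
    [∀ i, MeasurableSpace (Z i)] [∀ i, StandardBorelSpace (Z i)] {Y G : Type*} [MeasurableSpace Y]
    [StandardBorelSpace Y] [MeasurableSpace G] {e : ∀ i, Z i → Y} (he : ∀ i, Measurable (e i))
    (hinj : ∀ i, Function.Injective (e i)) {f g : Y → G} (hf : ∀ i, Measurable (f ∘ e i))
    (hg : Measurable g) (hfg : ∀ y, (∀ i z, e i z ≠ y) → f y = g y) : Measurable f := by
  -- This is the Lusin–Souslin theorem: measurable injections of standard Borel spaces carry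
  -- measurable sets to measurable sets.
  have hemb (i) : MeasurableEmbedding (e i) := (he i).measurableEmbedding (hinj i)
  intro s hs
  have : f ⁻¹' s = (⋃ i, e i '' ((f ∘ e i) ⁻¹' s)) ∪ (g ⁻¹' s ∩ (⋃ i, Set.range (e i))ᶜ) := by
    ext y
    by_cases hy : ∃ i z, e i z = y
    · obtain ⟨i, z, rfl⟩ := hy
      constructor
      · intro h
        left
        exact Set.mem_iUnion.2 ⟨i, z, h, rfl⟩
      · rintro (h | h)
        · obtain ⟨j, z', h1, h2⟩ := Set.mem_iUnion.1 h
          rw [← h2]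
          exact h1
        · exact (h.2 (Set.mem_iUnion.2 ⟨i, z, rfl⟩)).elim
    · push Not at hy
      have hy' := hfg y hy
      have hn : y ∉ ⋃ i, Set.range (e i) := fun h => by
        obtain ⟨i, z, hz⟩ := Set.mem_iUnion.1 h
        exact hy i z hz
      constructor
      · intro h
        exact Set.mem_union_right _ ⟨by rwa [Set.mem_preimage, ← hy'], hn⟩
      · rintro (h | h)
        · obtain ⟨i, z, -, hz⟩ := Set.mem_iUnion.1 h
          exact absurd hz (hy i z)
        · rw [Set.mem_preimage, hy']
          exact h.1
  rw [this]
  refine (MeasurableSet.iUnion fun i => (hemb i).measurableSet_image' (hf i hs)).union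
    ((hg hs).inter (MeasurableSet.iUnion fun i => (hemb i).measurableSet_range).compl)

instance (n : ℕ) : StandardBorelSpace (Simplex n) :=
  (isClosed_stdSimplex ℝ (Fin (n + 1))).measurableSet.standardBorel

instance : StandardBorelSpace unitInterval :=
  isClosed_Icc.measurableSet.standardBorel

theorem measurable_simplex_apply {n : ℕ} (j : Fin (n + 1)) : Measurable fun y : Simplex n => y j :=
  (measurable_pi_apply j).comp measurable_subtype_coe

theorem measurable_domIdx (n : ℕ) : Measurable (domIdx : Simplex n → Fin (n + 1)) := by
  refine measurable_to_countable' fun j => ?_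
  have h (i : Fin (n + 1)) : MeasurableSet {y : Simplex n | ∀ k, y k ≤ y i} := by
    simp only [Set.ofPred_forall]
    exact MeasurableSet.iInter fun k =>
      measurableSet_le (measurable_simplex_apply k) (measurable_simplex_apply i)
  have : domIdx ⁻¹' {j} = {y : Simplex n | ∀ k, y k ≤ y j} ∩
      ⋂ i : Fin (n + 1), ⋂ _ : i < j, {y : Simplex n | ∀ k, y k ≤ y i}ᶜ := by
    ext y
    simp only [Set.mem_preimage, Set.mem_singleton_iff, domIdx_eq_iff, Set.mem_inter_iff,
      Set.mem_ofPred_eq, Set.mem_iInter, Set.mem_compl_iff]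
  rw [this]
  exact (h j).inter (MeasurableSet.iInter fun i => MeasurableSet.iInter fun _ => (h i).compl)

theorem measurable_joinCoord (n : ℕ) : Measurable (joinCoord : Simplex (n + 1) → unitInterval) :=
  (measurable_simplex_apply 0).subtype_mk

theorem measurable_joinProj (n : ℕ) : Measurable (joinProj : Simplex (n + 1) → Simplex n) := by
  classical
  have hS : MeasurableSet (stdSimplex ℝ (Fin (n + 1))) := (isClosed_stdSimplex ℝ _).measurableSet
  rw [← (MeasurableEmbedding.subtype_coe hS).measurable_comp_iff]
  refine measurable_pi_lambda _ fun j => ?_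
  have h : (fun p : Simplex (n + 1) => (joinProj p).1 j) = fun p =>
      if p 0 = 1 then (stdSimplex.vertex (S := ℝ) (0 : Fin (n + 1))).1 j
      else p j.succ / (1 - p 0) := by
    ext p
    rw [joinProj]
    split_ifs <;> rfl
  change Measurable fun p : Simplex (n + 1) => (joinProj p).1 j
  rw [h]
  exact Measurable.ite (measurableSet_eq_fun (measurable_simplex_apply 0) measurable_const)
    measurable_const ((measurable_simplex_apply _).div
      (measurable_const.sub (measurable_simplex_apply 0)))

/-! ### Measurable families of singular chains -/

section Families

variable {X : Type u} [TopologicalSpace X] [MeasurableSpace X]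

theorem IsMeasurableSimplex.comp {n k : ℕ} {T : Type u} [MeasurableSpace T]
    {σ : T → C(Simplex n, X)} (h : IsMeasurableSimplex σ) (u : C(Simplex k, Simplex n)) :
    IsMeasurableSimplex fun t => (σ t).comp u :=
  Measurable.comp h ((u.continuous.measurable.comp measurable_fst).prodMk measurable_snd)

theorem IsMeasurableSimplex.measurable_apply {n : ℕ} {T : Type u} [MeasurableSpace T]
    {σ : T → C(Simplex n, X)} (h : IsMeasurableSimplex σ) (p : Simplex n) :
    Measurable fun t => σ t p :=
  Measurable.comp h (measurable_const.prodMk measurable_id)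

variable (X) in
/-- The measurable families of singular `n`-chains parametrized by `T`. -/
def measurableChains (T : Type u) [MeasurableSpace T] (n : ℕ) : AddSubgroup (T → Chain X n) :=
  AddSubgroup.closure {z | ∃ (f : T → ℤ) (τ : T → C(Simplex n, X)), Measurable f ∧
    IsMeasurableSimplex τ ∧ z = fun t => f t • of (τ t)}

variable {T : Type u} [MeasurableSpace T]

theorem smul_of_mem_measurableChains {n : ℕ} {f : T → ℤ} {τ : T → C(Simplex n, X)}
    (hf : Measurable f) (hτ : IsMeasurableSimplex τ) :
    (fun t => f t • of (τ t)) ∈ measurableChains X T n :=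
  AddSubgroup.subset_closure ⟨f, τ, hf, hτ, rfl⟩

theorem of_mem_measurableChains {n : ℕ} {τ : T → C(Simplex n, X)} (hτ : IsMeasurableSimplex τ) :
    (fun t => of (τ t)) ∈ measurableChains X T n := by
  simpa using smul_of_mem_measurableChains (f := fun _ => 1) measurable_const hτ

/-- The homomorphism may vary with the parameter, as is needed for cones with a moving apex. -/
theorem map_mem_of_mem_measurableChains {G : Type*} [AddCommGroup G] {n : ℕ}
    {L : T → Chain X n →+ G} {H : AddSubgroup (T → G)}
    (h : ∀ (f : T → ℤ) (τ : T → C(Simplex n, X)), Measurable f → IsMeasurableSimplex τ →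
      (fun t => f t • L t (of (τ t))) ∈ H)
    {z : T → Chain X n} (hz : z ∈ measurableChains X T n) : (fun t => L t (z t)) ∈ H := by
  let L' : (T → Chain X n) →+ (T → G) :=
    { toFun := fun z t => L t (z t)
      map_zero' := by ext; simp
      map_add' := by intros; ext; simp }
  have : measurableChains X T n ≤ H.comap L' := by
    rw [measurableChains, AddSubgroup.closure_le]
    rintro _ ⟨f, τ, hf, hτ, rfl⟩
    have := h f τ hf hτ
    simpa [L'] using this
  exact this hz

theorem natOp_mem_measurableChains {n k : ℕ} (m : Chain (Simplex n) k) {z : T → Chain X n}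
    (hz : z ∈ measurableChains X T n) : (fun t => natOp m X (z t)) ∈ measurableChains X T k := by
  refine map_mem_of_mem_measurableChains (L := fun _ => natOp m X) (fun f τ hf hτ => ?_) hz
  simp only [natOp_of]
  induction m using FreeAbelianGroup.induction_on with
  | zero => simp only [map_zero, smul_zero]; exact zero_mem _
  | of u => simpa using smul_of_mem_measurableChains hf (hτ.comp u)
  | neg u h => simp only [map_neg, smul_neg]; exact neg_mem h
  | add x y hx hy => simp only [map_add, smul_add]; exact add_mem hx hy

theorem iterHtpy_mem_measurableChains {n : ℕ} (m : ℕ) {z : T → Chain X n}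
    (hz : z ∈ measurableChains X T n) :
    (fun t => iterHtpy n m X (z t)) ∈ measurableChains X T (n + 1) := by
  have h1 (m : ℕ) : (fun t => (subdiv n X)^[m] (z t)) ∈ measurableChains X T n := by
    induction m with
    | zero => exact hz
    | succ m ih =>
      simp only [Function.iterate_succ_apply']
      exact natOp_mem_measurableChains _ ih
  induction m with
  | zero => simp only [iterHtpy_zero]; exact zero_mem _
  | succ m ih =>
    simp only [iterHtpy_succ]
    exact add_mem ih (natOp_mem_measurableChains _ (h1 m))

variable {Γ : Type v} [AddCommGroup Γ] [MeasurableSpace Γ] [MeasurableAdd₂ Γ] [MeasurableNeg Γ]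

theorem measurable_lift_of_mem [StandardBorelSpace T] {n : ℕ} {ω : C(Simplex n, X) → Γ}
    (hω : ω ∈ singularCochains X Γ n)
    {z : T → Chain X n} (hz : z ∈ measurableChains X T n) : Measurable fun t => lift ω (z t) := by
  let H : AddSubgroup (T → Γ) :=
    { carrier := {f | Measurable f}
      zero_mem' := measurable_const
      add_mem' := fun ha hb => Measurable.add ha hb
      neg_mem' := fun ha => Measurable.neg ha }
  refine map_mem_of_mem_measurableChains (H := H) (L := fun _ => lift ω) (fun f τ hf hτ => ?_) hz
  simp only [lift_apply_of]
  exact hf.smul (hω T τ hτ)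

theorem singularCoboundary_mem {n : ℕ} {ω : C(Simplex n, X) → Γ}
    (hω : ω ∈ singularCochains X Γ n) :
    singularCoboundary X Γ n ω ∈ singularCochains X Γ (n + 1) := by
  intro T _ _ σ hσ
  simp only [singularCoboundary, AddMonoidHom.coe_mk, ZeroHom.coe_mk]
  exact Finset.measurable_sum _ fun i _ =>
    (hω T _ (hσ.comp (faceMap i))).const_smul ((-1 : ℤ) ^ (i : ℕ))

theorem singularCoboundary_mem_cocycles {n : ℕ} {ω : C(Simplex n, X) → Γ}
    (hω : ω ∈ singularCochains X Γ n) :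
    singularCoboundary X Γ n ω ∈ singularCocycles X Γ (n + 1) :=
  AddSubgroup.mem_inf.2
    ⟨singularCoboundary_mem hω, singularCoboundary_singularCoboundary ω⟩

end Families

/-! ### Measurability of the primitive -/

namespace Triangulation

variable {X : Type u} [TopologicalSpace X] [MeasurableSpace X] (𝒯 : Triangulation X)
variable {Γ : Type v} [AddCommGroup Γ] [MeasurableSpace Γ] [StandardBorelSpace Γ]
  [MeasurableAdd₂ Γ] [MeasurableNeg Γ]

/-- No measurable choice of the number of subdivisions is needed: for each fixed `m` the evaluation
is measurable, and as `m` grows the values are eventually constant at every parameter. The limit is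
taken in a Polish topology on `Γ`. -/
theorem primitive_mem {n : ℕ} {θ : C(Simplex (n + 1), X) → Γ}
    (hθ : ∀ σ, 𝒯.IsSmall σ → θ σ = 0) (hm : θ ∈ singularCochains X Γ (n + 1)) :
    𝒯.primitive θ ∈ singularCochains X Γ n := by
  intro T _ _ σ hσ
  let := upgradeStandardBorel Γ
  refine measurable_of_tendsto_metrizable (f := fun m t => lift θ (iterHtpy n m X (of (σ t))))
    (fun m => measurable_lift_of_mem hm
      (iterHtpy_mem_measurableChains m (of_mem_measurableChains hσ))) ?_
  rw [tendsto_pi_nhds]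
  exact fun t => tendsto_const_nhds.congr' ((𝒯.eventually_lift_iterHtpy_eq hθ _).mono
    fun m hm => hm.symm)

end Triangulation

/-! ### Measurability of vertices -/

namespace MeasurableTriangulation

variable {X : Type u} [TopologicalSpace X] [MeasurableSpace X] (𝒯 : MeasurableTriangulation X)

theorem measurable_vert {n : ℕ} (j : Fin (n + 1)) : Measurable fun b : 𝒯.B n => 𝒯.vert b j :=
  (𝒯.measurable_simplex n).comp (measurable_const.prodMk measurable_id)

theorem measurable_vert_comp {n : ℕ} (π : Equiv.Perm (Fin (n + 1))) :
    Measurable fun b : 𝒯.B n => 𝒯.vert b ∘ π :=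
  measurable_pi_lambda _ fun j => 𝒯.measurable_vert (π j)

/-! ### Pairs of a vertex and a point of a common simplex -/

open Classical in
/-- The point dividing the segment from a vertex `a` to a point `x`. -/
def joinPoint (q : unitInterval × X × X) : X :=
  if h : 𝒯.Joinable q.2.1 q.2.2 then (h.exists_point 𝒯.toTriangulation q.1).choose else q.2.1

theorem coord_joinPoint (s : unitInterval) {a x : X} (h : 𝒯.Joinable a x) :
    𝒯.coord (𝒯.joinPoint (s, a, x)) = (s : ℝ) • 𝒯.coord a + (1 - s : ℝ) • 𝒯.coord x := by
  rw [joinPoint, dif_pos h]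
  exact (h.exists_point 𝒯.toTriangulation s).choose_spec

/-- The points of a simplex whose coordinates, except perhaps the `j`-th, are positive. -/
def almostInterior (n : ℕ) (j : Fin (n + 1)) : Set (Simplex n) := {y | ∀ i ≠ j, 0 < y i}

theorem measurableSet_almostInterior (n : ℕ) (j : Fin (n + 1)) :
    MeasurableSet (almostInterior n j) := by
  simp only [almostInterior, Set.ofPred_forall]
  exact MeasurableSet.iInter fun i => MeasurableSet.iInter fun _ =>
    measurableSet_lt measurable_const (measurable_simplex_apply i)

instance (n : ℕ) (j : Fin (n + 1)) : StandardBorelSpace (almostInterior n j) :=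
  (measurableSet_almostInterior n j).standardBorel

/-- The pairs of a vertex and a point that span a given simplex. -/
def vertexPoint {n : ℕ} (j : Fin (n + 1)) (q : almostInterior n j × 𝒯.B n) : X × X :=
  (𝒯.vert q.2 j, 𝒯.simplex n q.2 q.1)

theorem measurable_vertexPoint {n : ℕ} (j : Fin (n + 1)) : Measurable (𝒯.vertexPoint j) :=
  ((𝒯.measurable_vert j).comp measurable_snd).prodMk ((𝒯.measurable_simplex n).comp
    ((measurable_subtype_coe.comp measurable_fst).prodMk measurable_snd))

theorem range_vert_of_almostInterior {n : ℕ} (j : Fin (n + 1)) (q : almostInterior n j × 𝒯.B n) :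
    Set.range (𝒯.vert q.2) =
      {v | v = (𝒯.vertexPoint j q).1 ∨ 𝒯.coord (𝒯.vertexPoint j q).2 v ≠ 0} := by
  ext v
  constructor
  · rintro ⟨i, rfl⟩
    by_cases h : i = j
    · exact Or.inl (by rw [h]; rfl)
    · exact Or.inr (by rw [vertexPoint, 𝒯.coord_vert]; exact (q.1.2 i h).ne')
  · rintro (rfl | h)
    · exact ⟨j, rfl⟩
    · exact 𝒯.mem_range_vert_of_coord h

/-- The pair recovers the vertices of the simplex, namely `a` together with the support of `x`.
Positivity away from the `j`-th coordinate is what makes this work. -/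
theorem vertexPoint_injective {n : ℕ} (j : Fin (n + 1)) :
    Function.Injective (𝒯.vertexPoint j) := by
  rintro ⟨y, b⟩ ⟨y', b'⟩ h
  have h1 := 𝒯.range_vert_of_almostInterior j (y, b)
  rw [h, ← 𝒯.range_vert_of_almostInterior j (y', b')] at h1
  obtain rfl : b = b' := 𝒯.eq_of_vertices_eq n b b' h1
  exact Prod.ext (Subtype.ext (𝒯.simplex_injective n b (congrArg Prod.snd h))) rfl

theorem joinable_iff_mem_range {a x : X} : 𝒯.Joinable a x ↔
    ∃ (n : ℕ) (j : Fin (n + 1)) (q : almostInterior n j × 𝒯.B n),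
      𝒯.vertexPoint j q = (a, x) := by
  constructor
  · rintro ⟨n, b, ⟨j, rfl⟩, z, rfl⟩
    -- The midpoint is interior to the face spanned by the vertex and the support of `z`, the
    -- smallest simplex containing the pair. In that face all coordinates of `z` are positive except
    -- perhaps the one at the chosen vertex.
    let w : Simplex n := segPoint ⟨1 / 2, by norm_num, by norm_num⟩ (stdSimplex.vertex j) z
    have hw' (i) : w i = 1 / 2 * (Pi.single j 1 : Fin (n + 1) → ℝ) i + (1 - 1 / 2) * z i := rfl
    have hwj : w j ≠ 0 := by
      have := stdSimplex.zero_le z j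
      rw [hw', Pi.single_eq_same]
      positivity
    have hw (i) (hi : i ≠ j) : w i = 1 / 2 * z i := by
      rw [hw', Pi.single_eq_of_ne hi]
      ring
    obtain ⟨k, f, y, hf, hy, hz⟩ := exists_interior_face w
    obtain ⟨q, π, hq⟩ := 𝒯.exists_subface n b k f hf
    have hv (i) : 𝒯.vert b (f i) = 𝒯.vert q (π i) := by
      simpa [Triangulation.vert] using hq (stdSimplex.vertex i)
    have hmem (i) (hi : w i ≠ 0) : i ∈ Set.range f := by
      by_contra h
      exact hi (by rw [← hz, simplexMap_apply_eq_zero _ h])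
    obtain ⟨l, rfl⟩ := hmem j hwj
    have hx : 𝒯.simplex n b z ∈ Set.range (𝒯.simplex k q) := by
      refine 𝒯.mem_range_simplex fun v hv' => ?_
      obtain ⟨i, rfl⟩ := 𝒯.mem_range_vert_of_coord hv'
      rw [𝒯.coord_vert] at hv'
      obtain ⟨i, rfl⟩ : i ∈ Set.range f := by
        by_cases h : i = f l
        · exact ⟨l, h.symm⟩
        · exact hmem i (by rw [hw i h]; simpa using hv')
      exact ⟨π i, (hv i).symm⟩
    obtain ⟨z', hz'⟩ := hx
    refine ⟨k, π l, (⟨z', fun i hi => ?_⟩, q), ?_⟩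
    · obtain ⟨i, rfl⟩ := π.surjective i
      have hne : f i ≠ f l := fun h => hi (by rw [hf h])
      have h1 : 0 < w (f i) := by
        rw [← hz, simplexMap_apply_apply hf]
        exact hy i
      rw [hw _ hne] at h1
      rw [← 𝒯.coord_vert q z', hz', ← hv, 𝒯.coord_vert]
      linarith
    · exact Prod.ext (hv l).symm hz'
  · rintro ⟨n, j, q, h⟩
    obtain ⟨rfl, rfl⟩ := Prod.mk.inj h
    exact ⟨n, q.2, ⟨j, rfl⟩, q.1, rfl⟩

/-! ### Measurability of sorted simplices -/

section Sorted

variable {r : X → ℝ}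

theorem measurableSet_sortPerm_eq (hr : Measurable r) (hinj : Function.Injective r) {n : ℕ}
    (π : Equiv.Perm (Fin (n + 1))) : MeasurableSet {b : 𝒯.B n | 𝒯.sortPerm r b = π} := by
  have h : {b : 𝒯.B n | 𝒯.sortPerm r b = π} = ⋂ (i : Fin (n + 1)) (j : Fin (n + 1)) (_ : i < j),
      {b : 𝒯.B n | r (𝒯.vert b (π i)) < r (𝒯.vert b (π j))} := by
    ext b
    simp only [Set.mem_ofPred_eq, 𝒯.sortPerm_eq_iff hinj, Set.mem_iInter]
    rfl
  rw [h]
  exact MeasurableSet.iInter fun i => MeasurableSet.iInter fun j => MeasurableSet.iInter fun _ =>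
    measurableSet_lt (hr.comp (𝒯.measurable_vert _)) (hr.comp (𝒯.measurable_vert _))

theorem measurable_comp_sortPerm {G Y : Type*} [MeasurableSpace G] [MeasurableSpace Y]
    (hr : Measurable r) (hinj : Function.Injective r) {n : ℕ}
    {F : Equiv.Perm (Fin (n + 1)) → Y × 𝒯.B n → G} (hF : ∀ π, Measurable (F π)) :
    Measurable fun q : Y × 𝒯.B n => F (𝒯.sortPerm r q.2) q := by
  intro s hs
  have : (fun q : Y × 𝒯.B n => F (𝒯.sortPerm r q.2) q) ⁻¹' s =
      ⋃ π, Prod.snd ⁻¹' {b : 𝒯.B n | 𝒯.sortPerm r b = π} ∩ F π ⁻¹' s := by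
    ext q
    simp
  rw [this]
  exact MeasurableSet.iUnion fun π =>
    (measurable_snd (𝒯.measurableSet_sortPerm_eq hr hinj π)).inter (hF π hs)

theorem isMeasurableSimplex_sorted (hr : Measurable r) (hinj : Function.Injective r) (n : ℕ) :
    IsMeasurableSimplex fun b : 𝒯.B n =>
      (𝒯.simplex n b).comp (simplexMap (𝒯.sortPerm r b)) :=
  𝒯.measurable_comp_sortPerm hr hinj (F := fun π q => 𝒯.simplex n q.2 (simplexMap π q.1))
    fun π => (𝒯.measurable_simplex n).comp (((simplexMap π).continuous.measurable.comp
      measurable_fst).prodMk measurable_snd)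

theorem measurable_apply_sortPerm {G : Type*} [MeasurableSpace G] (hr : Measurable r)
    (hinj : Function.Injective r) {n : ℕ} (F : Equiv.Perm (Fin (n + 1)) → G) :
    Measurable fun b : 𝒯.B n => F (𝒯.sortPerm r b) := by
  intro s _
  have : (fun b : 𝒯.B n => F (𝒯.sortPerm r b)) ⁻¹' s =
      ⋃ π ∈ {π | F π ∈ s}, {b : 𝒯.B n | 𝒯.sortPerm r b = π} := by
    ext b
    simp
  rw [this]
  exact MeasurableSet.biUnion (Set.to_countable _) fun π _ => 𝒯.measurableSet_sortPerm_eq hr hinj π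

theorem measurable_sign_sortPerm (hr : Measurable r) (hinj : Function.Injective r) (n : ℕ) :
    Measurable fun b : 𝒯.B n => (Equiv.Perm.sign (𝒯.sortPerm r b) : ℤ) :=
  𝒯.measurable_apply_sortPerm hr hinj fun π => (Equiv.Perm.sign π : ℤ)

theorem sortedChain_mem_measurableChains (hr : Measurable r) (hinj : Function.Injective r) (n : ℕ) :
    (𝒯.sortedChain r : 𝒯.B n → Chain X n) ∈ measurableChains X (𝒯.B n) n :=
  smul_of_mem_measurableChains (𝒯.measurable_sign_sortPerm hr hinj n)
    (𝒯.isMeasurableSimplex_sorted hr hinj n)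

end Sorted

/-! ### Measurability of cones and of simplicial approximations -/

variable [StandardBorelSpace X]

instance (n : ℕ) : StandardBorelSpace (𝒯.B n) := (𝒯.isTransversal n).1.standardBorel

/-- The open simplices of each dimension form an injective measurable family over `B n`, on which
the dominant vertex is read off from the largest coordinate. -/
theorem measurable_dom : Measurable 𝒯.dom := by
  have hpos (n : ℕ) : MeasurableSet {y : Simplex n | ∀ j, 0 < y j} := by
    simp only [Set.ofPred_forall]
    exact MeasurableSet.iInter fun j =>
      measurableSet_lt measurable_const (measurable_simplex_apply j)
  have hSB (n : ℕ) : StandardBorelSpace {y : Simplex n | ∀ j, 0 < y j} :=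
    (hpos n).standardBorel
  refine measurable_of_injections (Z := fun n : ℕ => {y : Simplex n | ∀ j, 0 < y j} × 𝒯.B n)
    (e := fun n q => 𝒯.simplex n q.2 q.1) (g := id) (fun n => ?_) (fun n => ?_) (fun n => ?_)
    measurable_id (fun x hx => ?_)
  · exact (𝒯.measurable_simplex n).comp
      ((measurable_subtype_coe.comp measurable_fst).prodMk measurable_snd)
  · rintro ⟨y, b⟩ ⟨y', b'⟩ h
    have := (𝒯.existsUnique_open_simplex (𝒯.simplex n b y)).unique
      (y₁ := ⟨n, b, y⟩) (y₂ := ⟨n, b', y'⟩) ⟨y.2, rfl⟩ ⟨y'.2, h.symm⟩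
    simp only [Sigma.mk.injEq, heq_eq_eq, true_and, Prod.mk.injEq] at this
    exact Prod.ext (Subtype.ext this.2) this.1
  · have h1 : 𝒯.dom ∘ (fun q : {y : Simplex n | ∀ j, 0 < y j} × 𝒯.B n =>
        𝒯.simplex n q.2 q.1) = (fun q : 𝒯.B n × Fin (n + 1) => 𝒯.vert q.1 q.2) ∘
          fun q => (q.2, domIdx q.1.1) := by
      ext q
      exact congrArg (fun s : Σ n : ℕ, 𝒯.B n × Simplex n => 𝒯.vert s.2.1 (domIdx s.2.2))
        (𝒯.carrier_eq q.1.2)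
    rw [h1]
    refine (measurable_from_prod_countable_left fun j => 𝒯.measurable_vert j).comp ?_
    exact measurable_snd.prodMk ((measurable_domIdx n).comp
      (measurable_subtype_coe.comp measurable_fst))
  · exact absurd (𝒯.simplex_carrier_pos x) (hx _ (⟨_, 𝒯.pos_pos x⟩, _))

theorem measurable_hat {G : Type*} [AddCommGroup G] [MeasurableSpace G] [MeasurableAdd₂ G]
    [MeasurableNeg G] {n : ℕ} {c : 𝒯.B n → G} (hc : Measurable c) : Measurable (𝒯.hat c) := by
  refine measurable_of_injections (ι := Equiv.Perm (Fin (n + 1))) (Z := fun _ => 𝒯.B n)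
    (e := fun π b => 𝒯.vert b ∘ π) (g := fun _ => 0) 𝒯.measurable_vert_comp
    (fun π b b' h => (𝒯.vert_comp_perm_inj h).1) (fun π => ?_) measurable_const (fun w hw => ?_)
  · have : 𝒯.hat c ∘ (fun b => 𝒯.vert b ∘ π) = fun b => (Equiv.Perm.sign π : ℤ) • c b :=
      funext fun b => 𝒯.hat_vert_comp c b π
    rw [this]
    exact hc.const_smul (Equiv.Perm.sign π : ℤ)
  · apply 𝒯.hat_eq_zero
    rintro ⟨b, π, rfl⟩
    exact hw π b rfl

theorem measurable_domTuple {T : Type u} [MeasurableSpace T] {n : ℕ} {σ : T → C(Simplex n, X)}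
    (hσ : IsMeasurableSimplex σ) : Measurable fun t => 𝒯.domTuple (σ t) :=
  measurable_pi_lambda _ fun _ => 𝒯.measurable_dom.comp (hσ.measurable_apply _)

theorem measurableSet_joinable : MeasurableSet {p : X × X | 𝒯.Joinable p.1 p.2} := by
  have : {p : X × X | 𝒯.Joinable p.1 p.2} =
      ⋃ (n : ℕ) (j : Fin (n + 1)), Set.range (𝒯.vertexPoint j) := by
    ext ⟨a, x⟩
    simp only [Set.mem_ofPred_eq, joinable_iff_mem_range, Set.mem_iUnion, Set.mem_range]
  rw [this]
  exact MeasurableSet.iUnion fun n => MeasurableSet.iUnion fun j =>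
    ((𝒯.measurable_vertexPoint j).measurableEmbedding
      (𝒯.vertexPoint_injective j)).measurableSet_range

theorem measurable_joinPoint : Measurable 𝒯.joinPoint := by
  refine measurable_of_injections (ι := Σ n : ℕ, Fin (n + 1))
    (Z := fun i => unitInterval × almostInterior i.1 i.2 × 𝒯.B i.1)
    (e := fun i q => (q.1, 𝒯.vertexPoint i.2 q.2)) (g := fun q => q.2.1) (fun i => ?_)
    (fun i q q' h => ?_) (fun i => ?_) (measurable_fst.comp measurable_snd) (fun q hq => ?_)
  · exact measurable_fst.prodMk ((𝒯.measurable_vertexPoint i.2).comp measurable_snd)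
  · obtain ⟨h1, h2⟩ := Prod.mk.inj h
    exact Prod.ext h1 (𝒯.vertexPoint_injective i.2 h2)
  -- On each family of pairs spanning a simplex, the point is given by the affine formula in that
  -- simplex; injectivity of the coordinates identifies the two.
  · have h1 : 𝒯.joinPoint ∘ (fun q : unitInterval × almostInterior i.1 i.2 × 𝒯.B i.1 =>
        (q.1, 𝒯.vertexPoint i.2 q.2)) = fun q =>
          𝒯.simplex i.1 q.2.2 (segPoint q.1 (stdSimplex.vertex i.2) q.2.1) := by
      ext q
      apply 𝒯.coord_injective
      rw [Function.comp_apply, vertexPoint,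
        𝒯.coord_joinPoint _ (𝒯.joinable_iff_mem_range.2 ⟨_, i.2, q.2, rfl⟩), 𝒯.coord_segPoint]
      rfl
    rw [h1]
    refine (𝒯.measurable_simplex i.1).comp (Measurable.prodMk ?_
      (measurable_snd.comp measurable_snd))
    exact continuous_segPoint.measurable.comp (measurable_fst.prodMk (measurable_const.prodMk
      (measurable_subtype_coe.comp (measurable_fst.comp measurable_snd))))
  · rw [joinPoint, dif_neg]
    intro h
    obtain ⟨n, j, q', hq'⟩ := 𝒯.joinable_iff_mem_range.1 h
    exact hq ⟨n, j⟩ (q.1, q') (Prod.ext rfl hq')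

theorem isMeasurableSimplex_coneMap {T : Type u} [MeasurableSpace T] {k : ℕ} {a : T → X}
    (ha : Measurable a) (hav : ∀ t, ∃ (n : ℕ) (b : 𝒯.B n) (j : Fin (n + 1)), a t = 𝒯.vert b j)
    {τ : T → C(Simplex k, X)} (hτ : IsMeasurableSimplex τ) :
    IsMeasurableSimplex fun t => coneMap 𝒯.coord (a t) (τ t) := by
  classical
  have hcone (t) : Coneable 𝒯.coord (a t) (τ t) ↔ ∀ p, 𝒯.Joinable (a t) (τ t p) := by
    obtain ⟨n, b, j, h⟩ := hav t
    rw [h]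
    exact 𝒯.coneable_iff_joinable
  have hA : MeasurableSet {t | Coneable 𝒯.coord (a t) (τ t)} := by
    -- Joinability with a fixed apex is a closed condition, so a dense sequence in the simplex
    -- detects it.
    have : {t | Coneable 𝒯.coord (a t) (τ t)} =
        ⋂ m, {t | 𝒯.Joinable (a t) (τ t (TopologicalSpace.denseSeq (Simplex k) m))} := by
      ext t
      rw [Set.mem_iInter]
      refine (hcone t).trans ⟨fun h m => h _, fun h p => ?_⟩
      exact ((𝒯.isClosed_joinable (a t)).preimage (τ t).continuous).closure_subset_iff.2
        (Set.range_subset_iff.2 h) (TopologicalSpace.denseRange_denseSeq (Simplex k) p)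
    rw [this]
    exact MeasurableSet.iInter fun m =>
      (ha.prodMk (hτ.measurable_apply _)) 𝒯.measurableSet_joinable
  have heq : (fun p : Simplex (k + 1) × T => coneMap 𝒯.coord (a p.2) (τ p.2) p.1) = fun p =>
      if Coneable 𝒯.coord (a p.2) (τ p.2) then
        𝒯.joinPoint (joinCoord p.1, a p.2, τ p.2 (joinProj p.1)) else a p.2 := by
    ext ⟨p, t⟩
    dsimp only
    split_ifs with h
    · apply 𝒯.coord_injective
      rw [𝒯.coord_joinPoint _ ((hcone t).1 h _), ← h.isCone, joinPt_joinProj]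
    · rw [coneMap_of_not_coneable h]
      rfl
  rw [IsMeasurableSimplex, heq]
  refine Measurable.ite (measurable_snd hA) (𝒯.measurable_joinPoint.comp ?_)
    (ha.comp measurable_snd)
  refine ((measurable_joinCoord k).comp measurable_fst).prodMk
    ((ha.comp measurable_snd).prodMk ?_)
  exact Measurable.comp hτ (((measurable_joinProj k).comp measurable_fst).prodMk measurable_snd)

theorem cone_mem_measurableChains {T : Type u} [MeasurableSpace T] {k : ℕ} {a : T → X}
    (ha : Measurable a) (hav : ∀ t, ∃ (n : ℕ) (b : 𝒯.B n) (j : Fin (n + 1)), a t = 𝒯.vert b j)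
    {z : T → Chain X k} (hz : z ∈ measurableChains X T k) :
    (fun t => cone 𝒯.coord (a t) k (z t)) ∈ measurableChains X T (k + 1) := by
  refine map_mem_of_mem_measurableChains (L := fun t => cone 𝒯.coord (a t) k)
    (fun f τ hf hτ => ?_) hz
  simp only [cone_of]
  exact smul_of_mem_measurableChains hf (𝒯.isMeasurableSimplex_coneMap ha hav hτ)

/-- A chain-valued alternating extension of a measurable family of singular simplices. -/
theorem hat_mem_measurableChains {T : Type u} [MeasurableSpace T] {n : ℕ} {f : 𝒯.B n → ℤ}
    (hf : Measurable f) {ρ : 𝒯.B n → C(Simplex n, X)} (hρ : IsMeasurableSimplex ρ)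
    {w : T → Fin (n + 1) → X} (hw : Measurable w) :
    (fun t => 𝒯.hat (fun b => f b • of (ρ b)) (w t)) ∈ measurableChains X T n := by
  classical
  -- The singular simplex is separated from its integer coefficient. Off the vertex tuples the
  -- coefficient is zero, and the constant simplex only serves to keep `ψ` measurable everywhere.
  let ψ (w : Fin (n + 1) → X) : C(Simplex n, X) :=
    if h : ∃ (b : 𝒯.B n) (π : Equiv.Perm (Fin (n + 1))), w = 𝒯.vert b ∘ π then ρ h.choose
    else .const _ (w 0)
  have hψ (b : 𝒯.B n) (π : Equiv.Perm (Fin (n + 1))) : ψ (𝒯.vert b ∘ π) = ρ b := by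
    have h : ∃ (b' : 𝒯.B n) (π' : Equiv.Perm (Fin (n + 1))), 𝒯.vert b ∘ π = 𝒯.vert b' ∘ π' :=
      ⟨b, π, rfl⟩
    simp only [ψ, dif_pos h]
    rw [← (𝒯.vert_comp_perm_inj h.choose_spec.choose_spec).1]
  have hm : IsMeasurableSimplex ψ := by
    refine measurable_of_injections (ι := Equiv.Perm (Fin (n + 1)))
      (Z := fun _ => Simplex n × 𝒯.B n) (e := fun π q => (q.1, 𝒯.vert q.2 ∘ π))
      (g := fun q => q.2 0) (fun π => ?_) (fun π q q' h => ?_) (fun π => ?_)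
      ((measurable_pi_apply 0).comp measurable_snd) (fun q hq => ?_)
    · exact measurable_fst.prodMk ((𝒯.measurable_vert_comp π).comp measurable_snd)
    · obtain ⟨h1, h2⟩ := Prod.mk.inj h
      exact Prod.ext h1 (𝒯.vert_comp_perm_inj h2).1
    · have : (fun q : Simplex n × (Fin (n + 1) → X) => ψ q.2 q.1) ∘
          (fun q : Simplex n × 𝒯.B n => (q.1, 𝒯.vert q.2 ∘ π)) = fun q => ρ q.2 q.1 := by
        ext q
        simp only [Function.comp_apply]
        rw [← hψ q.2 π]
      rw [this]
      exact hρ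
    · have h : ¬ ∃ (b : 𝒯.B n) (π : Equiv.Perm (Fin (n + 1))), q.2 = 𝒯.vert b ∘ π := by
        rintro ⟨b, π, h⟩
        exact hq π (q.1, b) (Prod.ext rfl h.symm)
      simp only [ψ, dif_neg h]
      rfl
  have heq : (fun t => 𝒯.hat (fun b => f b • of (ρ b)) (w t)) =
      fun t => 𝒯.hat f (w t) • of (ψ (w t)) := by
    ext1 t
    by_cases h : ∃ (b : 𝒯.B n) (π : Equiv.Perm (Fin (n + 1))), w t = 𝒯.vert b ∘ π
    · obtain ⟨b, π, h⟩ := h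
      rw [h, 𝒯.hat_vert_comp, 𝒯.hat_vert_comp, hψ, smul_smul, smul_eq_mul]
    · rw [𝒯.hat_eq_zero _ h, 𝒯.hat_eq_zero _ h, zero_smul]
  rw [heq]
  refine smul_of_mem_measurableChains ((𝒯.measurable_hat hf).comp hw) ?_
  exact Measurable.comp hm (measurable_fst.prodMk (hw.comp measurable_snd))

variable {r : X → ℝ}

theorem approx_mem_measurableChains (hr : Measurable r) (hinj : Function.Injective r)
    {T : Type u} [MeasurableSpace T] {n : ℕ} {σ : T → C(Simplex n, X)}
    (hσ : IsMeasurableSimplex σ) : (fun t => 𝒯.approx r (σ t)) ∈ measurableChains X T n :=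
  𝒯.hat_mem_measurableChains (𝒯.measurable_sign_sortPerm hr hinj n)
    (𝒯.isMeasurableSimplex_sorted hr hinj n) (𝒯.measurable_domTuple hσ)

theorem approxHtpy_mem_measurableChains (hr : Measurable r) (hinj : Function.Injective r)
    {T : Type u} [MeasurableSpace T] : ∀ {n : ℕ} {σ : T → C(Simplex n, X)},
    IsMeasurableSimplex σ → (fun t => 𝒯.approxHtpy r n (σ t)) ∈ measurableChains X T (n + 1) := by
  have hcone {k n : ℕ} {σ : T → C(Simplex n, X)} (hσ : IsMeasurableSimplex σ) {z : T → Chain X k}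
      (hz : z ∈ measurableChains X T k) : (fun t => cone 𝒯.coord (𝒯.domTuple (σ t) 0) k (z t)) ∈
        measurableChains X T (k + 1) :=
    𝒯.cone_mem_measurableChains (measurable_pi_iff.1 (𝒯.measurable_domTuple hσ) 0)
      (fun t => ⟨_, _, _, rfl⟩) hz
  intro n
  induction n with
  | zero =>
    intro σ hσ
    exact hcone hσ (sub_mem (of_mem_measurableChains hσ)
      (𝒯.approx_mem_measurableChains hr hinj hσ))
  | succ n ih =>
    intro σ hσ
    refine hcone hσ (sub_mem (sub_mem (of_mem_measurableChains hσ)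
      (𝒯.approx_mem_measurableChains hr hinj hσ)) ?_)
    have : (fun t => lift (𝒯.approxHtpy r n) (boundary n (of (σ t)))) =
        ∑ i : Fin (n + 2), ((-1 : ℤ) ^ (i : ℕ)) •
          fun t => 𝒯.approxHtpy r n ((σ t).comp (faceMap i)) := by
      ext1 t
      simp [boundary_of]
    rw [this]
    exact sum_mem fun i _ => zsmul_mem (ih (hσ.comp (faceMap i))) _

end MeasurableTriangulation

namespace MeasurableTriangulation

variable {X : Type u} [TopologicalSpace X] [MeasurableSpace X] (𝒯 : MeasurableTriangulation X)
variable (Γ : Type v) [AddCommGroup Γ]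

/-! ### The comparison of singular and simplicial cochains -/

section Comparison

variable (r : X → ℝ)

/-- The restriction of singular cochains to the sorted simplices of a triangulation. -/
def restrict (n : ℕ) : (C(Simplex n, X) → Γ) →+ (𝒯.B n → Γ) where
  toFun ω b := lift ω (𝒯.sortedChain r b)
  map_zero' := by ext; simp [Triangulation.sortedChain]
  map_add' := by intros; ext; simp [Triangulation.sortedChain]

variable {Γ} {r}

theorem restrict_apply {n : ℕ} (ω : C(Simplex n, X) → Γ) (b : 𝒯.B n) :
    𝒯.restrict Γ r n ω b = lift ω (𝒯.sortedChain r b) := rfl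

theorem coboundary_restrict (hinj : Function.Injective r) {n : ℕ} (ω : C(Simplex n, X) → Γ) :
    𝒯.coboundary Γ n (𝒯.restrict Γ r n ω) =
      𝒯.restrict Γ r (n + 1) (singularCoboundary X Γ n ω) := by
  ext b
  rw [restrict_apply, lift_singularCoboundary, 𝒯.boundary_sortedChain hinj]
  simp [Triangulation.coboundary, restrict_apply]

/-- The extension of a simplicial cochain to singular simplices by simplicial approximation. -/
def extend {n : ℕ} (c : 𝒯.B n → Γ) (σ : C(Simplex n, X)) : Γ := 𝒯.hat c (𝒯.domTuple σ)

/-- Each vertex is its own dominant vertex, and the sign of the sorting permutation occurs twice. -/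
theorem restrict_extend {n : ℕ} (c : 𝒯.B n → Γ) : 𝒯.restrict Γ r n (𝒯.extend c) = c := by
  ext b
  have h : 𝒯.domTuple ((𝒯.simplex n b).comp (simplexMap (𝒯.sortPerm r b))) =
      𝒯.vert b ∘ 𝒯.sortPerm r b := by
    ext j
    simp only [Triangulation.domTuple, ContinuousMap.comp_apply, simplexMap_vertex]
    exact 𝒯.dom_vert b _
  rw [restrict_apply, Triangulation.sortedChain, map_zsmul, lift_apply_of, extend, h,
    𝒯.hat_vert_comp, smul_smul, Int.units_coe_mul_self, one_smul]

theorem singularCoboundary_extend {n : ℕ} (c : 𝒯.B n → Γ) {σ : C(Simplex (n + 1), X)}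
    (hσ : 𝒯.IsSmall σ) :
    singularCoboundary X Γ n (𝒯.extend c) σ = 𝒯.extend (𝒯.coboundary Γ n c) σ := by
  obtain ⟨m, b, hb⟩ := hσ.exists_domTuple_mem
  rw [extend, 𝒯.hat_coboundary c hb]
  simp only [singularCoboundary, AddMonoidHom.coe_mk, ZeroHom.coe_mk, extend,
    𝒯.domTuple_comp_faceMap]
  rfl

theorem restrict_eq_zero {n : ℕ} {ω : C(Simplex n, X) → Γ} (h : ∀ σ, 𝒯.IsSmall σ → ω σ = 0) :
    𝒯.restrict Γ r n ω = 0 := by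
  ext b
  rw [restrict_apply, Triangulation.sortedChain, map_zsmul, lift_apply_of,
    h _ ((𝒯.isSmall_simplex b).comp _ _), smul_zero]
  rfl

/-- The value of `ω` on an approximation is the alternating extension of its restriction. -/
theorem lift_approx {n : ℕ} {ω : C(Simplex n, X) → Γ} (h : 𝒯.restrict Γ r n ω = 0)
    (σ : C(Simplex n, X)) : lift ω (𝒯.approx r σ) = 0 := by
  rw [Triangulation.approx, 𝒯.map_hat (lift ω)]
  have : (fun b => lift ω (𝒯.sortedChain r b)) = (0 : 𝒯.B n → Γ) := h
  rw [this]
  unfold Triangulation.hat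
  split_ifs <;> simp

variable [MeasurableSpace Γ] [MeasurableAdd₂ Γ] [MeasurableNeg Γ]

theorem mem_coboundaries_of_small [StandardBorelSpace Γ] {n : ℕ}
    {ω : C(Simplex (n + 1), X) → Γ}
    (hω : ω ∈ singularCocycles X Γ (n + 1)) (h : ∀ σ, 𝒯.IsSmall σ → ω σ = 0) :
    ω ∈ singularCoboundaries X Γ (n + 1) :=
  ⟨𝒯.primitive ω, 𝒯.primitive_mem h hω.1, 𝒯.singularCoboundary_primitive h hω.2⟩

variable [StandardBorelSpace X]

theorem restrict_mem (hr : Measurable r) (hinj : Function.Injective r) {n : ℕ}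
    {ω : C(Simplex n, X) → Γ} (hω : ω ∈ singularCochains X Γ n) :
    𝒯.restrict Γ r n ω ∈ 𝒯.cochains Γ n :=
  measurable_lift_of_mem hω (𝒯.sortedChain_mem_measurableChains hr hinj n)

theorem extend_mem {n : ℕ} {c : 𝒯.B n → Γ} (hc : c ∈ 𝒯.cochains Γ n) :
    𝒯.extend c ∈ singularCochains X Γ n :=
  fun _ _ _ _ hσ => (𝒯.measurable_hat hc).comp (𝒯.measurable_domTuple hσ)

theorem restrict_mem_coboundaries (hr : Measurable r) (hinj : Function.Injective r) :
    ∀ {n : ℕ} {ω : C(Simplex n, X) → Γ}, ω ∈ singularCoboundaries X Γ n →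
      𝒯.restrict Γ r n ω ∈ 𝒯.coboundaries Γ n
  | 0, ω, hω => by
    rw [AddSubgroup.mem_bot.1 hω, map_zero]
    exact zero_mem _
  | n + 1, ω, hω => by
    obtain ⟨η, hη, rfl⟩ := hω
    exact ⟨_, 𝒯.restrict_mem hr hinj hη, 𝒯.coboundary_restrict hinj η⟩

theorem restrict_mem_cocycles (hr : Measurable r) (hinj : Function.Injective r)
    {n : ℕ} {ω : C(Simplex n, X) → Γ} (hω : ω ∈ singularCocycles X Γ n) :
    𝒯.restrict Γ r n ω ∈ 𝒯.cocycles Γ n := by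
  refine ⟨𝒯.restrict_mem hr hinj hω.1, ?_⟩
  have hω2 : singularCoboundary X Γ n ω = 0 := hω.2
  change 𝒯.coboundary Γ n _ = 0
  rw [𝒯.coboundary_restrict hinj, hω2, map_zero]

variable [StandardBorelSpace Γ]

/-- The extension of `c` may fail to be closed, but its coboundary vanishes on small simplices.
Subtracting the primitive of that coboundary closes it without changing its values on the
triangulation, whose simplices are small. -/
theorem exists_restrict_eq {n : ℕ} {c : 𝒯.B n → Γ} (hc : c ∈ 𝒯.cocycles Γ n) :
    ∃ ω ∈ singularCocycles X Γ n, 𝒯.restrict Γ r n ω = c := by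
  obtain ⟨hm, hker⟩ := AddSubgroup.mem_inf.1 hc
  have hker : 𝒯.coboundary Γ n c = 0 := hker
  set θ := singularCoboundary X Γ n (𝒯.extend c) with hθ
  have hsmall : ∀ σ, 𝒯.IsSmall σ → θ σ = 0 := by
    intro σ hσ
    rw [hθ, 𝒯.singularCoboundary_extend c hσ, hker, extend]
    unfold Triangulation.hat
    split_ifs <;> simp
  refine ⟨𝒯.extend c - 𝒯.primitive θ, AddSubgroup.mem_inf.2 ⟨sub_mem (𝒯.extend_mem hm)
    (𝒯.primitive_mem hsmall (singularCoboundary_mem (𝒯.extend_mem hm))), ?_⟩, ?_⟩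
  · rw [AddMonoidHom.mem_ker, map_sub, 𝒯.singularCoboundary_primitive hsmall
      (singularCoboundary_singularCoboundary _), sub_self]
  · rw [map_sub, 𝒯.restrict_extend, 𝒯.restrict_eq_zero fun σ => 𝒯.primitive_eq_zero hsmall,
      sub_zero]

/-- On a small simplex the homotopy formula gives `ω = δη`, where `η` is `ω` evaluated on
`approxHtpy`: the approximation term vanishes by `lift_approx`. So `ω - δη` is a cocycle that
vanishes on small simplices. In degree zero all simplices are small and `ω` itself is zero. -/
theorem mem_coboundaries_of_restrict_eq_zero (hr : Measurable r) (hinj : Function.Injective r) :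
    ∀ {n : ℕ} {ω : C(Simplex n, X) → Γ}, ω ∈ singularCocycles X Γ n →
      𝒯.restrict Γ r n ω = 0 → ω ∈ singularCoboundaries X Γ n
  | 0, ω, hω, h => by
    have hω2 : singularCoboundary X Γ 0 ω = 0 := hω.2
    refine AddSubgroup.mem_bot.2 (funext fun σ => ?_)
    have h1 := congrArg (lift ω) (𝒯.boundary_approxHtpy_zero (r := r) σ)
    rw [← lift_singularCoboundary, hω2, map_sub, lift_apply_of, 𝒯.lift_approx h, sub_zero] at h1
    rw [← h1]
    exact DFunLike.congr_fun (lift_ext (lift 0) (0 : Chain X 1 →+ Γ) fun _ => by simp) _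
  | n + 1, ω, hω, h => by
    have hω2 : singularCoboundary X Γ (n + 1) ω = 0 := hω.2
    set η : C(Simplex n, X) → Γ := fun σ => lift ω (𝒯.approxHtpy r n σ) with hη
    have hηm : η ∈ singularCochains X Γ n := fun T _ _ σ hσ =>
      measurable_lift_of_mem hω.1 (𝒯.approxHtpy_mem_measurableChains hr hinj hσ)
    have hηc : singularCoboundary X Γ n η ∈ singularCoboundaries X Γ (n + 1) := ⟨η, hηm, rfl⟩
    have hsub : ω - singularCoboundary X Γ n η ∈ singularCocycles X Γ (n + 1) :=
      sub_mem hω (singularCoboundary_mem_cocycles hηm)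
    have hs := 𝒯.mem_coboundaries_of_small hsub fun σ hσ => by
      have h1 := congrArg (lift ω) (𝒯.boundary_approxHtpy hinj hσ)
      rw [← lift_singularCoboundary, hω2, map_sub, map_sub, lift_apply_of, 𝒯.lift_approx h,
        sub_zero] at h1
      have h2 : singularCoboundary X Γ n η σ =
          lift ω (lift (𝒯.approxHtpy r n) (boundary n (of σ))) := by
        rw [singularCoboundary_apply]
        exact DFunLike.congr_fun (lift_ext (lift η) ((lift ω).comp (lift (𝒯.approxHtpy r n)))
          fun _ => by simp [hη]) _
      rw [Pi.sub_apply, h2, ← h1]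
      exact DFunLike.congr_fun (lift_ext (lift 0) (0 : Chain X (n + 2) →+ Γ) fun _ => by simp) _
    simpa using add_mem hs hηc

/-- Subtracting the coboundary of the extension of a simplicial primitive reduces to zero
restriction. -/
theorem mem_coboundaries_of_restrict_mem (hr : Measurable r) (hinj : Function.Injective r)
    {n : ℕ} {ω : C(Simplex n, X) → Γ} (hω : ω ∈ singularCocycles X Γ n)
    (h : 𝒯.restrict Γ r n ω ∈ 𝒯.coboundaries Γ n) : ω ∈ singularCoboundaries X Γ n := by
  cases n with
  | zero => exact 𝒯.mem_coboundaries_of_restrict_eq_zero hr hinj hω (AddSubgroup.mem_bot.1 h)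
  | succ n =>
    obtain ⟨d, hd, hdω⟩ := h
    have h1 : singularCoboundary X Γ n (𝒯.extend d) ∈ singularCoboundaries X Γ (n + 1) :=
      ⟨_, 𝒯.extend_mem hd, rfl⟩
    have h2 : ω - singularCoboundary X Γ n (𝒯.extend d) ∈ singularCocycles X Γ (n + 1) :=
      sub_mem hω (singularCoboundary_mem_cocycles (𝒯.extend_mem hd))
    have h3 := 𝒯.mem_coboundaries_of_restrict_eq_zero hr hinj h2 (by
      rw [map_sub, ← 𝒯.coboundary_restrict hinj, 𝒯.restrict_extend, hdω, sub_self])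
    simpa using add_mem h3 h1

end Comparison

theorem nonempty_cohomology_addEquiv [StandardBorelSpace X] [MeasurableSpace Γ]
    [StandardBorelSpace Γ] [MeasurableAdd₂ Γ] [MeasurableNeg Γ] (n : ℕ) :
    Nonempty (SingularCohomology X Γ n ≃+ 𝒯.Cohomology Γ n) := by
  -- A Borel embedding into `ℝ` supplies a measurable linear order of all vertices at once.
  have he := MeasureTheory.measurableEmbedding_embeddingReal X
  set r := MeasureTheory.embeddingReal X
  let φ : singularCocycles X Γ n →+ 𝒯.cocycles Γ n :=
    ((𝒯.restrict Γ r n).comp (singularCocycles X Γ n).subtype).codRestrict _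
      fun ω => 𝒯.restrict_mem_cocycles he.measurable he.injective ω.2
  have hφ (ω) : (φ ω : 𝒯.B n → Γ) = 𝒯.restrict Γ r n ω := rfl
  let Φ : SingularCohomology X Γ n →+ 𝒯.Cohomology Γ n := QuotientAddGroup.map _ _ φ fun ω hω =>
    𝒯.restrict_mem_coboundaries he.measurable he.injective hω
  refine ⟨AddEquiv.ofBijective Φ ⟨(injective_iff_map_eq_zero Φ).2 ?_, ?_⟩⟩
  · intro x hx
    obtain ⟨ω, rfl⟩ := QuotientAddGroup.mk_surjective x
    have h1 : φ ω ∈ (𝒯.coboundaries Γ n).addSubgroupOf (𝒯.cocycles Γ n) :=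
      (QuotientAddGroup.eq_zero_iff _).1 hx
    exact (QuotientAddGroup.eq_zero_iff _).2
      (𝒯.mem_coboundaries_of_restrict_mem he.measurable he.injective ω.2 h1)
  · intro y
    obtain ⟨c, rfl⟩ := QuotientAddGroup.mk_surjective y
    obtain ⟨ω, hω, h⟩ := 𝒯.exists_restrict_eq (r := r) c.2
    exact ⟨QuotientAddGroup.mk ⟨ω, hω⟩, congrArg QuotientAddGroup.mk (Subtype.ext h)⟩

end MeasurableTriangulation

end MTSpace

end

/-! ### The comparison theorem and independence of the triangulation -/

theorem mainTheorem4 {X : Type u} [TopologicalSpace X] [MeasurableSpace X]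
    (hX : MTSpace.IsMeasurableLamination X)
    {Γ : Type v} [AddCommGroup Γ] [MeasurableSpace Γ] [StandardBorelSpace Γ]
    [MeasurableAdd₂ Γ] [MeasurableNeg Γ] :
    (∀ (𝒯 : MTSpace.MeasurableTriangulation X) (n : ℕ),
      Nonempty (MTSpace.SingularCohomology X Γ n ≃+ 𝒯.Cohomology Γ n)) ∧
    (∀ (𝒯 𝒯' : MTSpace.MeasurableTriangulation X) (n : ℕ),
      Nonempty (𝒯.Cohomology Γ n ≃+ 𝒯'.Cohomology Γ n)) := by
  have := hX.standardBorelSpace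
  have h (𝒯 : MTSpace.MeasurableTriangulation X) (n : ℕ) :=
    𝒯.nonempty_cohomology_addEquiv (Γ := Γ) n
  refine ⟨h, fun 𝒯 𝒯' n => ?_⟩
  obtain ⟨e⟩ := h 𝒯 n
  obtain ⟨e'⟩ := h 𝒯' n
  exact ⟨e.symm.trans e'⟩
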